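/- Let $d\in\{2,3\}$, let $\alpha\ge 1$ and $\epsilon\in(0,1)$ be constants, and let $s>\frac d2$, $r>\frac d2+s+100$ be real numbers. Consider on $[0,\infty)\times\mathbb R^d$ the regularized magnetic Zakharov system $$\begin{aligned} & iE_t+i\epsilon^2\Delta^2E_t+\nabla(\nabla\cdot E)-\alpha\nabla\times(\nabla\times E)-nE+iE\times B=0,\\ & n_{tt}-\Delta n=\Delta|E|^2,\\ & B_{tt}+\Delta^2B-\Delta B=-i\Delta^2(E\times\overline E), \end{aligned}\tag{3.1}$$ with unknowns $E(t,x)\in\mathbb C^3$, $n(t,x)\in\mathbb R$, $B(t,x)\in\mathbb R^3$ and initial data $$E(0)=E_0,\quad n(0)=n_0,\quad n_t(0)=n_1,\quad B(0)=B_0,\quad B_t(0)=B_1 .$$ If $d=2$, fields depend on $(x_1,x_2)$ only (so $\partial_3=0$), and $E$, $E_0$ are of the form $(E_1,E_2,0)$ and $B$, $B_0$, $B_1$ of the form $(0,0,B_3)$. A solution means functions with $E\in C^1([0,\infty);H^4)$ and $n,B\in C^2([0,\infty);L^2)$ such that, for every $t\ge0$, $E(t)$, $E_t(t)$ and $B(t)$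 are $C^4$, $n(t)$ is $C^2$ and $n_t(t)$, $B_t(t)$ are continuous in $x$, the equations (3.1) hold at every point of $[0,\infty)\times\mathbb R^d$, and the initial data are attained almost everywhere on $\mathbb R^d$. **Theorem 3.1.** Let $E_0\in H^{r+1}$, $n_0\in H^r$, $n_1\in H^{r-1}\cap\dot H^{-1}$, $B_0\in H^{r-1}\cap\dot H^{-1}$, $B_1\in H^{r-3}\cap\dot H^{-2}$, where $n_0,n_1,B_0,B_1$ are real-valued. Then (3.1) has a solution $(E,n,B)$, global in time, with $$(E,n,B)\in C\big([0,\infty);H^{r+1}\oplus H^r\oplus H^{r-1}\big),$$ and it is the only solution in this class. It is smooth in the sense that moreover $$E\in C^1([0,\infty);H^{r+1}),\qquad n\in C^1([0,\infty);H^{r-1})\cap C^2([0,\infty);H^{r-2}),\qquad B\in C^1([0,\infty);H^{r-3})\cap C^2([0,\infty);H^{r-5}).$$ -/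

import Mathlib

open MeasureTheory Set Filter
open scoped Topology ENNReal FourierTransform Matrix

noncomputable section

namespace MagneticZakharov

/-- The physical space `ℝ^d` with its Euclidean norm. -/
abbrev Space (d : ℕ) : Type := EuclideanSpace ℝ (Fin d)

variable {d : ℕ}

/-! ### Sobolev spaces -/

open Classical in
/-- The inhomogeneous norm `‖(1 + |ξ|²)^{s/2} f̂‖_{L²}` of a function `f` in `L²`, where `f̂` is the
`L²` Fourier transform; `∞` if `f` is not in `L²` (only used for `s ≥ 0`, where `H^s ⊆ L²`).
The transform is normalised with the kernel `exp (-2πi x·ξ)`, which gives an equivalent norm. -/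
def sobolevNorm (s : ℝ) (f : Space d → ℂ) : ℝ≥0∞ :=
  if h : MemLp f 2 volume then
    eLpNorm (fun ξ : Space d => ((1 + ‖ξ‖ ^ 2) ^ (s / 2) : ℝ) • (𝓕 (h.toLp f)) ξ) 2 volume
  else ∞

open Classical in
/-- The homogeneous norm `‖|ξ|^s f̂‖_{L²}` of a function `f` in `L²`; `∞` if `f` is not in `L²`
(only used for functions that lie in `L²` as well). -/
def homogeneousNorm (s : ℝ) (f : Space d → ℂ) : ℝ≥0∞ :=
  if h : MemLp f 2 volume then
    eLpNorm (fun ξ : Space d => (‖ξ‖ ^ s : ℝ) • (𝓕 (h.toLp f)) ξ) 2 volume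
  else ∞

/-- `f ∈ H^s`, for `s ≥ 0`. -/
def MemH (s : ℝ) (f : Space d → ℂ) : Prop := sobolevNorm s f < ∞

/-- `f ∈ L² ∩ Ḣ^s`. -/
def MemHdot (s : ℝ) (f : Space d → ℂ) : Prop := homogeneousNorm s f < ∞

/-! ### Curves in Sobolev spaces

A time dependent function is a map `u : ℝ → Space d → ℂ` of which only the values at times `t ≥ 0`
matter. -/

/-- `u ∈ C([0,∞); H^s)`. -/
def ContInH (s : ℝ) (u : ℝ → Space d → ℂ) : Prop :=
  ∀ t, 0 ≤ t → MemH s (u t) ∧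
    Tendsto (fun τ => sobolevNorm s (fun x => u τ x - u t x)) (𝓝[Ici 0] t) (𝓝 0)

/-- `u ∈ C¹([0,∞); H^s)` with time derivative `u'` (one-sided at `t = 0`). -/
def C1InH (s : ℝ) (u u' : ℝ → Space d → ℂ) : Prop :=
  ContInH s u ∧ ContInH s u' ∧
    ∀ t, 0 ≤ t →
      Tendsto (fun τ => sobolevNorm s (fun x => (τ - t)⁻¹ • (u τ x - u t x) - u' t x))
        (𝓝[Ici 0 \ {t}] t) (𝓝 0)

/-! ### Vector calculus

Vector fields always have three components; if `d = 2` they do not depend on `x₃`. -/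

/-- The partial derivative `∂_j`, with `∂_j = 0` for `j` beyond the dimension of the space. -/
def partialD (j : Fin 3) (f : Space d → ℂ) (x : Space d) : ℂ :=
  if h : (j : ℕ) < d then fderiv ℝ f x (EuclideanSpace.single (⟨j, h⟩ : Fin d) (1 : ℝ)) else 0

def grad (f : Space d → ℂ) (x : Space d) : Fin 3 → ℂ := fun j => partialD j f x

def divergence (F : Space d → Fin 3 → ℂ) (x : Space d) : ℂ :=
  ∑ j, partialD j (fun y => F y j) x

def curl (F : Space d → Fin 3 → ℂ) (x : Space d) : Fin 3 → ℂ :=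
  ![partialD 1 (fun y => F y 2) x - partialD 2 (fun y => F y 1) x,
    partialD 2 (fun y => F y 0) x - partialD 0 (fun y => F y 2) x,
    partialD 0 (fun y => F y 1) x - partialD 1 (fun y => F y 0) x]

/-- The Laplacian `Δ = ∑_j ∂_j²`, applied componentwise to vector valued functions. -/
def lap {V : Type*} [NormedAddCommGroup V] [NormedSpace ℝ V] (f : Space d → V) : Space d → V :=
  Laplacian.laplacian f

/-- A real vector field regarded as a complex one. -/
def complexify (B : Space d → Fin 3 → ℝ) (x : Space d) : Fin 3 → ℂ := fun i => (B x i : ℂ)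

/-- `|E|²`. -/
def normSq (E : Space d → Fin 3 → ℂ) (x : Space d) : ℝ := ∑ i, ‖E x i‖ ^ 2

/-- `E × Ē`. -/
def crossConj (E : Space d → Fin 3 → ℂ) (x : Space d) : Fin 3 → ℂ := E x ⨯₃ star (E x)

/-! ### The regularized system -/

/-- The unknowns `E`, `n`, `B` of the system, together with (candidates for) their time derivatives
`E_t`, `n_t`, `n_tt`, `B_t`, `B_tt`. -/
structure Fields (d : ℕ) where
  E : ℝ → Space d → Fin 3 → ℂ
  Et : ℝ → Space d → Fin 3 → ℂ
  n : ℝ → Space d → ℝ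
  nt : ℝ → Space d → ℝ
  ntt : ℝ → Space d → ℝ
  B : ℝ → Space d → Fin 3 → ℝ
  Bt : ℝ → Space d → Fin 3 → ℝ
  Btt : ℝ → Space d → Fin 3 → ℝ

/-- The initial data `E(0)`, `n(0)`, `n_t(0)`, `B(0)`, `B_t(0)`. -/
structure Data (d : ℕ) where
  E₀ : Space d → Fin 3 → ℂ
  n₀ : Space d → ℝ
  n₁ : Space d → ℝ
  B₀ : Space d → Fin 3 → ℝ
  B₁ : Space d → Fin 3 → ℝ

/-- In dimension two the fields have the form `E = (E₁, E₂, 0)`, `B = (0, 0, B₃)`. -/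
def PlanarForm (d : ℕ) (E : Fin 3 → ℂ) (B : Fin 3 → ℝ) : Prop :=
  d = 2 → E 2 = 0 ∧ B 0 = 0 ∧ B 1 = 0

/-- The hypotheses on the initial data: `E₀ ∈ H^{r+1}`, `n₀ ∈ H^r`, `n₁ ∈ H^{r-1} ∩ Ḣ^{-1}`,
`B₀ ∈ H^{r-1} ∩ Ḣ^{-1}`, `B₁ ∈ H^{r-3} ∩ Ḣ^{-2}`. -/
structure Data.Admissible (D : Data d) (r : ℝ) : Prop where
  memE₀ : ∀ i, MemH (r + 1) (fun x => D.E₀ x i)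
  memn₀ : MemH r (fun x => (D.n₀ x : ℂ))
  memn₁ : MemH (r - 1) (fun x => (D.n₁ x : ℂ))
  memn₁' : MemHdot (-1) (fun x => (D.n₁ x : ℂ))
  memB₀ : ∀ i, MemH (r - 1) (fun x => (D.B₀ x i : ℂ))
  memB₀' : ∀ i, MemHdot (-1) (fun x => (D.B₀ x i : ℂ))
  memB₁ : ∀ i, MemH (r - 3) (fun x => (D.B₁ x i : ℂ))
  memB₁' : ∀ i, MemHdot (-2) (fun x => (D.B₁ x i : ℂ))
  planar₀ : ∀ᵐ x, PlanarForm d (D.E₀ x) (D.B₀ x)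
  planar₁ : ∀ᵐ x, PlanarForm d (D.E₀ x) (D.B₁ x)

/-- The time derivatives of `u` are what they are called: `E ∈ C¹([0,∞); H^a)`,
`n ∈ C¹([0,∞); H^b)`, `n_t ∈ C¹([0,∞); H^{b'})`, `B ∈ C¹([0,∞); H^c)`,
`B_t ∈ C¹([0,∞); H^{c'})`. -/
structure Fields.TimeRegular (u : Fields d) (a b b' c c' : ℝ) : Prop where
  derivE : ∀ i, C1InH a (fun t x => u.E t x i) (fun t x => u.Et t x i)
  derivn : C1InH b (fun t x => (u.n t x : ℂ)) (fun t x => (u.nt t x : ℂ))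
  derivnt : C1InH b' (fun t x => (u.nt t x : ℂ)) (fun t x => (u.ntt t x : ℂ))
  derivB : ∀ i, C1InH c (fun t x => (u.B t x i : ℂ)) (fun t x => (u.Bt t x i : ℂ))
  derivBt : ∀ i, C1InH c' (fun t x => (u.Bt t x i : ℂ)) (fun t x => (u.Btt t x i : ℂ))

/-- `(E, n, B) ∈ C([0,∞); H^{r+1} ⊕ H^r ⊕ H^{r-1})`. -/
structure Fields.InClass (u : Fields d) (r : ℝ) : Prop where
  contE : ∀ i, ContInH (r + 1) (fun t x => u.E t x i)
  contn : ContInH r (fun t x => (u.n t x : ℂ))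
  contB : ∀ i, ContInH (r - 1) (fun t x => (u.B t x i : ℂ))

/-- The functions `u` have the classical spatial derivatives that occur in the regularized system,
satisfy the three equations at every point of `[0,∞) × ℝ^d`, and attain the initial data. -/
structure Fields.Solves (u : Fields d) (α ε : ℝ) (D : Data d) : Prop where
  smoothE : ∀ t, 0 ≤ t → ContDiff ℝ 4 (u.E t)
  smoothEt : ∀ t, 0 ≤ t → ContDiff ℝ 4 (u.Et t)
  smoothn : ∀ t, 0 ≤ t → ContDiff ℝ 2 (u.n t)
  contnt : ∀ t, 0 ≤ t → Continuous (u.nt t)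
  smoothB : ∀ t, 0 ≤ t → ContDiff ℝ 4 (u.B t)
  contBt : ∀ t, 0 ≤ t → Continuous (u.Bt t)
  planar : ∀ t, 0 ≤ t → ∀ x, PlanarForm d (u.E t x) (u.B t x)
  eqE : ∀ t, 0 ≤ t → ∀ x,
    Complex.I • u.Et t x + (Complex.I * (ε : ℂ) ^ 2) • lap (lap (u.Et t)) x
      + grad (divergence (u.E t)) x - (α : ℂ) • curl (curl (u.E t)) x
      - (u.n t x : ℂ) • u.E t x + Complex.I • (u.E t x ⨯₃ complexify (u.B t) x) = 0
  eqn : ∀ t, 0 ≤ t → ∀ x,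
    u.ntt t x - lap (u.n t) x = lap (normSq (u.E t)) x
  eqB : ∀ t, 0 ≤ t → ∀ x,
    complexify (u.Btt t) x + lap (lap (complexify (u.B t))) x - lap (complexify (u.B t)) x
      = -Complex.I • lap (lap (crossConj (u.E t))) x
  initE : u.E 0 =ᵐ[volume] D.E₀
  initn : u.n 0 =ᵐ[volume] D.n₀
  initnt : u.nt 0 =ᵐ[volume] D.n₁
  initB : u.B 0 =ᵐ[volume] D.B₀
  initBt : u.Bt 0 =ᵐ[volume] D.B₁

end MagneticZakharov

end

open MagneticZakharov

/-!
The regularization `1 + ε² Δ²` in front of `E_t` turns the system into an ordinary differential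
equation. Indeed `E_t = i (1 + ε² Δ²)⁻¹ (∇ div E - α curl curl E - n E + i E × B)`, and the inverse
gains four derivatives, so that with `E ∈ H^{ρ+1}`, `n ∈ H^ρ`, `B ∈ H^{ρ-1}` the right-hand side is
again in `H^{ρ+1}`. The two wave equations have the form `p_tt = -θ² p - θ G`, with `θ = |∇|`,
`G = |∇| |E|²` for `p = n` and with `θ = (Δ² - Δ)^{1/2}`, `G = i θ⁻¹ Δ² (E × Ē)` for `p = B`. They are
the real parts of `z_t = -i θ z - i G` for `z = p + i θ⁻¹ p_t`, where the conditions
`n_1 ∈ Ḣ^{-1}` and `B_1 ∈ Ḣ^{-2}` make `θ⁻¹ p_t` square integrable at time `0`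
(`Dispersion.exists_div`). Removing the free oscillation `exp (-i t θ)` from `z` leaves an equation
for `(E, z_n, z_B)` whose vector field `stateField` is Lipschitz on bounded sets of
`H^{ρ+1} × H^ρ × H^{ρ-1}`, because `G` has the regularity of `p` in both cases.

Global existence (`exists_state`) follows from an a priori bound (`state_apriori`). The mass
`∫ |E|² + ε² |ΔE|²` is conserved (`inner_elec_eq_zero`) and bounds `E` in `H²`, an algebra in
dimensions `d ≤ 3`; hence `z_n` and `z_B` grow at most linearly in `L²`, and the tame product
estimates (`norm_elec_le`, `norm_jop_quad_le`), in which the top norm enters linearly, allow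
Gronwall's lemma at top order. The bounds are insensitive to multiplying the vector field by a factor
`χ(t) ∈ [0, 1]`, so they apply to truncations of the equation, which exist for all times
(`BddLip.exists_global`). The planar form is preserved because it is the fixed point set of a symmetry
(`state_planar`).

For uniqueness a solution of the system, with time derivatives that are only assumed in weak norms,
is turned into a curve of states which solves the same ordinary differential equation
(`exists_state_of_solves`). The equation identifies `E_t` with the element `elec` of `H^{ρ+1}`, once the
classical `Δ² E_t` is known to be the expected multiplier (`isLift_lap`), and a function which
is differentiable in a weak norm with a derivative that is continuous in a strong one is differentiable
in the latter (`hasDerivWithinAt_of_injective`). The component `θ⁻¹ p_t` is recovered by integrating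
`-θ p - G` in time (`Dispersion.exists_interaction`). This costs up to four derivatives, so the curves
are compared at the level `ρ = r - 4`.

Everything takes place on the Fourier side. All spaces `H^σ` are modelled on `L²`: an element `f` of
`L²` at level `σ` stands for the function `phys σ f` with the Fourier transform
`(1 + |ξ|²)^{-σ/2} f`, differential operators are bounded multipliers `mulOp`, and products are
bounded bilinear maps `convOp`. The relation `IsLift s f F` connects functions on `ℝ^d` with this
model.
-/

open MeasureTheory Set Filter
open scoped Topology ENNReal FourierTransform Matrix

noncomputable section

namespace MagneticZakharov

variable {d : ℕ}


/-! ### Bounded symbols and multiplication operators on `L²` -/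

/-- The space `L²(ℝ^d; ℂ)`, used for (weighted) Fourier transforms. -/
abbrev L2 (d : ℕ) : Type := Lp ℂ 2 (volume : Measure (Space d))

/-- The weight `(1 + |ξ|²)^{s/2}`. -/
def jb (s : ℝ) (ξ : Space d) : ℝ := (1 + ‖ξ‖ ^ 2) ^ (s / 2)

lemma one_le_base (ξ : Space d) : 1 ≤ 1 + ‖ξ‖ ^ 2 := by nlinarith [sq_nonneg ‖ξ‖]

lemma base_pos (ξ : Space d) : 0 < 1 + ‖ξ‖ ^ 2 := lt_of_lt_of_le one_pos (one_le_base ξ)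

lemma jb_pos (s : ℝ) (ξ : Space d) : 0 < jb s ξ := Real.rpow_pos_of_pos (base_pos ξ) _

lemma jb_nonneg (s : ℝ) (ξ : Space d) : 0 ≤ jb s ξ := (jb_pos s ξ).le

lemma jb_ne (s : ℝ) (ξ : Space d) : jb s ξ ≠ 0 := (jb_pos s ξ).ne'

lemma jb_add (s t : ℝ) (ξ : Space d) : jb (s + t) ξ = jb s ξ * jb t ξ := by
  unfold jb; rw [← Real.rpow_add (base_pos ξ)]; ring_nf

lemma jb_zero (ξ : Space d) : jb 0 ξ = 1 := by simp [jb]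

lemma jb_neg (s : ℝ) (ξ : Space d) : jb (-s) ξ = (jb s ξ)⁻¹ := by
  unfold jb; rw [← Real.rpow_neg (base_pos ξ).le]; ring_nf

lemma jb_mono {s t : ℝ} (h : s ≤ t) (ξ : Space d) : jb s ξ ≤ jb t ξ :=
  Real.rpow_le_rpow_of_exponent_le (one_le_base ξ) (by linarith)

lemma jb_le_one {s : ℝ} (h : s ≤ 0) (ξ : Space d) : jb s ξ ≤ 1 :=
  (jb_mono h ξ).trans_eq (jb_zero ξ)

lemma one_le_jb {s : ℝ} (h : 0 ≤ s) (ξ : Space d) : 1 ≤ jb s ξ :=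
  (jb_zero ξ).symm.trans_le (jb_mono h ξ)

lemma jb_two (ξ : Space d) : jb 2 ξ = 1 + ‖ξ‖ ^ 2 := by simp [jb]

lemma jb_one_sq (ξ : Space d) : jb 1 ξ ^ 2 = 1 + ‖ξ‖ ^ 2 := by
  rw [← jb_two, show (2 : ℝ) = 1 + 1 by norm_num, jb_add, sq]

lemma norm_le_jb_one (ξ : Space d) : ‖ξ‖ ≤ jb 1 ξ := by
  have h := jb_one_sq ξ
  nlinarith [jb_pos 1 ξ, norm_nonneg ξ]

lemma jb_neg_arg (s : ℝ) (ξ : Space d) : jb s (-ξ) = jb s ξ := by simp [jb]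

@[fun_prop]
lemma continuous_jb (s : ℝ) : Continuous (jb (d := d) s) := by
  unfold jb
  exact Continuous.rpow_const (by fun_prop) (fun ξ => Or.inl (base_pos ξ).ne')

@[fun_prop]
lemma measurable_jb (s : ℝ) : Measurable (jb (d := d) s) := (continuous_jb s).measurable

/-- A bounded measurable symbol. -/
def BddSym (m : Space d → ℂ) : Prop := Measurable m ∧ ∃ C : ℝ, ∀ ξ, ‖m ξ‖ ≤ C

lemma BddSym.of_le {m : Space d → ℂ} (hm : Measurable m) (C : ℝ) (h : ∀ ξ, ‖m ξ‖ ≤ C) :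
    BddSym m := ⟨hm, C, h⟩

lemma BddSym.mul {m m' : Space d → ℂ} (h : BddSym m) (h' : BddSym m') :
    BddSym (fun ξ => m ξ * m' ξ) := by
  obtain ⟨hm, C, hC⟩ := h
  obtain ⟨hm', C', hC'⟩ := h'
  refine ⟨hm.mul hm', C * C', fun ξ => ?_⟩
  rw [norm_mul]
  exact mul_le_mul (hC ξ) (hC' ξ) (norm_nonneg _) ((norm_nonneg _).trans (hC ξ))

lemma BddSym.add {m m' : Space d → ℂ} (h : BddSym m) (h' : BddSym m') :
    BddSym (fun ξ => m ξ + m' ξ) := by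
  obtain ⟨hm, C, hC⟩ := h
  obtain ⟨hm', C', hC'⟩ := h'
  exact ⟨hm.add hm', C + C', fun ξ => (norm_add_le _ _).trans (add_le_add (hC ξ) (hC' ξ))⟩

lemma bddSym_const (c : ℂ) : BddSym (fun _ : Space d => c) :=
  ⟨measurable_const, ‖c‖, fun _ => le_rfl⟩

lemma bddSym_jb {s : ℝ} (h : s ≤ 0) : BddSym (fun ξ : Space d => (jb s ξ : ℂ)) := by
  refine ⟨by fun_prop, 1, fun ξ => ?_⟩
  rw [Complex.norm_real, Real.norm_of_nonneg (jb_nonneg s ξ)]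
  exact jb_le_one h ξ

lemma BddSym.memLp_mul {m : Space d → ℂ} (h : BddSym m) (f : L2 d) :
    MemLp (fun ξ => m ξ * f ξ) 2 volume := by
  obtain ⟨hm, C, hC⟩ := h
  refine MemLp.of_le_mul (c := C) (Lp.memLp f)
    (hm.aestronglyMeasurable.mul (Lp.aestronglyMeasurable f)) (ae_of_all _ fun ξ => ?_)
  rw [norm_mul]
  exact mul_le_mul_of_nonneg_right (hC ξ) (norm_nonneg _)

open Classical in
/-- Multiplication by a symbol `m`, as a bounded operator on `L²`; by convention it is `0` if `m` is
not a bounded measurable function. It is regarded as a real linear operator, because it is composed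
with complex conjugations. -/
def mulOp (m : Space d → ℂ) : L2 d →L[ℝ] L2 d :=
  if h : BddSym m then
    LinearMap.mkContinuous
      { toFun := fun f => (h.memLp_mul f).toLp
        map_add' := fun f g => by
          rw [← MemLp.toLp_add, MemLp.toLp_eq_toLp_iff]
          filter_upwards [Lp.coeFn_add f g] with ξ hξ
          simp only [hξ, Pi.add_apply, mul_add]
        map_smul' := fun c f => by
          rw [RingHom.id_apply, ← MemLp.toLp_const_smul, MemLp.toLp_eq_toLp_iff]
          filter_upwards [Lp.coeFn_smul c f] with ξ hξ
          simp only [hξ, Pi.smul_apply, mul_smul_comm] }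
      h.2.choose (fun f => by
        refine Lp.norm_le_mul_norm_of_ae_le_mul ?_
        filter_upwards [(h.memLp_mul f).coeFn_toLp] with ξ hξ
        simp only [LinearMap.coe_mk, AddHom.coe_mk, hξ, norm_mul]
        exact mul_le_mul_of_nonneg_right (h.2.choose_spec ξ) (norm_nonneg _))
  else 0

lemma mulOp_ae {m : Space d → ℂ} (h : BddSym m) (f : L2 d) :
    mulOp m f =ᵐ[volume] fun ξ => m ξ * f ξ := by
  rw [mulOp, dif_pos h]
  exact (h.memLp_mul f).coeFn_toLp

lemma norm_mulOp_le {m : Space d → ℂ} (h : BddSym m) {C : ℝ} (hC : ∀ ξ, ‖m ξ‖ ≤ C) (f : L2 d) :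
    ‖mulOp m f‖ ≤ C * ‖f‖ := by
  refine Lp.norm_le_mul_norm_of_ae_le_mul ?_
  filter_upwards [mulOp_ae h f] with ξ hξ
  rw [hξ, norm_mul]
  exact mul_le_mul_of_nonneg_right (hC ξ) (norm_nonneg _)

/-- Comparison of two multiplication operators through a pointwise comparison of the symbols. -/
lemma norm_mulOp_le_mulOp {m m' : Space d → ℂ} (h : BddSym m) (h' : BddSym m') {C : ℝ}
    (hC : ∀ ξ, ‖m ξ‖ ≤ C * ‖m' ξ‖) (f : L2 d) : ‖mulOp m f‖ ≤ C * ‖mulOp m' f‖ := by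
  refine Lp.norm_le_mul_norm_of_ae_le_mul ?_
  filter_upwards [mulOp_ae h f, mulOp_ae h' f] with ξ hξ hξ'
  rw [hξ, hξ', norm_mul, norm_mul, ← mul_assoc]
  exact mul_le_mul_of_nonneg_right (hC ξ) (norm_nonneg _)

lemma mulOp_mulOp {m m' : Space d → ℂ} (h : BddSym m) (h' : BddSym m') (f : L2 d) :
    mulOp m (mulOp m' f) = mulOp (fun ξ => m ξ * m' ξ) f := by
  refine Lp.ext ?_
  filter_upwards [mulOp_ae h (mulOp m' f), mulOp_ae h' f, mulOp_ae (h.mul h') f] with ξ h1 h2 h3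
  rw [h1, h2, h3, mul_assoc]

lemma mulOp_mulOp_eq {m m' m'' : Space d → ℂ} (h : BddSym m) (h' : BddSym m')
    (hm : ∀ ξ, m ξ * m' ξ = m'' ξ) (f : L2 d) : mulOp m (mulOp m' f) = mulOp m'' f := by
  rw [mulOp_mulOp h h', funext hm]

lemma mulOp_comm {m m' : Space d → ℂ} (h : BddSym m) (h' : BddSym m') (f : L2 d) :
    mulOp m (mulOp m' f) = mulOp m' (mulOp m f) := by
  rw [mulOp_mulOp h h', mulOp_mulOp h' h]
  simp only [mul_comm]

lemma mulOp_add_sym {m m' : Space d → ℂ} (h : BddSym m) (h' : BddSym m') (f : L2 d) :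
    mulOp (fun ξ => m ξ + m' ξ) f = mulOp m f + mulOp m' f := by
  refine Lp.ext ?_
  filter_upwards [mulOp_ae h f, mulOp_ae h' f, mulOp_ae (h.add h') f,
    Lp.coeFn_add (mulOp m f) (mulOp m' f)] with ξ h1 h2 h3 h4
  rw [h4, Pi.add_apply, h1, h2, h3, add_mul]

lemma mulOp_const (c : ℂ) (f : L2 d) : mulOp (fun _ => c) f = c • f := by
  refine Lp.ext ?_
  filter_upwards [mulOp_ae (bddSym_const c) f, Lp.coeFn_smul c f] with ξ h1 h2
  rw [h1, h2, Pi.smul_apply, smul_eq_mul]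

lemma mulOp_smul {m : Space d → ℂ} (h : BddSym m) (c : ℂ) (f : L2 d) :
    mulOp m (c • f) = c • mulOp m f := by
  rw [← mulOp_const, mulOp_comm h (bddSym_const c), mulOp_const]

lemma mulOp_eq_self {m : Space d → ℂ} (hm : ∀ ξ, m ξ = 1) (f : L2 d) : mulOp m f = f := by
  rw [funext hm, mulOp_const, one_smul]

lemma mulOp_injective {m : Space d → ℂ} (h : BddSym m) (h0 : ∀ᵐ ξ, m ξ ≠ 0) :
    Function.Injective (mulOp m) := by
  intro f g hfg
  refine Lp.ext ?_
  have h1 := mulOp_ae h f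
  rw [hfg] at h1
  filter_upwards [h1, mulOp_ae h g, h0] with ξ h1 h2 h3
  exact mul_left_cancel₀ h3 (h1.symm.trans h2)

lemma norm_mulOp_jb_le {s : ℝ} (hs : s ≤ 0) (f : L2 d) :
    ‖mulOp (fun ξ => (jb s ξ : ℂ)) f‖ ≤ ‖f‖ := by
  have := norm_mulOp_le (bddSym_jb hs) (C := 1) (fun ξ => by
    rw [Complex.norm_real, Real.norm_of_nonneg (jb_nonneg s ξ)]
    exact jb_le_one hs ξ) f
  rwa [one_mul] at this

lemma norm_mulOp_unimodular {m : Space d → ℂ} (hm : Measurable m) (h : ∀ ξ, ‖m ξ‖ = 1)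
    (f : L2 d) : ‖mulOp m f‖ = ‖f‖ := by
  have hb : BddSym m := ⟨hm, 1, fun ξ => (h ξ).le⟩
  rw [Lp.norm_def, Lp.norm_def]
  refine congrArg ENNReal.toReal (eLpNorm_congr_norm_ae ?_)
  filter_upwards [mulOp_ae hb f] with ξ hξ
  rw [hξ, norm_mul, h, one_mul]

/-- Strong convergence of multiplication operators: bounded pointwise convergence of the symbols
suffices. -/
lemma tendsto_mulOp {ι : Type*} {l : Filter ι} [l.IsCountablyGenerated]
    {m : ι → Space d → ℂ} {m' : Space d → ℂ} {C : ℝ} (h : ∀ i, Measurable (m i))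
    (h' : Measurable m') (hC : ∀ i ξ, ‖m i ξ‖ ≤ C) (hC' : ∀ ξ, ‖m' ξ‖ ≤ C)
    (hm : ∀ ξ, Tendsto (fun i => m i ξ) l (𝓝 (m' ξ))) (f : L2 d) :
    Tendsto (fun i => mulOp (m i) f) l (𝓝 (mulOp m' f)) := by
  have hb : ∀ i, BddSym (m i) := fun i => ⟨h i, C, hC i⟩
  have hb' : BddSym m' := ⟨h', C, hC'⟩
  rw [tendsto_iff_norm_sub_tendsto_zero]
  have key : ∀ i, ‖mulOp (m i) f - mulOp m' f‖ =
      (∫⁻ ξ, ‖(m i ξ - m' ξ) * f ξ‖ₑ ^ (2 : ℝ)).toReal ^ (1 / 2 : ℝ) := by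
    intro i
    rw [Lp.norm_def, eLpNorm_congr_ae (g := fun ξ => (m i ξ - m' ξ) * f ξ),
      eLpNorm_eq_lintegral_rpow_enorm_toReal (by norm_num) (by norm_num), ← ENNReal.toReal_rpow]
    · simp
    · filter_upwards [mulOp_ae (hb i) f, mulOp_ae hb' f,
        Lp.coeFn_sub (mulOp (m i) f) (mulOp m' f)] with ξ h1 h2 h3
      rw [h3, Pi.sub_apply, h1, h2, sub_mul]
  simp_rw [key]
  have hlim : Tendsto (fun i => ∫⁻ ξ, ‖(m i ξ - m' ξ) * f ξ‖ₑ ^ (2 : ℝ)) l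
      (𝓝 (∫⁻ _ : Space d, 0)) := by
    have hf2 : ∫⁻ ξ, ‖((2 * C : ℝ) : ℂ) * f ξ‖ₑ ^ (2 : ℝ) ≠ ∞ := by
      have := (Lp.memLp f).const_mul ((2 * C : ℝ) : ℂ)
      have h2 := lintegral_rpow_enorm_lt_top_of_eLpNorm_lt_top (by norm_num) (by norm_num) this.2
      simpa using h2.ne
    refine tendsto_lintegral_filter_of_dominated_convergence
      (fun ξ => ‖((2 * C : ℝ) : ℂ) * f ξ‖ₑ ^ (2 : ℝ)) ?_ ?_ hf2 ?_
    · refine Eventually.of_forall fun i => ?_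
      have h1 : Measurable (fun ξ => f ξ) := (Lp.stronglyMeasurable f).measurable
      exact ((((h i).sub h').mul h1).enorm).pow_const _
    · refine Eventually.of_forall fun i => ae_of_all _ fun ξ => ?_
      gcongr
      rw [enorm_mul, enorm_mul]
      gcongr
      rw [← ofReal_norm, ← ofReal_norm]
      apply ENNReal.ofReal_le_ofReal
      refine (norm_sub_le _ _).trans ?_
      rw [Complex.norm_real]
      refine le_trans ?_ (le_abs_self _)
      linarith [hC i ξ, hC' ξ]
    · refine ae_of_all _ fun ξ => ?_
      have h1 : Tendsto (fun i => (m i ξ - m' ξ) * f ξ) l (𝓝 0) := by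
        have := ((hm ξ).sub_const (m' ξ)).mul_const (f ξ)
        simpa using this
      have h2 := (h1.enorm).ennrpow_const (2 : ℝ)
      simpa using h2
  rw [lintegral_zero] at hlim
  have h3 := (ENNReal.tendsto_toReal ENNReal.zero_ne_top).comp hlim
  have h4 := h3.rpow_const (p := 1 / 2) (Or.inr (by norm_num))
  simpa using h4

/-! ### Conjugation and reflection -/

/-- The operator `f ↦ conj (f (-·))`, which is complex conjugation on the physical side. -/
def conjRefl : L2 d →L[ℝ] L2 d :=
  (Complex.conjCLE.toContinuousLinearMap.compLpL 2 volume).comp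
    (Lp.compMeasurePreservingₗᵢ ℝ (fun ξ : Space d => -ξ)
      (Measure.measurePreserving_neg _)).toContinuousLinearMap

lemma conjRefl_ae (f : L2 d) :
    conjRefl f =ᵐ[volume] fun ξ => star (f (-ξ)) := by
  filter_upwards [ContinuousLinearMap.coeFn_compLpL (p := 2) (μ := volume)
      Complex.conjCLE.toContinuousLinearMap (Lp.compMeasurePreserving (fun ξ : Space d => -ξ)
      (Measure.measurePreserving_neg _) f),
    Lp.coeFn_compMeasurePreserving f
      (Measure.measurePreserving_neg (volume : Measure (Space d)))] with ξ h1 h2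
  refine h1.trans ?_
  rw [h2]
  rfl

lemma norm_conjRefl (f : L2 d) : ‖conjRefl f‖ = ‖f‖ := by
  rw [← Lp.norm_compMeasurePreserving f
    (Measure.measurePreserving_neg (volume : Measure (Space d))), Lp.norm_def, Lp.norm_def]
  refine congrArg ENNReal.toReal (eLpNorm_congr_norm_ae ?_)
  filter_upwards [conjRefl_ae f, Lp.coeFn_compMeasurePreserving f
      (Measure.measurePreserving_neg (volume : Measure (Space d)))] with ξ h1 h2
  rw [h1, h2, norm_star, Function.comp_apply]

lemma ae_neg {p : Space d → Prop} (h : ∀ᵐ ξ, p ξ) : ∀ᵐ ξ : Space d, p (-ξ) :=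
  (Measure.measurePreserving_neg (volume : Measure (Space d))).quasiMeasurePreserving.ae h

lemma conjRefl_conjRefl (f : L2 d) : conjRefl (conjRefl f) = f := by
  refine Lp.ext ?_
  filter_upwards [conjRefl_ae (conjRefl f), ae_neg (conjRefl_ae f)] with ξ h1 h2
  rw [h1, h2, star_star, neg_neg]

lemma conjRefl_mulOp {m m' : Space d → ℂ} (h : BddSym m) (h' : BddSym m')
    (hm : ∀ ξ, m' ξ = star (m (-ξ))) (f : L2 d) :
    conjRefl (mulOp m f) = mulOp m' (conjRefl f) := by
  refine Lp.ext ?_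
  filter_upwards [conjRefl_ae (mulOp m f), ae_neg (mulOp_ae h f), mulOp_ae h' (conjRefl f),
    conjRefl_ae f] with ξ h1 h2 h3 h4
  rw [h1, h2, h3, h4, hm, star_mul']

/-- The Fourier side of taking the real part. -/
def symPart : L2 d →L[ℝ] L2 d := (1 / 2 : ℝ) • (ContinuousLinearMap.id ℝ (L2 d) + conjRefl)

lemma symPart_apply (f : L2 d) : symPart f = (1 / 2 : ℝ) • (f + conjRefl f) := rfl

lemma norm_symPart_le (f : L2 d) : ‖symPart f‖ ≤ ‖f‖ := by
  rw [symPart_apply, norm_smul]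
  have := norm_add_le f (conjRefl f)
  rw [norm_conjRefl] at this
  norm_num
  linarith

lemma conjRefl_symPart (f : L2 d) : conjRefl (symPart f) = symPart f := by
  rw [symPart_apply, map_smul, map_add, conjRefl_conjRefl, add_comm]

/-! ### Convolution estimates -/

/-- The `L²` norm of a function with values in `[0, ∞]`. -/
def lnorm2 (u : Space d → ℝ≥0∞) : ℝ≥0∞ := (∫⁻ ξ, u ξ ^ (2 : ℝ)) ^ (1 / 2 : ℝ)

lemma lnorm2_mono {u v : Space d → ℝ≥0∞} (h : ∀ᵐ ξ, u ξ ≤ v ξ) : lnorm2 u ≤ lnorm2 v := by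
  unfold lnorm2
  refine ENNReal.rpow_le_rpow (lintegral_mono_ae ?_) (by norm_num)
  filter_upwards [h] with ξ hξ
  exact ENNReal.rpow_le_rpow hξ (by norm_num)

lemma lnorm2_add_le {u v : Space d → ℝ≥0∞} (hu : Measurable u) (hv : Measurable v) :
    lnorm2 (fun ξ => u ξ + v ξ) ≤ lnorm2 u + lnorm2 v :=
  ENNReal.lintegral_Lp_add_le hu.aemeasurable hv.aemeasurable (by norm_num)

lemma lnorm2_const_mul (c : ℝ≥0∞) {u : Space d → ℝ≥0∞} (hu : Measurable u) :
    lnorm2 (fun ξ => c * u ξ) = c * lnorm2 u := by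
  unfold lnorm2
  simp_rw [ENNReal.mul_rpow_of_nonneg _ _ (show (0 : ℝ) ≤ 2 by norm_num)]
  rw [lintegral_const_mul _ (hu.pow_const _),
    ENNReal.mul_rpow_of_nonneg _ _ (by norm_num), ← ENNReal.rpow_mul]
  norm_num

lemma eLpNorm_eq_lnorm2 (f : Space d → ℂ) : eLpNorm f 2 volume = lnorm2 (fun ξ => ‖f ξ‖ₑ) := by
  rw [eLpNorm_eq_lintegral_rpow_enorm_toReal (by norm_num) (by norm_num)]
  simp [lnorm2]

lemma lintegral_mul_le_lnorm2 {u v : Space d → ℝ≥0∞} (hu : Measurable u) (hv : Measurable v) :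
    ∫⁻ ξ, u ξ * v ξ ≤ lnorm2 u * lnorm2 v :=
  ENNReal.lintegral_mul_le_Lp_mul_Lq volume Real.HolderConjugate.two_two hu.aemeasurable
    hv.aemeasurable

/-- Young's inequality `‖u * v‖_{L²} ≤ ‖u‖_{L¹} ‖v‖_{L²}`. -/
lemma lnorm2_lconvolution_le {u v : Space d → ℝ≥0∞} (hu : Measurable u) (hv : Measurable v) :
    lnorm2 (u ⋆ₗ v) ≤ (∫⁻ ξ, u ξ) * lnorm2 v := by
  have h1 : ∀ x, (u ⋆ₗ v) x ^ (2 : ℝ) ≤ (∫⁻ ξ, u ξ) * ∫⁻ y, u y * v (-y + x) ^ (2 : ℝ) := by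
    intro x
    have hvx : Measurable (fun y => v (-y + x)) := hv.comp (by fun_prop)
    have h2 : ∀ y, u y * v (-y + x) = u y ^ (1 / 2 : ℝ) * (u y ^ (1 / 2 : ℝ) * v (-y + x)) := by
      intro y
      rw [← mul_assoc, ← ENNReal.rpow_add_of_nonneg _ _ (by norm_num) (by norm_num)]
      norm_num
    rw [lconvolution_def, lintegral_congr h2]
    have h3 := lintegral_mul_le_lnorm2 (hu.pow_const (1 / 2 : ℝ))
      ((hu.pow_const (1 / 2 : ℝ)).mul hvx)
    refine (ENNReal.rpow_le_rpow h3 (by norm_num : (0 : ℝ) ≤ 2)).trans ?_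
    rw [ENNReal.mul_rpow_of_nonneg _ _ (by norm_num)]
    unfold lnorm2
    rw [← ENNReal.rpow_mul, ← ENNReal.rpow_mul]
    simp only [Pi.mul_apply, ENNReal.mul_rpow_of_nonneg _ _ (show (0 : ℝ) ≤ 2 by norm_num),
      ← ENNReal.rpow_mul]
    norm_num
  have h4 : ∫⁻ x, (u ⋆ₗ v) x ^ (2 : ℝ) ≤ (∫⁻ ξ, u ξ) ^ (2 : ℝ) * ∫⁻ x, v x ^ (2 : ℝ) := by
    have hm : Measurable (fun p : Space d × Space d => u p.2 * v (-p.2 + p.1) ^ (2 : ℝ)) :=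
      (hu.comp measurable_snd).mul ((hv.comp (by fun_prop)).pow_const _)
    refine (lintegral_mono h1).trans ?_
    rw [lintegral_const_mul _ hm.lintegral_prod_right,
      lintegral_lintegral_swap hm.aemeasurable]
    have h5 : ∀ y, ∫⁻ x, u y * v (-y + x) ^ (2 : ℝ) = u y * ∫⁻ x, v x ^ (2 : ℝ) := by
      intro y
      have hm' : Measurable (fun x => v (-y + x) ^ (2 : ℝ)) :=
        (hv.comp (measurable_const_add (-y))).pow_const _
      rw [lintegral_const_mul _ hm',
        lintegral_add_left_eq_self (fun x => v x ^ (2 : ℝ)) (-y)]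
    simp_rw [h5]
    rw [lintegral_mul_const _ hu, ← mul_assoc, ENNReal.rpow_two, sq]
  unfold lnorm2
  refine (ENNReal.rpow_le_rpow h4 (by norm_num : (0 : ℝ) ≤ 1 / 2)).trans ?_
  rw [ENNReal.mul_rpow_of_nonneg _ _ (by norm_num), ← ENNReal.rpow_mul]
  norm_num

/-- The weighted absolute value `(1 + |ξ|²)^{s/2} |F(ξ)|`. -/
def wabs (s : ℝ) (F : Space d → ℂ) (ξ : Space d) : ℝ≥0∞ := ENNReal.ofReal (jb s ξ) * ‖F ξ‖ₑ

lemma measurable_wabs (s : ℝ) {F : Space d → ℂ} (hF : Measurable F) : Measurable (wabs s F) :=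
  ((measurable_jb s).ennreal_ofReal).mul hF.enorm

lemma wabs_zero (F : Space d → ℂ) : wabs 0 F = fun ξ => ‖F ξ‖ₑ := by
  ext ξ; simp [wabs, jb_zero]

lemma wabs_add (s t : ℝ) (F : Space d → ℂ) (ξ : Space d) :
    wabs (s + t) F ξ = ENNReal.ofReal (jb s ξ) * wabs t F ξ := by
  rw [wabs, wabs, jb_add, ENNReal.ofReal_mul (jb_nonneg s ξ), mul_assoc]

/-- The frequency weight of a product is controlled by the frequency weights of the factors. -/
lemma jb_le_add {s : ℝ} (hs : 0 ≤ s) (ξ η : Space d) :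
    jb s ξ ≤ (4 : ℝ) ^ (s / 2) * (jb s η + jb s (ξ - η)) := by
  have h1 : ‖ξ‖ ≤ ‖η‖ + ‖ξ - η‖ := by
    simpa using norm_add_le η (ξ - η)
  have h2 : 1 + ‖ξ‖ ^ 2 ≤ 4 * max (1 + ‖η‖ ^ 2) (1 + ‖ξ - η‖ ^ 2) := by
    have := le_max_left (1 + ‖η‖ ^ 2) (1 + ‖ξ - η‖ ^ 2)
    have := le_max_right (1 + ‖η‖ ^ 2) (1 + ‖ξ - η‖ ^ 2)
    nlinarith [norm_nonneg ξ, norm_nonneg η, norm_nonneg (ξ - η), sq_nonneg (‖η‖ - ‖ξ - η‖)]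
  have hs2 : 0 ≤ s / 2 := by positivity
  unfold jb
  refine (Real.rpow_le_rpow (base_pos ξ).le h2 hs2).trans ?_
  rw [Real.mul_rpow (by norm_num) ((base_pos η).le.trans (le_max_left _ _))]
  refine mul_le_mul_of_nonneg_left ?_ (by positivity)
  rcases max_cases (1 + ‖η‖ ^ 2) (1 + ‖ξ - η‖ ^ 2) with h | h <;> rw [h.1]
  · exact le_add_of_nonneg_right (jb_nonneg s (ξ - η))
  · exact le_add_of_nonneg_left (jb_nonneg s η)

/-- The convolution of two complex functions. -/
abbrev conv (F G : Space d → ℂ) : Space d → ℂ :=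
  MeasureTheory.convolution F G (ContinuousLinearMap.mul ℂ ℂ) volume

lemma wabs_conv_le {s : ℝ} (hs : 0 ≤ s) {F G : Space d → ℂ} (hF : Measurable F)
    (hG : Measurable G) (ξ : Space d) :
    wabs s (conv F G) ξ ≤ ENNReal.ofReal ((4 : ℝ) ^ (s / 2)) *
      ((wabs s F ⋆ₗ wabs 0 G) ξ + (wabs 0 F ⋆ₗ wabs s G) ξ) := by
  have hm : ∀ s t, Measurable (fun y => wabs s F y * wabs t G (-y + ξ)) := fun s t =>
    (measurable_wabs s hF).mul ((measurable_wabs t hG).comp (by fun_prop))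
  rw [lconvolution_def, lconvolution_def, ← lintegral_add_left (hm _ _),
    ← lintegral_const_mul _ (by exact (hm _ _).add (hm _ _))]
  unfold wabs conv
  rw [convolution_def]
  refine (mul_le_mul_right (enorm_integral_le_lintegral_enorm _) _).trans ?_
  rw [← lintegral_const_mul']
  · refine lintegral_mono fun y => ?_
    have h1 := jb_le_add hs ξ y
    simp only [ContinuousLinearMap.mul_apply', enorm_mul, jb_zero, ENNReal.ofReal_one, one_mul]
    rw [neg_add_eq_sub]
    calc ENNReal.ofReal (jb s ξ) * (‖F y‖ₑ * ‖G (ξ - y)‖ₑ)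
        ≤ ENNReal.ofReal ((4 : ℝ) ^ (s / 2) * (jb s y + jb s (ξ - y)))
          * (‖F y‖ₑ * ‖G (ξ - y)‖ₑ) := by gcongr
      _ = _ := by
        rw [ENNReal.ofReal_mul (by positivity), ENNReal.ofReal_add (jb_nonneg _ _) (jb_nonneg _ _)]
        ring
  · exact ENNReal.ofReal_ne_top

/-- The `L²` norm of `(1 + |ξ|²)^{-1}`; it is finite in dimensions `d ≤ 3`. -/
def embConst (d : ℕ) : ℝ≥0∞ := lnorm2 (fun ξ : Space d => ENNReal.ofReal (jb (-2) ξ))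

lemma embConst_lt_top (hd : d ≤ 3) : embConst d < ∞ := by
  unfold embConst lnorm2
  refine ENNReal.rpow_lt_top_of_nonneg (by norm_num) (ne_of_lt ?_)
  have h : Integrable (fun ξ : Space d => (1 + ‖ξ‖ ^ 2) ^ (-(4 : ℝ) / 2)) volume :=
    integrable_rpow_neg_one_add_norm_sq (by
      rw [finrank_euclideanSpace_fin]
      exact_mod_cast Nat.lt_succ_of_le hd)
  refine lt_of_eq_of_lt (lintegral_congr fun ξ => ?_) h.lintegral_lt_top
  rw [ENNReal.ofReal_rpow_of_nonneg (jb_nonneg _ _) (by norm_num)]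
  unfold jb
  rw [← Real.rpow_mul (base_pos ξ).le]
  norm_num

/-- In dimensions `d ≤ 3`, two weights suffice to pass from `L²` to `L¹`. -/
lemma lintegral_wabs_le (s : ℝ) {F : Space d → ℂ} (hF : Measurable F) :
    ∫⁻ ξ, wabs s F ξ ≤ embConst d * lnorm2 (wabs (s + 2) F) := by
  have h : ∀ ξ, wabs s F ξ = ENNReal.ofReal (jb (-2) ξ) * wabs (s + 2) F ξ := fun ξ => by
    rw [← wabs_add]; ring_nf
  simp_rw [h]
  exact lintegral_mul_le_lnorm2 (measurable_jb _).ennreal_ofReal (measurable_wabs _ hF)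

lemma measurable_lconv {u v : Space d → ℝ≥0∞} (hu : Measurable u) (hv : Measurable v) :
    Measurable (u ⋆ₗ v) := measurable_lconvolution volume hu hv

lemma lnorm2_wabs_conv_aux {s : ℝ} (hs : 0 ≤ s) {F G : Space d → ℂ} (hF : Measurable F)
    (hG : Measurable G) :
    lnorm2 (wabs s (conv F G)) ≤ ENNReal.ofReal ((4 : ℝ) ^ (s / 2)) *
      (lnorm2 (wabs s F ⋆ₗ wabs 0 G) + lnorm2 (wabs 0 F ⋆ₗ wabs s G)) := by
  have h1 := measurable_lconv (measurable_wabs s hF) (measurable_wabs 0 hG)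
  have h2 := measurable_lconv (measurable_wabs 0 hF) (measurable_wabs s hG)
  refine (lnorm2_mono (ae_of_all _ (wabs_conv_le hs hF hG))).trans ?_
  rw [lnorm2_const_mul _ (by exact h1.add h2)]
  gcongr
  exact lnorm2_add_le h1 h2

/-- The algebra estimate: `‖fg‖_{H^s} ≲ ‖f‖_{H^s} ‖g‖_{H²} + ‖f‖_{H²} ‖g‖_{H^s}`. -/
lemma lnorm2_wabs_conv_le {s : ℝ} (hs : 0 ≤ s) {F G : Space d → ℂ} (hF : Measurable F)
    (hG : Measurable G) :
    lnorm2 (wabs s (conv F G)) ≤ ENNReal.ofReal ((4 : ℝ) ^ (s / 2)) * embConst d *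
      (lnorm2 (wabs s F) * lnorm2 (wabs 2 G) + lnorm2 (wabs 2 F) * lnorm2 (wabs s G)) := by
  refine (lnorm2_wabs_conv_aux hs hF hG).trans ?_
  rw [mul_assoc, mul_add (embConst d)]
  gcongr
  · rw [lconvolution_comm]
    refine (lnorm2_lconvolution_le (measurable_wabs _ hG) (measurable_wabs _ hF)).trans ?_
    have := lintegral_wabs_le 0 hG
    rw [zero_add] at this
    calc _ ≤ (embConst d * lnorm2 (wabs 2 G)) * lnorm2 (wabs s F) := by gcongr
      _ = _ := by ring
  · refine (lnorm2_lconvolution_le (measurable_wabs _ hF) (measurable_wabs _ hG)).trans ?_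
    have := lintegral_wabs_le 0 hF
    rw [zero_add] at this
    calc _ ≤ (embConst d * lnorm2 (wabs 2 F)) * lnorm2 (wabs s G) := by gcongr
      _ = _ := by ring

/-- A variant in which the first factor enters only through its `L²` norm where the second one
carries the derivatives: `‖fg‖_{H^s} ≲ ‖f‖_{H^s} ‖g‖_{H²} + ‖f‖_{L²} ‖g‖_{H^{s+2}}`. -/
lemma lnorm2_wabs_conv_le' {s : ℝ} (hs : 0 ≤ s) {F G : Space d → ℂ} (hF : Measurable F)
    (hG : Measurable G) :
    lnorm2 (wabs s (conv F G)) ≤ ENNReal.ofReal ((4 : ℝ) ^ (s / 2)) * embConst d *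
      (lnorm2 (wabs s F) * lnorm2 (wabs 2 G) + lnorm2 (wabs 0 F) * lnorm2 (wabs (s + 2) G)) := by
  refine (lnorm2_wabs_conv_aux hs hF hG).trans ?_
  rw [mul_assoc, mul_add (embConst d)]
  gcongr
  · rw [lconvolution_comm]
    refine (lnorm2_lconvolution_le (measurable_wabs _ hG) (measurable_wabs _ hF)).trans ?_
    have := lintegral_wabs_le 0 hG
    rw [zero_add] at this
    calc _ ≤ (embConst d * lnorm2 (wabs 2 G)) * lnorm2 (wabs s F) := by gcongr
      _ = _ := by ring
  · rw [lconvolution_comm]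
    refine (lnorm2_lconvolution_le (measurable_wabs _ hG) (measurable_wabs _ hF)).trans ?_
    have := lintegral_wabs_le s hG
    calc _ ≤ (embConst d * lnorm2 (wabs (s + 2) G)) * lnorm2 (wabs 0 F) := by gcongr
      _ = _ := by ring

/-! ### Weighted Fourier transforms and their products -/

/-- An element `f` of `L²` at level `σ` stands for the function whose Fourier transform is
`rep σ f = (1 + |ξ|²)^{-σ/2} f`; in this way `L²` serves as a model of every `H^σ`. -/
def rep (σ : ℝ) (f : L2 d) : Space d → ℂ := fun ξ => (jb (-σ) ξ : ℂ) * f ξ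

/-- Multiplication by `(1 + |ξ|²)^{s/2}`, for `s ≤ 0`. -/
abbrev jop (s : ℝ) : L2 d →L[ℝ] L2 d := mulOp (fun ξ => (jb s ξ : ℂ))

lemma measurable_rep (σ : ℝ) (f : L2 d) : Measurable (rep σ f) := by
  have h1 : Measurable (fun ξ => f ξ) := (Lp.stronglyMeasurable f).measurable
  exact (Complex.measurable_ofReal.comp (measurable_jb (-σ))).mul h1

lemma enorm_jb (s : ℝ) (ξ : Space d) : ‖(jb s ξ : ℂ)‖ₑ = ENNReal.ofReal (jb s ξ) := by
  rw [← ofReal_norm, Complex.norm_real, Real.norm_of_nonneg (jb_nonneg s ξ)]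

lemma wabs_rep (s σ : ℝ) (f : L2 d) (ξ : Space d) :
    wabs s (rep σ f) ξ = ‖(jb (s - σ) ξ : ℂ) * f ξ‖ₑ := by
  rw [wabs, rep, enorm_mul, enorm_mul, enorm_jb, enorm_jb, sub_eq_add_neg, jb_add,
    ENNReal.ofReal_mul (jb_nonneg s ξ), mul_assoc]

lemma lnorm2_wabs_rep {s σ : ℝ} (h : s ≤ σ) (f : L2 d) :
    lnorm2 (wabs s (rep σ f)) = ‖jop (s - σ) f‖ₑ := by
  rw [Lp.enorm_def, eLpNorm_eq_lnorm2]
  refine le_antisymm (lnorm2_mono ?_) (lnorm2_mono ?_) <;>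
  · filter_upwards [mulOp_ae (bddSym_jb (show s - σ ≤ 0 by linarith)) f] with ξ hξ
    rw [hξ, wabs_rep]

lemma jop_zero (f : L2 d) : jop 0 f = f := mulOp_eq_self (by simp [jb_zero]) f

lemma jop_jop {s t : ℝ} (hs : s ≤ 0) (ht : t ≤ 0) (f : L2 d) :
    jop s (jop t f) = jop (s + t) f :=
  mulOp_mulOp_eq (bddSym_jb hs) (bddSym_jb ht) (fun ξ => by rw [jb_add]; push_cast; ring) f

lemma norm_jop_le {s : ℝ} (hs : s ≤ 0) (f : L2 d) : ‖jop s f‖ ≤ ‖f‖ := norm_mulOp_jb_le hs f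

lemma norm_jop_mono {s t : ℝ} (hst : s ≤ t) (ht : t ≤ 0) (f : L2 d) :
    ‖jop s f‖ ≤ ‖jop t f‖ := by
  have := norm_jop_le (sub_nonpos.2 hst) (jop t f)
  rwa [jop_jop (sub_nonpos.2 hst) ht, sub_add_cancel] at this

lemma jop_injective {s : ℝ} (hs : s ≤ 0) : Function.Injective (jop (d := d) s) :=
  mulOp_injective (bddSym_jb hs) (ae_of_all _ fun ξ => by exact_mod_cast jb_ne s ξ)

lemma lintegral_wabs_rep_lt_top (hd : d ≤ 3) {s σ : ℝ} (h : s + 2 ≤ σ) (f : L2 d) :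
    ∫⁻ ξ, wabs s (rep σ f) ξ < ∞ := by
  refine (lintegral_wabs_le s (measurable_rep σ f)).trans_lt ?_
  rw [lnorm2_wabs_rep h]
  exact ENNReal.mul_lt_top (embConst_lt_top hd) enorm_lt_top

lemma integrable_rep (hd : d ≤ 3) {σ : ℝ} (h : 2 ≤ σ) (f : L2 d) :
    Integrable (rep σ f) volume := by
  refine ⟨(measurable_rep σ f).aestronglyMeasurable, ?_⟩
  have := lintegral_wabs_rep_lt_top hd (s := 0) (σ := σ) (by linarith) f
  rwa [wabs_zero] at this

lemma integrable_pow_mul_rep (hd : d ≤ 3) {σ : ℝ} (k : ℕ) (h : k + 2 ≤ σ) (f : L2 d) :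
    Integrable (fun ξ => ‖ξ‖ ^ k * ‖rep σ f ξ‖) volume := by
  refine ⟨((measurable_norm.pow_const k).mul (measurable_rep σ f).norm).aestronglyMeasurable, ?_⟩
  refine (lintegral_mono fun ξ => ?_).trans_lt (lintegral_wabs_rep_lt_top hd h f)
  rw [wabs, enorm_mul, enorm_norm]
  gcongr
  rw [Real.enorm_eq_ofReal (by positivity)]
  refine ENNReal.ofReal_le_ofReal ?_
  refine (pow_le_pow_left₀ (norm_nonneg ξ) (norm_le_jb_one ξ) k).trans_eq ?_
  unfold jb
  rw [← Real.rpow_natCast, ← Real.rpow_mul (base_pos ξ).le]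
  ring_nf

lemma rep_congr_level {σ τ : ℝ} (h : τ ≤ σ) (f : L2 d) :
    rep τ (jop (τ - σ) f) =ᵐ[volume] rep σ f := by
  filter_upwards [mulOp_ae (bddSym_jb (show τ - σ ≤ 0 by linarith)) f] with ξ hξ
  rw [rep, rep, hξ, ← mul_assoc, ← Complex.ofReal_mul, ← jb_add]
  ring_nf

lemma rep_add (σ : ℝ) (f g : L2 d) : rep σ (f + g) =ᵐ[volume] rep σ f + rep σ g := by
  filter_upwards [Lp.coeFn_add f g] with ξ hξ
  simp only [rep, hξ, Pi.add_apply, mul_add]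

lemma rep_smul (σ : ℝ) (c : ℝ) (f : L2 d) : rep σ (c • f) =ᵐ[volume] c • rep σ f := by
  filter_upwards [Lp.coeFn_smul c f] with ξ hξ
  simp only [rep, hξ, Pi.smul_apply, mul_smul_comm]

lemma rep_mulOp (σ : ℝ) {m : Space d → ℂ} (h : BddSym m) (f : L2 d) :
    rep σ (mulOp m f) =ᵐ[volume] fun ξ => m ξ * rep σ f ξ := by
  filter_upwards [mulOp_ae h f] with ξ hξ
  rw [rep, hξ, rep]; ring

/-- The exponents for which the product maps `H^{σ₁} × H^{σ₂}` to `H^σ`. -/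
structure ConvAdm (d : ℕ) (σ₁ σ₂ σ : ℝ) : Prop where
  dim : d ≤ 3
  nonneg : 0 ≤ σ
  le₁ : σ ≤ σ₁
  le₂ : σ ≤ σ₂
  two_le₁ : 2 ≤ σ₁
  two_le₂ : 2 ≤ σ₂

/-- The constant in the product estimates at the exponent `s`. -/
def convConst (d : ℕ) (s : ℝ) : ℝ := (4 : ℝ) ^ (s / 2) * (embConst d).toReal

lemma convConst_nonneg (d : ℕ) (s : ℝ) : 0 ≤ convConst d s := by
  unfold convConst; positivity

lemma ofReal_convConst (hd : d ≤ 3) (s : ℝ) :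
    ENNReal.ofReal ((4 : ℝ) ^ (s / 2)) * embConst d = ENNReal.ofReal (convConst d s) := by
  rw [convConst, ENNReal.ofReal_mul (by positivity), ENNReal.ofReal_toReal (embConst_lt_top hd).ne]

/-- The Fourier transform of the product of the functions represented by `f` and `g`, with the
weight of level `σ`. -/
def convFun (σ₁ σ₂ σ : ℝ) (f g : L2 d) : Space d → ℂ :=
  fun ξ => (jb σ ξ : ℂ) * conv (rep σ₁ f) (rep σ₂ g) ξ

lemma enorm_convFun (σ₁ σ₂ σ : ℝ) (f g : L2 d) (ξ : Space d) :
    ‖convFun σ₁ σ₂ σ f g ξ‖ₑ = wabs σ (conv (rep σ₁ f) (rep σ₂ g)) ξ := by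
  rw [convFun, enorm_mul, enorm_jb, wabs]

lemma lnorm2_wabs_conv_rep_le {σ₁ σ₂ σ : ℝ} (h : ConvAdm d σ₁ σ₂ σ) (f g : L2 d) :
    lnorm2 (wabs σ (conv (rep σ₁ f) (rep σ₂ g))) ≤ ENNReal.ofReal (convConst d σ *
      (‖jop (σ - σ₁) f‖ * ‖jop (2 - σ₂) g‖ + ‖jop (2 - σ₁) f‖ * ‖jop (σ - σ₂) g‖)) := by
  refine (lnorm2_wabs_conv_le h.nonneg (measurable_rep _ f) (measurable_rep _ g)).trans_eq ?_
  rw [lnorm2_wabs_rep h.le₁, lnorm2_wabs_rep h.le₂, lnorm2_wabs_rep h.two_le₁,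
    lnorm2_wabs_rep h.two_le₂, ofReal_convConst h.dim,
    ENNReal.ofReal_mul (convConst_nonneg d σ), ENNReal.ofReal_add (by positivity) (by positivity),
    ENNReal.ofReal_mul (norm_nonneg _), ENNReal.ofReal_mul (norm_nonneg _)]
  simp only [ofReal_norm]

lemma memLp_convFun {σ₁ σ₂ σ : ℝ} (h : ConvAdm d σ₁ σ₂ σ) (f g : L2 d) :
    MemLp (convFun σ₁ σ₂ σ f g) 2 volume := by
  constructor
  · have h1 := (integrable_rep h.dim h.two_le₁ f).integrable_convolution
      (ContinuousLinearMap.mul ℂ ℂ) (integrable_rep h.dim h.two_le₂ g)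
    have h2 : Measurable (fun ξ : Space d => (jb σ ξ : ℂ)) := by fun_prop
    exact h2.aestronglyMeasurable.mul h1.aestronglyMeasurable
  · rw [eLpNorm_eq_lnorm2]
    simp_rw [enorm_convFun]
    exact (lnorm2_wabs_conv_rep_le h f g).trans_lt ENNReal.ofReal_lt_top

lemma convFun_add_left {σ₁ σ₂ σ : ℝ} (h : ConvAdm d σ₁ σ₂ σ) (f f' g : L2 d) :
    convFun σ₁ σ₂ σ (f + f') g =ᵐ[volume] convFun σ₁ σ₂ σ f g + convFun σ₁ σ₂ σ f' g := by
  have hi := fun f => integrable_rep h.dim h.two_le₁ f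
  have hg := integrable_rep h.dim h.two_le₂ g
  have h0 : conv (rep σ₁ (f + f')) (rep σ₂ g) = conv (rep σ₁ f + rep σ₁ f') (rep σ₂ g) :=
    convolution_congr _ (rep_add σ₁ f f') (ae_eq_refl _)
  filter_upwards [(hi f).ae_convolution_exists (ContinuousLinearMap.mul ℂ ℂ) hg,
    (hi f').ae_convolution_exists (ContinuousLinearMap.mul ℂ ℂ) hg] with ξ h1 h2
  rw [Pi.add_apply, convFun, convFun, convFun, h0, ← mul_add]
  congr 1
  exact h1.add_distrib h2

lemma convFun_add_right {σ₁ σ₂ σ : ℝ} (h : ConvAdm d σ₁ σ₂ σ) (f g g' : L2 d) :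
    convFun σ₁ σ₂ σ f (g + g') =ᵐ[volume] convFun σ₁ σ₂ σ f g + convFun σ₁ σ₂ σ f g' := by
  have hi := fun f => integrable_rep h.dim h.two_le₂ f
  have hf := integrable_rep h.dim h.two_le₁ f
  have h0 : conv (rep σ₁ f) (rep σ₂ (g + g')) = conv (rep σ₁ f) (rep σ₂ g + rep σ₂ g') :=
    convolution_congr _ (ae_eq_refl _) (rep_add σ₂ g g')
  filter_upwards [hf.ae_convolution_exists (ContinuousLinearMap.mul ℂ ℂ) (hi g),
    hf.ae_convolution_exists (ContinuousLinearMap.mul ℂ ℂ) (hi g')] with ξ h1 h2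
  rw [Pi.add_apply, convFun, convFun, convFun, h0, ← mul_add]
  congr 1
  exact h1.distrib_add h2

lemma convFun_smul_left (σ₁ σ₂ σ : ℝ) (c : ℝ) (f g : L2 d) :
    convFun σ₁ σ₂ σ (c • f) g = c • convFun σ₁ σ₂ σ f g := by
  have h0 : conv (rep σ₁ (c • f)) (rep σ₂ g) = conv ((c : ℂ) • rep σ₁ f) (rep σ₂ g) :=
    convolution_congr _ ((rep_smul σ₁ c f).trans (ae_of_all _ fun ξ => by simp)) (ae_eq_refl _)
  ext ξ
  rw [Pi.smul_apply, convFun, convFun, h0, conv, smul_convolution, Pi.smul_apply]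
  simp only [smul_eq_mul, Complex.real_smul]
  ring

lemma convFun_smul_right (σ₁ σ₂ σ : ℝ) (c : ℝ) (f g : L2 d) :
    convFun σ₁ σ₂ σ f (c • g) = c • convFun σ₁ σ₂ σ f g := by
  have h0 : conv (rep σ₁ f) (rep σ₂ (c • g)) = conv (rep σ₁ f) ((c : ℂ) • rep σ₂ g) :=
    convolution_congr _ (ae_eq_refl _) ((rep_smul σ₂ c g).trans (ae_of_all _ fun ξ => by simp))
  ext ξ
  rw [Pi.smul_apply, convFun, convFun, h0, conv, convolution_smul, Pi.smul_apply]
  simp only [smul_eq_mul, Complex.real_smul]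
  ring

open Classical in
/-- The product `H^{σ₁} × H^{σ₂} → H^σ` on the Fourier side, as a bounded bilinear map; by
convention it is `0` if the exponents are not admissible. -/
def convOp (σ₁ σ₂ σ : ℝ) : L2 d →L[ℝ] L2 d →L[ℝ] L2 d :=
  if h : ConvAdm d σ₁ σ₂ σ then
    LinearMap.mkContinuous₂
      (LinearMap.mk₂ ℝ (fun f g => (memLp_convFun h f g).toLp)
        (fun f f' g => by
          rw [← MemLp.toLp_add, MemLp.toLp_eq_toLp_iff]
          exact convFun_add_left h f f' g)
        (fun c f g => by
          rw [← MemLp.toLp_const_smul, MemLp.toLp_eq_toLp_iff, convFun_smul_left])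
        (fun f g g' => by
          rw [← MemLp.toLp_add, MemLp.toLp_eq_toLp_iff]
          exact convFun_add_right h f g g')
        (fun c f g => by
          rw [← MemLp.toLp_const_smul, MemLp.toLp_eq_toLp_iff, convFun_smul_right]))
      (2 * convConst d σ) (fun f g => by
        rw [LinearMap.mk₂_apply, Lp.norm_toLp, eLpNorm_eq_lnorm2]
        simp_rw [enorm_convFun]
        refine ENNReal.toReal_le_of_le_ofReal
          (by have := convConst_nonneg d σ; positivity)
          ((lnorm2_wabs_conv_rep_le h f g).trans (ENNReal.ofReal_le_ofReal ?_))
        have h1 := mul_le_mul (norm_jop_le (sub_nonpos.2 h.le₁) f)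
          (norm_jop_le (sub_nonpos.2 h.two_le₂) g) (norm_nonneg _) (norm_nonneg _)
        have h2 := mul_le_mul (norm_jop_le (sub_nonpos.2 h.two_le₁) f)
          (norm_jop_le (sub_nonpos.2 h.le₂) g) (norm_nonneg _) (norm_nonneg _)
        have h3 := mul_le_mul_of_nonneg_left (add_le_add h1 h2) (convConst_nonneg d σ)
        linarith)
  else 0

lemma convOp_ae {σ₁ σ₂ σ : ℝ} (h : ConvAdm d σ₁ σ₂ σ) (f g : L2 d) :
    convOp σ₁ σ₂ σ f g =ᵐ[volume] convFun σ₁ σ₂ σ f g := by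
  rw [convOp, dif_pos h]
  exact (memLp_convFun h f g).coeFn_toLp

lemma rep_convOp {σ₁ σ₂ σ : ℝ} (h : ConvAdm d σ₁ σ₂ σ) (f g : L2 d) :
    rep σ (convOp σ₁ σ₂ σ f g) =ᵐ[volume] conv (rep σ₁ f) (rep σ₂ g) := by
  filter_upwards [convOp_ae h f g] with ξ hξ
  rw [rep, hξ, convFun, ← mul_assoc, ← Complex.ofReal_mul, ← jb_add, neg_add_cancel, jb_zero,
    Complex.ofReal_one, one_mul]

lemma wabs_congr (s : ℝ) {F G : Space d → ℂ} (h : F =ᵐ[volume] G) :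
    wabs s F =ᵐ[volume] wabs s G := by
  filter_upwards [h] with ξ hξ
  rw [wabs, wabs, hξ]

lemma enorm_jop_convOp {σ₁ σ₂ σ τ : ℝ} (h : ConvAdm d σ₁ σ₂ σ) (hτ : τ ≤ σ) (f g : L2 d) :
    ‖jop (τ - σ) (convOp σ₁ σ₂ σ f g)‖ₑ = lnorm2 (wabs τ (conv (rep σ₁ f) (rep σ₂ g))) := by
  rw [← lnorm2_wabs_rep hτ]
  have h1 := wabs_congr τ (rep_convOp h f g)
  exact le_antisymm (lnorm2_mono h1.le) (lnorm2_mono h1.symm.le)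

lemma ConvAdm.lower {σ₁ σ₂ σ τ : ℝ} (h : ConvAdm d σ₁ σ₂ σ) (h0 : 0 ≤ τ) (hτ : τ ≤ σ) :
    ConvAdm d σ₁ σ₂ τ :=
  ⟨h.dim, h0, hτ.trans h.le₁, hτ.trans h.le₂, h.two_le₁, h.two_le₂⟩

/-- The algebra estimate for the product, in `H^τ`. -/
lemma norm_jop_convOp_le {σ₁ σ₂ σ τ : ℝ} (h : ConvAdm d σ₁ σ₂ σ) (h0 : 0 ≤ τ) (hτ : τ ≤ σ)
    (f g : L2 d) : ‖jop (τ - σ) (convOp σ₁ σ₂ σ f g)‖ ≤ convConst d τ *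
      (‖jop (τ - σ₁) f‖ * ‖jop (2 - σ₂) g‖ + ‖jop (2 - σ₁) f‖ * ‖jop (τ - σ₂) g‖) := by
  have h1 := lnorm2_wabs_conv_rep_le (h.lower h0 hτ) f g
  rw [← enorm_jop_convOp h hτ, ← ofReal_norm] at h1
  refine (ENNReal.ofReal_le_ofReal_iff ?_).1 h1
  have := convConst_nonneg d τ
  positivity

/-- The estimate in which the first factor enters only through its `L²` norm where the second one
carries the derivatives. -/
lemma norm_convOp_le' {σ₁ σ₂ σ : ℝ} (h : ConvAdm d σ₁ σ₂ σ) (h2 : σ + 2 ≤ σ₂) (f g : L2 d) :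
    ‖convOp σ₁ σ₂ σ f g‖ ≤ convConst d σ *
      (‖f‖ * ‖jop (2 - σ₂) g‖ + ‖jop (-σ₁) f‖ * ‖g‖) := by
  have h3 := lnorm2_wabs_conv_le' h.nonneg (measurable_rep σ₁ f) (measurable_rep σ₂ g)
  have h4 := enorm_jop_convOp h le_rfl f g
  have h5 : (0 : ℝ) ≤ σ₁ := by linarith [h.two_le₁]
  rw [sub_self, jop_zero] at h4
  rw [← h4, lnorm2_wabs_rep h.le₁, lnorm2_wabs_rep h5, lnorm2_wabs_rep h.two_le₂,
    lnorm2_wabs_rep h2, ofReal_convConst h.dim, zero_sub] at h3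
  simp only [← ofReal_norm] at h3
  rw [← ENNReal.ofReal_mul (norm_nonneg _), ← ENNReal.ofReal_mul (norm_nonneg _),
    ← ENNReal.ofReal_add (by positivity) (by positivity),
    ← ENNReal.ofReal_mul (convConst_nonneg d σ),
    ENNReal.ofReal_le_ofReal_iff (by have := convConst_nonneg d σ; positivity)] at h3
  refine h3.trans (mul_le_mul_of_nonneg_left ?_ (convConst_nonneg d σ))
  gcongr
  · exact norm_jop_le (sub_nonpos.2 h.le₁) f
  · exact norm_jop_le (sub_nonpos.2 h2) g

/-! ### From weighted Fourier transforms to functions -/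

/-- The continuous function represented by `f` at level `σ`. -/
def phys (σ : ℝ) (f : L2 d) : Space d → ℂ := 𝓕⁻ (rep σ f)

lemma phys_congr {σ τ : ℝ} {f g : L2 d} (h : rep σ f =ᵐ[volume] rep τ g) :
    phys σ f = phys τ g := funext fun x => Real.fourierInv_congr_ae h x

lemma phys_level {σ τ : ℝ} (h : τ ≤ σ) (f : L2 d) : phys τ (jop (τ - σ) f) = phys σ f :=
  phys_congr (rep_congr_level h f)

lemma fourierInv_add' {F G : Space d → ℂ} (hF : Integrable F) (hG : Integrable G) :
    𝓕⁻ (F + G) = 𝓕⁻ F + 𝓕⁻ G := by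
  ext x
  simp only [Pi.add_apply, Real.fourierInv_eq, smul_add]
  have h := fun {F : Space d → ℂ} (hF : Integrable F) =>
    (Real.fourierIntegral_convergent_iff (μ := volume) (-x)).2 hF
  simp only [inner_neg_right, neg_neg] at h
  exact integral_add (h hF) (h hG)

lemma fourierInv_const_mul (c : ℂ) (F : Space d → ℂ) (x : Space d) :
    𝓕⁻ (fun ξ => c * F ξ) x = c * 𝓕⁻ F x := by
  simp only [Real.fourierInv_eq]
  rw [← integral_const_mul]
  congr 1
  ext ξ
  simp only [Circle.smul_def, smul_eq_mul]
  ring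

lemma phys_add (hd : d ≤ 3) {σ : ℝ} (h : 2 ≤ σ) (f g : L2 d) (x : Space d) :
    phys σ (f + g) x = phys σ f x + phys σ g x := by
  unfold phys
  rw [Real.fourierInv_congr_ae (rep_add σ f g),
    fourierInv_add' (integrable_rep hd h f) (integrable_rep hd h g), Pi.add_apply]

lemma phys_smul (σ : ℝ) (c : ℂ) (f : L2 d) (x : Space d) :
    phys σ (c • f) x = c * phys σ f x := by
  unfold phys
  rw [← fourierInv_const_mul]
  refine Real.fourierInv_congr_ae ?_ x
  filter_upwards [Lp.coeFn_smul c f] with ξ hξ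
  rw [rep, hξ, rep, Pi.smul_apply, smul_eq_mul]
  ring

lemma phys_real_smul (σ : ℝ) (c : ℝ) (f : L2 d) (x : Space d) :
    phys σ (c • f) x = c * phys σ f x := by
  rw [← phys_smul]
  refine congrFun (congrArg (phys σ) (Lp.ext ?_)) x
  filter_upwards [Lp.coeFn_smul c f, Lp.coeFn_smul (c : ℂ) f] with ξ h1 h2
  rw [h1, h2, Pi.smul_apply, Pi.smul_apply, Complex.real_smul, smul_eq_mul]

lemma phys_sub (hd : d ≤ 3) {σ : ℝ} (h : 2 ≤ σ) (f g : L2 d) (x : Space d) :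
    phys σ (f - g) x = phys σ f x - phys σ g x := by
  have h1 := phys_add hd h f ((-1 : ℂ) • g) x
  rw [phys_smul] at h1
  rw [sub_eq_add_neg, ← neg_one_smul ℂ g, h1]
  ring

lemma phys_zero (σ : ℝ) (x : Space d) : phys σ (0 : L2 d) x = 0 := by
  have := phys_smul σ 0 (0 : L2 d) x
  rwa [zero_smul, zero_mul] at this

lemma phys_neg (σ : ℝ) (f : L2 d) (x : Space d) : phys σ (-f) x = -phys σ f x := by
  rw [← neg_one_smul ℂ f, phys_smul]; ring

lemma phys_sum (hd : d ≤ 3) {σ : ℝ} (h : 2 ≤ σ) {ι : Type*} (s : Finset ι) (f : ι → L2 d)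
    (x : Space d) : phys σ (∑ i ∈ s, f i) x = ∑ i ∈ s, phys σ (f i) x := by
  classical
  induction s using Finset.induction_on with
  | empty => simp [phys_zero]
  | insert i s hi ih => rw [Finset.sum_insert hi, Finset.sum_insert hi, phys_add hd h, ih]

lemma phys_conjRefl (σ : ℝ) (f : L2 d) (x : Space d) :
    phys σ (conjRefl f) x = star (phys σ f x) := by
  have h1 : rep σ (conjRefl f) =ᵐ[volume] fun ξ => star (rep σ f (-ξ)) := by
    filter_upwards [conjRefl_ae f] with ξ hξ
    rw [rep, hξ, rep, star_mul', jb_neg_arg]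
    simp
  unfold phys
  rw [Real.fourierInv_congr_ae h1, Real.fourierInv_eq, Real.fourierInv_eq]
  rw [← integral_neg_eq_self]
  have h2 : star (∫ v, 𝐞 (inner ℝ v x) • rep σ f v) =
      ∫ v, star (𝐞 (inner ℝ v x) • rep σ f v) :=
    (integral_conj (𝕜 := ℂ) (μ := volume) (f := fun v => 𝐞 (inner ℝ v x) • rep σ f v)).symm
  rw [h2]
  congr 1
  ext v
  rw [neg_neg, inner_neg_left]
  simp [Circle.smul_def, AddChar.map_neg_eq_inv]

lemma phys_symPart (hd : d ≤ 3) {σ : ℝ} (h : 2 ≤ σ) (f : L2 d) (x : Space d) :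
    phys σ (symPart f) x = ((phys σ f x).re : ℂ) := by
  rw [symPart_apply, phys_real_smul, phys_add hd h, phys_conjRefl]
  have := Complex.add_conj (phys σ f x)
  simp only [starRingEnd_apply] at this
  rw [this]
  push_cast
  ring

lemma phys_mul {σ₁ σ₂ σ : ℝ} (h : ConvAdm d σ₁ σ₂ σ) (f g : L2 d) (x : Space d) :
    phys σ (convOp σ₁ σ₂ σ f g) x = phys σ₁ f x * phys σ₂ g x := by
  unfold phys
  rw [Real.fourierInv_congr_ae (rep_convOp h f g), Real.fourierInv_eq_fourier_neg,
    Real.fourierInv_eq_fourier_neg, Real.fourierInv_eq_fourier_neg]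
  exact Real.fourier_mul_convolution_eq (integrable_rep h.dim h.two_le₁ f)
    (integrable_rep h.dim h.two_le₂ g) (-x)

/-! ### Derivatives -/

/-- The symbol `2πi ξ·v (1 + |ξ|²)^{-1/2}` of the derivative in the direction `v`, as a map from
level `σ` to level `σ - 1`. -/
def dirSym (v : Space d) (ξ : Space d) : ℂ :=
  (2 * Real.pi * Complex.I) * (inner ℝ ξ v : ℝ) * (jb (-1) ξ : ℂ)

lemma bddSym_dirSym (v : Space d) : BddSym (dirSym v) := by
  refine ⟨by unfold dirSym; fun_prop, 2 * Real.pi * ‖v‖, fun ξ => ?_⟩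
  rw [dirSym, norm_mul, norm_mul, Complex.norm_real, Complex.norm_real,
    Real.norm_of_nonneg (jb_nonneg _ _), jb_neg]
  have h1 : ‖(2 * Real.pi * Complex.I : ℂ)‖ = 2 * Real.pi := by
    simp [abs_of_pos Real.pi_pos]
  rw [h1, mul_assoc]
  refine mul_le_mul_of_nonneg_left ?_ (by positivity)
  rw [mul_inv_le_iff₀ (jb_pos 1 ξ)]
  refine (norm_inner_le_norm ξ v).trans ?_
  rw [mul_comm]
  exact mul_le_mul_of_nonneg_left (norm_le_jb_one ξ) (norm_nonneg v)

lemma integrable_pow_neg_rep (hd : d ≤ 3) {σ : ℝ} (k : ℕ) (h : k + 2 ≤ σ) (f : L2 d) :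
    Integrable (fun ξ => ‖ξ‖ ^ k * ‖rep σ f (-ξ)‖) volume := by
  simpa using (integrable_pow_mul_rep hd k h f).comp_neg

lemma phys_eq_fourier (σ : ℝ) (f : L2 d) : phys σ f = 𝓕 (fun ξ => rep σ f (-ξ)) :=
  Real.fourierInv_eq_fourier_comp_neg _

lemma contDiff_phys (hd : d ≤ 3) {σ : ℝ} (k : ℕ) (h : k + 2 ≤ σ) (f : L2 d) :
    ContDiff ℝ k (phys σ f) := by
  rw [phys_eq_fourier]
  refine Real.contDiff_fourier (N := k) fun n hn => integrable_pow_neg_rep hd n ?_ f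
  have : (n : ℝ) ≤ k := by exact_mod_cast hn
  linarith

lemma continuous_phys (hd : d ≤ 3) {σ : ℝ} (h : 2 ≤ σ) (f : L2 d) : Continuous (phys σ f) :=
  (contDiff_phys hd 0 (by simpa using h) f).continuous

lemma fderiv_phys (hd : d ≤ 3) {σ : ℝ} (h : 3 ≤ σ) (f : L2 d) (x v : Space d) :
    fderiv ℝ (phys σ f) x v = phys (σ - 1) (mulOp (dirSym v) f) x := by
  have h0 : Integrable (fun ξ => rep σ f (-ξ)) volume :=
    (integrable_rep hd (by linarith) f).comp_neg
  have h1 : Integrable (fun ξ => ‖ξ‖ * ‖rep σ f (-ξ)‖) volume := by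
    simpa using integrable_pow_neg_rep hd (σ := σ) 1 (by norm_num; linarith) f
  have hi : Integrable (VectorFourier.fourierSMulRight (innerSL ℝ) (fun ξ => rep σ f (-ξ)))
      volume := by
    refine (h1.const_mul (2 * Real.pi * ‖innerSL (E := Space d) ℝ‖)).mono'
      (h0.aestronglyMeasurable.fourierSMulRight) (ae_of_all _ fun ξ => ?_)
    refine (VectorFourier.norm_fourierSMulRight_le _ _ _).trans_eq (by ring)
  rw [phys_eq_fourier, (Real.hasFDerivAt_fourier h0 h1 x).fderiv,
    Real.fourier_continuousLinearMap_apply hi]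
  unfold phys
  rw [Real.fourierInv_eq_fourier_comp_neg]
  refine Real.fourier_congr_ae ?_ x
  filter_upwards [ae_neg (rep_mulOp (σ - 1) (bddSym_dirSym v) f)] with ξ hξ
  have h2 : ((innerSL ℝ) ξ) v = inner ℝ ξ v := rfl
  rw [hξ, VectorFourier.fourierSMulRight_apply, dirSym, rep, rep,
    show -σ = -1 + -(σ - 1) by ring, jb_add, inner_neg_left]
  simp only [smul_eq_mul, Complex.real_smul, jb_neg_arg]
  erw [h2]
  push_cast
  ring

/-- The wave number `2π|ξ|`. -/
def wn (ξ : Space d) : ℝ := 2 * Real.pi * ‖ξ‖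

/-- The symbol of the Laplacian, as a map from level `σ` to level `σ - 2`. -/
def lapSym (ξ : Space d) : ℂ := -(wn ξ : ℂ) ^ 2 * (jb (-2) ξ : ℂ)

lemma wn_nonneg (ξ : Space d) : 0 ≤ wn ξ := by unfold wn; positivity

@[fun_prop]
lemma measurable_wn : Measurable (wn (d := d)) := by unfold wn; fun_prop

lemma wn_le (ξ : Space d) : wn ξ ≤ 2 * Real.pi * jb 1 ξ :=
  mul_le_mul_of_nonneg_left (norm_le_jb_one ξ) (by positivity)

lemma bddSym_lapSym : BddSym (lapSym (d := d)) := by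
  refine ⟨by unfold lapSym; fun_prop, (2 * Real.pi) ^ 2, fun ξ => ?_⟩
  rw [lapSym, norm_mul, norm_neg, norm_pow, Complex.norm_real, Complex.norm_real,
    Real.norm_of_nonneg (jb_nonneg _ _), Real.norm_of_nonneg (wn_nonneg ξ), jb_neg,
    mul_inv_le_iff₀ (jb_pos 2 ξ), jb_two, ← jb_one_sq, ← mul_pow]
  exact pow_le_pow_left₀ (wn_nonneg ξ) (wn_le ξ) 2

lemma fderiv_fderiv_phys (hd : d ≤ 3) {σ : ℝ} (h : 4 ≤ σ) (f : L2 d) (x v : Space d) :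
    fderiv ℝ (fderiv ℝ (phys σ f)) x v v =
      phys (σ - 2) (mulOp (dirSym v) (mulOp (dirSym v) f)) x := by
  have hc : ContDiff ℝ 2 (phys σ f) := contDiff_phys hd 2 (by norm_num; linarith) f
  have h1 : Differentiable ℝ (fderiv ℝ (phys σ f)) :=
    (hc.fderiv_right (m := 1) (by norm_num)).differentiable (by norm_num)
  have h2 : fderiv ℝ (fun y => fderiv ℝ (phys σ f) y v) x v =
      fderiv ℝ (fderiv ℝ (phys σ f)) x v v := by
    rw [fderiv_clm_apply (h1 x) (differentiableAt_const v)]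
    simp
  rw [← h2]
  simp_rw [fderiv_phys hd (show 3 ≤ σ by linarith) f]
  change fderiv ℝ (phys (σ - 1) (mulOp (dirSym v) f)) x v = _
  rw [fderiv_phys hd (show 3 ≤ σ - 1 by linarith), sub_sub]
  norm_num

lemma lap_phys (hd : d ≤ 3) {σ : ℝ} (h : 4 ≤ σ) (f : L2 d) :
    lap (phys σ f) = phys (σ - 2) (mulOp lapSym f) := by
  ext x
  unfold lap
  rw [InnerProductSpace.laplacian_eq_iteratedFDeriv_orthonormalBasis _
    (EuclideanSpace.basisFun (Fin d) ℝ)]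
  simp only [iteratedFDeriv_two_apply, Matrix.cons_val_zero, Matrix.cons_val_one]
  simp_rw [fderiv_fderiv_phys hd h]
  rw [← phys_sum hd (by linarith)]
  congr 1
  refine Lp.ext ?_
  have hb := fun i => bddSym_dirSym (EuclideanSpace.basisFun (Fin d) ℝ i)
  have h1 : ∀ᵐ ξ, ∀ i, (mulOp (dirSym (EuclideanSpace.basisFun (Fin d) ℝ i))
      (mulOp (dirSym (EuclideanSpace.basisFun (Fin d) ℝ i)) f)) ξ =
      dirSym (EuclideanSpace.basisFun (Fin d) ℝ i) ξ *
      dirSym (EuclideanSpace.basisFun (Fin d) ℝ i) ξ * f ξ := by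
    rw [ae_all_iff]
    intro i
    rw [mulOp_mulOp (hb i) (hb i)]
    exact mulOp_ae ((hb i).mul (hb i)) f
  filter_upwards [h1, mulOp_ae bddSym_lapSym f, Lp.coeFn_fun_finsetSum Finset.univ (fun i =>
      mulOp (dirSym (EuclideanSpace.basisFun (Fin d) ℝ i))
        (mulOp (dirSym (EuclideanSpace.basisFun (Fin d) ℝ i)) f))] with ξ h1 h2 h3
  rw [h2, h3]
  simp_rw [h1]
  rw [← Finset.sum_mul]
  congr 1
  have h4 : ∀ i, dirSym (EuclideanSpace.basisFun (Fin d) ℝ i) ξ *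
      dirSym (EuclideanSpace.basisFun (Fin d) ℝ i) ξ =
      -(2 * Real.pi) ^ 2 * (jb (-2) ξ : ℂ) * ((ξ i ^ 2 : ℝ) : ℂ) := by
    intro i
    have h5 : inner ℝ ξ (EuclideanSpace.basisFun (Fin d) ℝ i) = ξ i := by
      rw [EuclideanSpace.basisFun_apply, EuclideanSpace.inner_single_right]
      simp
    rw [dirSym, h5, show (-2 : ℝ) = -1 + -1 by norm_num, jb_add]
    push_cast
    linear_combination ((2 * Real.pi) ^ 2 * (ξ i : ℂ) ^ 2 * (jb (-1) ξ : ℂ) ^ 2) * Complex.I_sq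
  simp_rw [h4]
  rw [← Finset.mul_sum, ← Complex.ofReal_sum]
  have h6 : ∑ i, ξ i ^ 2 = ‖ξ‖ ^ 2 := by
    rw [EuclideanSpace.norm_sq_eq]
    simp
  rw [h6, lapSym, wn]
  push_cast
  ring

/-- The `j`-th component `2πξ_j` of the wave vector; it is `0` for `j` beyond the dimension. -/
def kap (j : Fin 3) (ξ : Space d) : ℝ :=
  if h : (j : ℕ) < d then 2 * Real.pi * ξ ⟨j, h⟩ else 0

/-- The symbol of `∂_j`, as a map from level `σ` to level `σ - 1`. -/
def partSym (j : Fin 3) (ξ : Space d) : ℂ := Complex.I * (kap j ξ : ℂ) * (jb (-1) ξ : ℂ)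

lemma partSym_eq {j : Fin 3} (h : (j : ℕ) < d) :
    partSym j = dirSym (EuclideanSpace.single (⟨j, h⟩ : Fin d) (1 : ℝ)) := by
  ext ξ
  rw [partSym, dirSym, kap, dif_pos h, EuclideanSpace.inner_single_right]
  simp only [one_mul, conj_trivial]
  push_cast
  ring

lemma partSym_eq_zero {j : Fin 3} (h : ¬ (j : ℕ) < d) :
    partSym (d := d) j = fun _ => 0 := by
  ext ξ
  rw [partSym, kap, dif_neg h]
  simp

lemma bddSym_partSym (j : Fin 3) : BddSym (partSym (d := d) j) := by
  by_cases h : (j : ℕ) < d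
  · rw [partSym_eq h]; exact bddSym_dirSym _
  · rw [partSym_eq_zero h]; exact bddSym_const 0

lemma partialD_phys (hd : d ≤ 3) {σ : ℝ} (h : 3 ≤ σ) (j : Fin 3) (f : L2 d) :
    partialD j (phys σ f) = phys (σ - 1) (mulOp (partSym j) f) := by
  ext x
  by_cases hj : (j : ℕ) < d
  · rw [partialD, dif_pos hj, partSym_eq hj, fderiv_phys hd h]
  · rw [partialD, dif_neg hj, partSym_eq_zero hj, mulOp_const, zero_smul, phys_zero]

/-! ### Plancherel and Sobolev norms -/

/-- For an integrable square integrable function the `L²` inverse Fourier transform is given by the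
integral. -/
lemma fourierInv_toLp_ae {g : Space d → ℂ} (h1 : Integrable g) (h2 : MemLp g 2 volume) :
    (𝓕⁻ (h2.toLp g) : L2 d) =ᵐ[volume] 𝓕⁻ g := by
  have hc : Continuous (𝓕⁻ g) := by
    rw [Real.fourierInv_eq_fourier_comp_neg]
    refine (Real.contDiff_fourier (N := 0) fun n hn => ?_).continuous
    have hn0 : n = 0 := by exact_mod_cast (nonpos_iff_eq_zero.1 hn)
    subst hn0
    simpa using h1.comp_neg.norm
  refine ae_eq_of_integral_contDiff_smul_eq
    ((Lp.memLp _).locallyIntegrable (by norm_num)) hc.locallyIntegrable fun φ hφ hφc => ?_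
  have hψc : HasCompactSupport (fun x => (φ x : ℂ)) := hφc.comp_left Complex.ofReal_zero
  let ψ : SchwartzMap (Space d) ℂ :=
    hψc.toSchwartzMap (Complex.ofRealCLM.contDiff.comp hφ)
  have hψ : ∀ x, ψ x = (φ x : ℂ) := fun x => rfl
  have h3 := DFunLike.congr_fun (Lp.fourierInv_toTemperedDistribution_eq (h2.toLp g)) ψ
  rw [TemperedDistribution.fourierInv_apply, Lp.toTemperedDistribution_apply,
    Lp.toTemperedDistribution_apply] at h3
  have h4 : ∫ x, (𝓕⁻ ψ) x • (h2.toLp g) x = ∫ x, (𝓕⁻ ψ) x • g x := by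
    refine integral_congr_ae ?_
    filter_upwards [h2.coeFn_toLp] with x hx
    rw [hx]
  have h5 : ∫ x, (𝓕⁻ ψ) x • g x = ∫ x, ψ x • 𝓕⁻ g x := by
    have h6 := VectorFourier.integral_fourierIntegral_smul_eq_flip (μ := volume) (ν := volume)
      (L := (-(innerₗ (Space d)) : Space d →ₗ[ℝ] Space d →ₗ[ℝ] ℝ)) (f := ψ) (g := g)
      Real.continuous_fourierChar (by simp only [LinearMap.neg_apply, innerₗ_apply_apply]; fun_prop)
      ψ.integrable h1
    have h7 : ∀ x, VectorFourier.fourierIntegral Real.fourierChar volume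
        (-(innerₗ (Space d)) : Space d →ₗ[ℝ] Space d →ₗ[ℝ] ℝ) ψ x = (𝓕⁻ ψ) x := by
      intro x
      rw [SchwartzMap.fourierInv_coe, Real.fourierInv_eq]
      simp [VectorFourier.fourierIntegral]
    have h8 : ∀ x, VectorFourier.fourierIntegral Real.fourierChar volume
        (-(innerₗ (Space d)) : Space d →ₗ[ℝ] Space d →ₗ[ℝ] ℝ).flip g x = 𝓕⁻ g x := by
      intro x
      rw [Real.fourierInv_eq]
      simp [VectorFourier.fourierIntegral, real_inner_comm]
    simp only [h7, h8] at h6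
    exact h6
  calc ∫ x, φ x • (𝓕⁻ (h2.toLp g) : L2 d) x = ∫ x, ψ x • (𝓕⁻ (h2.toLp g) : L2 d) x := by
        simp [hψ]
    _ = ∫ x, ψ x • 𝓕⁻ g x := by rw [← h3, h4, h5]
    _ = _ := by simp [hψ]

lemma memLp_rep {σ : ℝ} (h : 0 ≤ σ) (f : L2 d) : MemLp (rep σ f) 2 volume := by
  refine ⟨(measurable_rep σ f).aestronglyMeasurable, ?_⟩
  have h1 := lnorm2_wabs_rep h f
  rw [wabs_zero, ← eLpNorm_eq_lnorm2] at h1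
  rw [h1]
  exact enorm_lt_top

lemma memLp_phys (hd : d ≤ 3) {σ : ℝ} (h : 2 ≤ σ) (f : L2 d) : MemLp (phys σ f) 2 volume :=
  (memLp_congr_ae (fourierInv_toLp_ae (integrable_rep hd h f)
    (memLp_rep (by linarith) f))).1 (Lp.memLp _)

lemma toLp_phys (hd : d ≤ 3) {σ : ℝ} (h : 2 ≤ σ) (f : L2 d) :
    (memLp_phys hd h f).toLp = 𝓕⁻ ((memLp_rep (by linarith : 0 ≤ σ) f).toLp) := by
  refine Lp.ext ((MemLp.coeFn_toLp _).trans ?_)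
  exact (fourierInv_toLp_ae (integrable_rep hd h f) (memLp_rep (by linarith) f)).symm

lemma fourier_phys (hd : d ≤ 3) {σ : ℝ} (h : 2 ≤ σ) (f : L2 d)
    (hm : MemLp (phys σ f) 2 volume) :
    (𝓕 (hm.toLp (phys σ f)) : L2 d) =ᵐ[volume] rep σ f := by
  rw [toLp_phys hd h f, FourierTransform.fourier_fourierInv_eq]
  exact MemLp.coeFn_toLp _

lemma sobolevNorm_eq (s : ℝ) {f : Space d → ℂ} (h : MemLp f 2 volume) :
    sobolevNorm s f = lnorm2 (wabs s (𝓕 (h.toLp f) : L2 d)) := by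
  rw [sobolevNorm, dif_pos h, eLpNorm_eq_lnorm2]
  congr 1
  ext ξ
  rw [wabs, ← enorm_jb, ← enorm_mul]
  rfl

lemma sobolevNorm_phys (hd : d ≤ 3) {s σ : ℝ} (h : 2 ≤ σ) (hs : s ≤ σ) (f : L2 d) :
    sobolevNorm s (phys σ f) = ‖jop (s - σ) f‖ₑ := by
  rw [sobolevNorm_eq s (memLp_phys hd h f), ← lnorm2_wabs_rep hs]
  have h1 := wabs_congr s (fourier_phys hd h f (memLp_phys hd h f))
  exact le_antisymm (lnorm2_mono h1.le) (lnorm2_mono h1.symm.le)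

lemma phys_injective (hd : d ≤ 3) {σ : ℝ} (h : 2 ≤ σ) : Function.Injective (phys (d := d) σ) := by
  intro f g hfg
  have h1 : phys σ (f - g) = fun _ => 0 := by
    ext x
    rw [phys_sub hd h, hfg, sub_self]
  have h2 := sobolevNorm_phys hd h le_rfl (f - g)
  have h3 := sobolevNorm_phys hd h le_rfl (0 : L2 d)
  have h4 : phys σ (0 : L2 d) = fun _ => 0 := by
    ext x
    rw [phys_zero]
  rw [h1, ← h4, h3, sub_self, jop_zero, jop_zero, enorm_zero] at h2
  exact sub_eq_zero.1 (enorm_eq_zero.1 h2.symm)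

/-- The `L²` pairing of two functions in terms of their Fourier transforms. -/
lemma integral_rep_mul (hd : d ≤ 3) {σ τ : ℝ} (h : 2 ≤ σ) (h' : 2 ≤ τ) (f g : L2 d) :
    ∫ ξ, star (rep σ f ξ) * rep τ g ξ = ∫ x, star (phys σ f x) * phys τ g x := by
  have h1 : inner ℂ (memLp_phys hd h f).toLp (memLp_phys hd h' g).toLp =
      (inner ℂ ((memLp_rep (by linarith : 0 ≤ σ) f).toLp)
        ((memLp_rep (by linarith : 0 ≤ τ) g).toLp) : ℂ) := by
    rw [toLp_phys hd h, toLp_phys hd h']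
    exact (Lp.fourierTransformₗᵢ (Space d) ℂ).symm.inner_map_map _ _
  rw [L2.inner_def, L2.inner_def] at h1
  have h2 : ∀ {F G : Space d → ℂ} (hF : MemLp F 2 volume) (hG : MemLp G 2 volume),
      ∫ x, inner ℂ ((hF.toLp F : L2 d) x) ((hG.toLp G : L2 d) x) = ∫ x, star (F x) * G x := by
    intro F G hF hG
    refine integral_congr_ae ?_
    filter_upwards [hF.coeFn_toLp, hG.coeFn_toLp] with x h1 h2
    rw [h1, h2, RCLike.inner_apply]
    simp [mul_comm]
  rw [h2, h2] at h1
  exact h1.symm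

/-! ### Functions in `H^s` and curves of such functions -/

/-- `F` is the weighted Fourier transform of `f`, at level `s`; that is, `rep s F` is the `L²`
Fourier transform of the `L²` function `f`. -/
def IsLift (s : ℝ) (f : Space d → ℂ) (F : L2 d) : Prop :=
  ∃ h : MemLp f 2 volume, rep s F =ᵐ[volume] (𝓕 (h.toLp f) : L2 d)

lemma isLift_phys (hd : d ≤ 3) {s σ : ℝ} (h : 2 ≤ σ) (hs : s ≤ σ) (f : L2 d) :
    IsLift s (phys σ f) (jop (s - σ) f) :=
  ⟨memLp_phys hd h f, (rep_congr_level hs f).trans (fourier_phys hd h f _).symm⟩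

lemma rep_injective {s : ℝ} {F G : L2 d} (h : rep s F =ᵐ[volume] rep s G) : F = G := by
  refine Lp.ext ?_
  filter_upwards [h] with ξ hξ
  exact mul_left_cancel₀ (by exact_mod_cast jb_ne (-s) ξ) hξ

lemma IsLift.unique {s : ℝ} {f : Space d → ℂ} {F G : L2 d} (h : IsLift s f F)
    (h' : IsLift s f G) : F = G := by
  obtain ⟨h1, h2⟩ := h
  obtain ⟨h3, h4⟩ := h'
  exact rep_injective (h2.trans h4.symm)

lemma IsLift.congr {s : ℝ} {f g : Space d → ℂ} {F : L2 d} (h : IsLift s f F)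
    (hfg : f =ᵐ[volume] g) : IsLift s g F := by
  obtain ⟨h1, h2⟩ := h
  refine ⟨(memLp_congr_ae hfg).1 h1, ?_⟩
  rwa [← (MemLp.toLp_eq_toLp_iff h1 ((memLp_congr_ae hfg).1 h1)).2 hfg]

lemma IsLift.sub {s : ℝ} {f g : Space d → ℂ} {F G : L2 d} (h : IsLift s f F)
    (h' : IsLift s g G) : IsLift s (fun x => f x - g x) (F - G) := by
  obtain ⟨h1, h2⟩ := h
  obtain ⟨h3, h4⟩ := h'
  refine ⟨h1.sub h3, ?_⟩
  have h5 : (𝓕 ((h1.sub h3).toLp (fun x => f x - g x)) : L2 d) =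
      (𝓕 (h1.toLp f) : L2 d) - (𝓕 (h3.toLp g) : L2 d) :=
    ((Lp.fourierTransformₗᵢ (Space d) ℂ).map_sub (h1.toLp f) (h3.toLp g))
  rw [h5]
  filter_upwards [h2, h4, Lp.coeFn_sub F G,
    Lp.coeFn_sub (𝓕 (h1.toLp f) : L2 d) (𝓕 (h3.toLp g) : L2 d)] with ξ e1 e2 e3 e4
  rw [e4, Pi.sub_apply, ← e1, ← e2, rep, e3, Pi.sub_apply, mul_sub, rep, rep]

lemma IsLift.smul {s : ℝ} {f : Space d → ℂ} {F : L2 d} (h : IsLift s f F) (c : ℝ) :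
    IsLift s (fun x => c • f x) (c • F) := by
  obtain ⟨h1, h2⟩ := h
  refine ⟨h1.const_smul c, ?_⟩
  have h5 : (𝓕 ((h1.const_smul c).toLp (fun x => c • f x)) : L2 d) =
      (c : ℂ) • (𝓕 (h1.toLp f) : L2 d) := by
    have h6 : (h1.const_smul c).toLp (fun x => c • f x) = (c : ℂ) • h1.toLp f := by
      refine Lp.ext ?_
      filter_upwards [(h1.const_smul c).coeFn_toLp, h1.coeFn_toLp,
        Lp.coeFn_smul (c : ℂ) (h1.toLp f)] with x e1 e2 e3
      rw [e3, Pi.smul_apply, e2]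
      refine e1.trans ?_
      simp
    rw [h6]
    exact (Lp.fourierTransformₗᵢ (Space d) ℂ).map_smul _ _
  rw [h5]
  filter_upwards [h2, Lp.coeFn_smul (c : ℂ) (𝓕 (h1.toLp f) : L2 d), rep_smul s c F]
    with ξ e1 e2 e3
  rw [e2, Pi.smul_apply, ← e1, e3, Pi.smul_apply, Complex.real_smul, smul_eq_mul]

lemma IsLift.sobolevNorm_eq {s : ℝ} {f : Space d → ℂ} {F : L2 d} (h : IsLift s f F) :
    sobolevNorm s f = ‖F‖ₑ := by
  obtain ⟨h1, h2⟩ := h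
  have h3 := lnorm2_wabs_rep (le_refl s) F
  rw [sub_self, jop_zero] at h3
  rw [MagneticZakharov.sobolevNorm_eq s h1, ← h3]
  have h4 := wabs_congr s h2
  exact le_antisymm (lnorm2_mono h4.symm.le) (lnorm2_mono h4.le)

lemma IsLift.memH {s : ℝ} {f : Space d → ℂ} {F : L2 d} (h : IsLift s f F) : MemH s f := by
  rw [MemH, h.sobolevNorm_eq]
  exact enorm_lt_top

lemma IsLift.lower {s σ : ℝ} (hs : s ≤ σ) {f : Space d → ℂ} {F : L2 d} (h : IsLift σ f F) :
    IsLift s f (jop (s - σ) F) := by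
  obtain ⟨h1, h2⟩ := h
  exact ⟨h1, (rep_congr_level hs F).trans h2⟩

lemma IsLift.phys_ae (hd : d ≤ 3) {σ : ℝ} (h2 : 2 ≤ σ) {f : Space d → ℂ} {F : L2 d}
    (h : IsLift σ f F) : phys σ F =ᵐ[volume] f := by
  obtain ⟨h1, h3⟩ := h
  have h4 : (memLp_rep (by linarith : 0 ≤ σ) F).toLp = (𝓕 (h1.toLp f) : L2 d) :=
    Lp.ext ((MemLp.coeFn_toLp _).trans h3)
  have h5 := toLp_phys hd h2 F
  rw [h4, FourierTransform.fourierInv_fourier_eq, MemLp.toLp_eq_toLp_iff] at h5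
  exact h5

lemma IsLift.phys_eq (hd : d ≤ 3) {σ : ℝ} (h2 : 2 ≤ σ) {f : Space d → ℂ} {F : L2 d}
    (h : IsLift σ f F) (hf : Continuous f) : phys σ F = f :=
  (Continuous.ae_eq_iff_eq volume (continuous_phys hd h2 F) hf).1 (h.phys_ae hd h2)

lemma MemH.exists_isLift {s : ℝ} {f : Space d → ℂ} (h : MemH s f) : ∃ F, IsLift s f F := by
  have h1 : MemLp f 2 volume := by
    by_contra h1
    rw [MemH, sobolevNorm, dif_neg h1] at h
    exact lt_irrefl _ h
  rw [MemH, sobolevNorm, dif_pos h1] at h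
  have h2 : Measurable (fun ξ : Space d => ((1 + ‖ξ‖ ^ 2) ^ (s / 2) : ℝ)) := measurable_jb s
  have h3 : MemLp (fun ξ : Space d => ((1 + ‖ξ‖ ^ 2) ^ (s / 2) : ℝ) •
      (𝓕 (h1.toLp f) : L2 d) ξ) 2 volume :=
    ⟨h2.aestronglyMeasurable.smul (Lp.aestronglyMeasurable _), h⟩
  refine ⟨h3.toLp, h1, ?_⟩
  filter_upwards [h3.coeFn_toLp] with ξ hξ
  rw [rep, hξ]
  change (jb (-s) ξ : ℂ) * ((jb s ξ : ℝ) • (𝓕 (h1.toLp f) : L2 d) ξ) = _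
  rw [Complex.real_smul, ← mul_assoc, ← Complex.ofReal_mul, ← jb_add, neg_add_cancel, jb_zero,
    Complex.ofReal_one, one_mul]

/-- The weighted Fourier transform of a real function is invariant under `conjRefl`. -/
lemma IsLift.conjRefl_eq (hd : d ≤ 3) {σ : ℝ} (h2 : 2 ≤ σ) {f : Space d → ℝ} {F : L2 d}
    (h : IsLift σ (fun x => (f x : ℂ)) F) : conjRefl F = F := by
  have h3 : phys σ (conjRefl F) =ᵐ[volume] phys σ F := by
    filter_upwards [h.phys_ae hd h2] with x hx
    rw [phys_conjRefl, hx]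
    simp
  exact phys_injective hd h2 ((Continuous.ae_eq_iff_eq volume (continuous_phys hd h2 _)
    (continuous_phys hd h2 F)).1 h3)

lemma tendsto_sobolevNorm_iff {ι : Type*} {l : Filter ι} {s : ℝ} {f : ι → Space d → ℂ}
    {F : ι → L2 d} (h : ∀ᶠ i in l, IsLift s (f i) (F i)) :
    Tendsto (fun i => sobolevNorm s (f i)) l (𝓝 0) ↔ Tendsto F l (𝓝 0) := by
  have h1 : (fun i => sobolevNorm s (f i)) =ᶠ[l] fun i => ‖F i‖ₑ :=
    h.mono fun i hi => hi.sobolevNorm_eq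
  rw [tendsto_congr' h1, tendsto_zero_iff_enorm_tendsto_zero]

lemma contInH_iff {s : ℝ} {u : ℝ → Space d → ℂ} {F : ℝ → L2 d}
    (h : ∀ t, 0 ≤ t → IsLift s (u t) (F t)) :
    ContInH s u ↔ ContinuousOn F (Ici 0) := by
  have key : ∀ t, 0 ≤ t → (Tendsto (fun τ => sobolevNorm s (fun x => u τ x - u t x))
      (𝓝[Ici 0] t) (𝓝 0) ↔ ContinuousWithinAt F (Ici 0) t) := by
    intro t ht
    rw [tendsto_sobolevNorm_iff (F := fun τ => F τ - F t), ContinuousWithinAt]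
    · exact (tendsto_sub_nhds_zero_iff)
    · exact eventually_mem_nhdsWithin.mono fun τ hτ => (h τ hτ).sub (h t ht)
  constructor
  · exact fun hu t ht => (key t ht).1 (hu t ht).2
  · exact fun hF t ht => ⟨(h t ht).memH, (key t ht).2 (hF t ht)⟩

lemma ContInH.exists_lift {s : ℝ} {u : ℝ → Space d → ℂ} (h : ContInH s u) :
    ∃ F : ℝ → L2 d, (∀ t, 0 ≤ t → IsLift s (u t) (F t)) ∧ ContinuousOn F (Ici 0) := by
  have h1 : ∀ t, ∃ F, 0 ≤ t → IsLift s (u t) F := by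
    intro t
    by_cases ht : 0 ≤ t
    · obtain ⟨F, hF⟩ := (h t ht).1.exists_isLift
      exact ⟨F, fun _ => hF⟩
    · exact ⟨0, fun h => absurd h ht⟩
  choose F hF using h1
  exact ⟨F, hF, (contInH_iff hF).1 h⟩

lemma c1InH_iff {s : ℝ} {u u' : ℝ → Space d → ℂ} {F F' : ℝ → L2 d}
    (h : ∀ t, 0 ≤ t → IsLift s (u t) (F t)) (h' : ∀ t, 0 ≤ t → IsLift s (u' t) (F' t)) :
    C1InH s u u' ↔ ContinuousOn F' (Ici 0) ∧
      ∀ t, 0 ≤ t → HasDerivWithinAt F (F' t) (Ici 0) t := by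
  have key : ∀ t, 0 ≤ t →
      (Tendsto (fun τ => sobolevNorm s (fun x => (τ - t)⁻¹ • (u τ x - u t x) - u' t x))
        (𝓝[Ici 0 \ {t}] t) (𝓝 0) ↔ HasDerivWithinAt F (F' t) (Ici 0) t) := by
    intro t ht
    rw [hasDerivWithinAt_iff_tendsto_slope,
      tendsto_sobolevNorm_iff (F := fun τ => (τ - t)⁻¹ • (F τ - F t) - F' t)]
    · exact tendsto_sub_nhds_zero_iff
    · exact eventually_mem_nhdsWithin.mono fun τ hτ =>
        (((h τ hτ.1).sub (h t ht)).smul _).sub (h' t ht)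
  rw [C1InH, contInH_iff h, contInH_iff h']
  constructor
  · rintro ⟨-, h2, h3⟩
    exact ⟨h2, fun t ht => (key t ht).1 (h3 t ht)⟩
  · rintro ⟨h2, h3⟩
    exact ⟨fun t ht => (h3 t ht).continuousWithinAt, h2, fun t ht => (key t ht).2 (h3 t ht)⟩

/-! ### Ordinary differential equations with a field that is Lipschitz on bounded sets -/

section ODE

set_option linter.unusedSectionVars false

variable {X Y Z : Type*} [NormedAddCommGroup X] [NormedSpace ℝ X] [NormedAddCommGroup Y]
  [NormedSpace ℝ Y] [NormedAddCommGroup Z] [NormedSpace ℝ Z]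

/-- The maps `F t` are bounded and Lipschitz on bounded sets, uniformly in `t`. -/
def BddLip (F : ℝ → X → Y) : Prop :=
  ∀ R : ℝ, ∃ K : ℝ, 0 ≤ K ∧ ∀ t w w', ‖w‖ ≤ R → ‖w'‖ ≤ R →
    ‖F t w‖ ≤ K ∧ ‖F t w - F t w'‖ ≤ K * ‖w - w'‖

lemma BddLip.clm (A : X →L[ℝ] Y) : BddLip (fun _ w => A w) := by
  intro R
  refine ⟨‖A‖ * max R 0 + ‖A‖, by positivity, fun t w w' hw hw' => ⟨?_, ?_⟩⟩
  · have h1 := A.le_opNorm w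
    have h2 := mul_le_mul_of_nonneg_left (hw.trans (le_max_left R 0)) (norm_nonneg A)
    linarith [norm_nonneg A]
  · rw [← map_sub]
    refine (A.le_opNorm _).trans (mul_le_mul_of_nonneg_right ?_ (norm_nonneg _))
    have : 0 ≤ ‖A‖ * max R 0 := by positivity
    linarith

lemma BddLip.add {F G : ℝ → X → Y} (hF : BddLip F) (hG : BddLip G) :
    BddLip (fun t w => F t w + G t w) := by
  intro R
  obtain ⟨K, hK, h⟩ := hF R
  obtain ⟨K', hK', h'⟩ := hG R
  refine ⟨K + K', by positivity, fun t w w' hw hw' => ⟨?_, ?_⟩⟩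
  · exact (norm_add_le _ _).trans (add_le_add (h t w w' hw hw').1 (h' t w w' hw hw').1)
  · rw [add_sub_add_comm, add_mul]
    exact (norm_add_le _ _).trans (add_le_add (h t w w' hw hw').2 (h' t w w' hw hw').2)

/-- Composition with a uniformly bounded family of linear maps. -/
lemma BddLip.clm_family {F : ℝ → X → Y} (hF : BddLip F) (A : ℝ → Y →L[ℝ] Z)
    {C : ℝ} (hC : 0 ≤ C) (hA : ∀ t y, ‖A t y‖ ≤ C * ‖y‖) : BddLip (fun t w => A t (F t w)) := by
  intro R
  obtain ⟨K, hK, h⟩ := hF R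
  refine ⟨C * K, by positivity, fun t w w' hw hw' => ⟨?_, ?_⟩⟩
  · exact (hA t _).trans (mul_le_mul_of_nonneg_left (h t w w' hw hw').1 hC)
  · rw [← map_sub, mul_assoc]
    exact (hA t _).trans (mul_le_mul_of_nonneg_left (h t w w' hw hw').2 hC)

lemma BddLip.clm_comp {F : ℝ → X → Y} (hF : BddLip F) (A : Y →L[ℝ] Z) :
    BddLip (fun t w => A (F t w)) :=
  hF.clm_family (fun _ => A) (norm_nonneg A) (fun _ y => A.le_opNorm y)

lemma BddLip.sub {F G : ℝ → X → Y} (hF : BddLip F) (hG : BddLip G) :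
    BddLip (fun t w => F t w - G t w) := by
  have := hF.add (hG.clm_comp (-ContinuousLinearMap.id ℝ Y))
  simpa [sub_eq_add_neg] using this

lemma BddLip.zero : BddLip (fun (_ : ℝ) (_ : X) => (0 : Y)) := by
  simpa using BddLip.clm (0 : X →L[ℝ] Y)

lemma BddLip.sum {ι : Type*} (s : Finset ι) {F : ι → ℝ → X → Y} (hF : ∀ i, BddLip (F i)) :
    BddLip (fun t w => ∑ i ∈ s, F i t w) := by
  classical
  induction s using Finset.induction_on with
  | empty => simpa using BddLip.zero
  | insert i s hi ih => simpa [Finset.sum_insert hi] using (hF i).add ih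

lemma BddLip.bilin {Y' : Type*} [NormedAddCommGroup Y'] [NormedSpace ℝ Y']
    {F : ℝ → X → Y} {G : ℝ → X → Y'} (hF : BddLip F) (hG : BddLip G)
    (B : Y →L[ℝ] Y' →L[ℝ] Z) : BddLip (fun t w => B (F t w) (G t w)) := by
  intro R
  obtain ⟨K, hK, h⟩ := hF R
  obtain ⟨K', hK', h'⟩ := hG R
  refine ⟨2 * (‖B‖ * K * K'), by positivity, fun t w w' hw hw' => ⟨?_, ?_⟩⟩
  · refine (B.le_opNorm₂ _ _).trans ?_
    have : ‖B‖ * ‖F t w‖ * ‖G t w‖ ≤ ‖B‖ * K * K' := by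
      gcongr
      exacts [(h t w w' hw hw').1, (h' t w w' hw hw').1]
    have h0 : 0 ≤ ‖B‖ * K * K' := by positivity
    linarith
  · have e : B (F t w) (G t w) - B (F t w') (G t w') =
        B (F t w - F t w') (G t w) + B (F t w') (G t w - G t w') := by
      simp only [map_sub, sub_apply]
      abel
    rw [e]
    have h1 : ‖B (F t w - F t w') (G t w)‖ ≤ ‖B‖ * (K * ‖w - w'‖) * K' := by
      refine (B.le_opNorm₂ _ _).trans ?_
      gcongr
      exacts [(h t w w' hw hw').2, (h' t w w' hw hw').1]
    have h2 : ‖B (F t w') (G t w - G t w')‖ ≤ ‖B‖ * K * (K' * ‖w - w'‖) := by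
      refine (B.le_opNorm₂ _ _).trans ?_
      gcongr
      exacts [(h t w' w hw' hw).1, (h' t w w' hw hw').2]
    refine (norm_add_le _ _).trans ((add_le_add h1 h2).trans_eq ?_)
    ring

lemma BddLip.pi {ι : Type*} [Fintype ι] {F : ι → ℝ → X → Y} (hF : ∀ i, BddLip (F i)) :
    BddLip (fun t w => fun i => F i t w) := by
  intro R
  choose K hK h using fun i => hF i R
  have hK0 : 0 ≤ ∑ i, K i := Finset.sum_nonneg fun i _ => hK i
  have hi : ∀ i, K i ≤ ∑ i, K i := fun i =>
    Finset.single_le_sum (f := K) (fun j _ => hK j) (Finset.mem_univ i)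
  refine ⟨∑ i, K i, hK0, fun t w w' hw hw' => ⟨?_, ?_⟩⟩
  · exact (pi_norm_le_iff_of_nonneg hK0).2 fun i => (h i t w w' hw hw').1.trans (hi i)
  · refine (pi_norm_le_iff_of_nonneg (by positivity)).2 fun i => ?_
    exact (h i t w w' hw hw').2.trans (mul_le_mul_of_nonneg_right (hi i) (norm_nonneg _))

lemma BddLip.prodMk {F : ℝ → X → Y} {G : ℝ → X → Z} (hF : BddLip F) (hG : BddLip G) :
    BddLip (fun t w => (F t w, G t w)) := by
  intro R
  obtain ⟨K, hK, h⟩ := hF R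
  obtain ⟨K', hK', h'⟩ := hG R
  refine ⟨max K K', le_max_of_le_left hK, fun t w w' hw hw' => ⟨?_, ?_⟩⟩
  · exact max_le_max (h t w w' hw hw').1 (h' t w w' hw hw').1
  · rw [max_mul_of_nonneg _ _ (norm_nonneg _)]
    exact max_le_max (h t w w' hw hw').2 (h' t w w' hw hw').2

lemma hasDerivWithinAt_Ici_of_Icc {f : ℝ → X} {f' : X} {a b t : ℝ} (ht : t ∈ Ico a b)
    (h : HasDerivWithinAt f f' (Icc a b) t) : HasDerivWithinAt f f' (Ici t) t := by
  refine h.mono_of_mem_nhdsWithin ?_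
  filter_upwards [Icc_mem_nhdsGE ht.2] with x hx
  exact ⟨ht.1.trans hx.1, hx.2⟩

lemma BddLip.unique {F : ℝ → X → X} (hF : BddLip F) {T : ℝ} {f g : ℝ → X}
    (hf : ∀ t ∈ Icc 0 T, HasDerivWithinAt f (F t (f t)) (Icc 0 T) t)
    (hg : ∀ t ∈ Icc 0 T, HasDerivWithinAt g (F t (g t)) (Icc 0 T) t)
    (h0 : f 0 = g 0) : EqOn f g (Icc 0 T) := by
  have cf : ContinuousOn f (Icc 0 T) := fun t ht => (hf t ht).continuousWithinAt
  have cg : ContinuousOn g (Icc 0 T) := fun t ht => (hg t ht).continuousWithinAt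
  obtain ⟨R, hR⟩ := isCompact_Icc.exists_bound_of_continuousOn cf
  obtain ⟨R', hR'⟩ := isCompact_Icc.exists_bound_of_continuousOn cg
  obtain ⟨K, hK, h⟩ := hF (max R R')
  refine ODE_solution_unique_of_mem_Icc_right (v := F) (K := ⟨K, hK⟩)
    (s := fun _ => {w | ‖w‖ ≤ max R R'}) ?_ cf
    (fun t ht => hasDerivWithinAt_Ici_of_Icc ht (hf t (Ico_subset_Icc_self ht)))
    (fun t ht => (hR t (Ico_subset_Icc_self ht)).trans (le_max_left _ _)) cg
    (fun t ht => hasDerivWithinAt_Ici_of_Icc ht (hg t (Ico_subset_Icc_self ht)))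
    (fun t ht => (hR' t (Ico_subset_Icc_self ht)).trans (le_max_right _ _)) h0
  intro t _
  refine LipschitzOnWith.of_dist_le_mul fun w hw w' hw' => ?_
  rw [dist_eq_norm, dist_eq_norm]
  exact (h t w w' hw hw').2

/-- The cut-off that equals `1` on the ball of radius `R` and `0` outside the ball of radius
`R + 1`. -/
def cutoff (R : ℝ) (w : X) : ℝ := max 0 (min 1 (R + 1 - ‖w‖))

lemma cutoff_nonneg (R : ℝ) (w : X) : 0 ≤ cutoff R w := le_max_left _ _

lemma cutoff_le_one (R : ℝ) (w : X) : cutoff R w ≤ 1 := max_le zero_le_one (min_le_left _ _)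

lemma cutoff_eq_one {R : ℝ} {w : X} (h : ‖w‖ ≤ R) : cutoff R w = 1 := by
  unfold cutoff
  rw [min_eq_left (by linarith), max_eq_right zero_le_one]

lemma cutoff_eq_zero {R : ℝ} {w : X} (h : R + 1 ≤ ‖w‖) : cutoff R w = 0 := by
  unfold cutoff
  exact max_eq_left ((min_le_right _ _).trans (by linarith))

lemma abs_cutoff_sub_le (R : ℝ) (w w' : X) : |cutoff R w - cutoff R w'| ≤ ‖w - w'‖ := by
  unfold cutoff
  refine (abs_max_sub_max_le_max _ _ _ _).trans ?_
  rw [sub_self, abs_zero, max_eq_right (abs_nonneg _)]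
  refine (abs_min_sub_min_le_max _ _ _ _).trans ?_
  rw [sub_self, abs_zero, max_eq_right (abs_nonneg _)]
  have := abs_norm_sub_norm_le w' w
  rw [norm_sub_rev w w']
  rwa [show R + 1 - ‖w‖ - (R + 1 - ‖w'‖) = ‖w'‖ - ‖w‖ by ring]

/-- The truncated vector field is bounded and globally Lipschitz. -/
lemma BddLip.exists_truncated {F : ℝ → X → X} (hF : BddLip F) (R : ℝ) :
    ∃ K : ℝ, 0 ≤ K ∧ ∀ t w w', ‖cutoff R w • F t w‖ ≤ K ∧
      ‖cutoff R w • F t w - cutoff R w' • F t w'‖ ≤ 2 * K * ‖w - w'‖ := by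
  obtain ⟨K, hK, h⟩ := hF (R + 1)
  have hb : ∀ t w, ‖cutoff R w • F t w‖ ≤ K := by
    intro t w
    rcases le_total ‖w‖ (R + 1) with hw | hw
    · rw [norm_smul, Real.norm_of_nonneg (cutoff_nonneg R w)]
      calc _ ≤ 1 * K := mul_le_mul (cutoff_le_one R w) (h t w w hw hw).1 (norm_nonneg _)
            zero_le_one
        _ = K := one_mul K
    · rw [cutoff_eq_zero hw, zero_smul, norm_zero]
      exact hK
  have hone : ∀ t w w', ‖w‖ ≤ R + 1 → R + 1 ≤ ‖w'‖ →
      ‖cutoff R w • F t w - cutoff R w' • F t w'‖ ≤ 2 * K * ‖w - w'‖ := by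
    intro t w w' hw hw'
    have h1 := abs_cutoff_sub_le R w w'
    rw [cutoff_eq_zero hw', sub_zero] at h1
    rw [cutoff_eq_zero hw', zero_smul, sub_zero, norm_smul, Real.norm_eq_abs]
    have h2 := mul_le_mul h1 (h t w w hw hw).1 (norm_nonneg _) (norm_nonneg _)
    have h3 : 0 ≤ ‖w - w'‖ * K := by positivity
    linarith
  refine ⟨K, hK, fun t w w' => ⟨hb t w, ?_⟩⟩
  rcases le_total ‖w‖ (R + 1) with hw | hw <;> rcases le_total ‖w'‖ (R + 1) with hw' | hw'
  · have e : cutoff R w • F t w - cutoff R w' • F t w' =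
        (cutoff R w - cutoff R w') • F t w + cutoff R w' • (F t w - F t w') := by
      module
    rw [e]
    refine (norm_add_le _ _).trans ?_
    rw [norm_smul, norm_smul, Real.norm_eq_abs, Real.norm_of_nonneg (cutoff_nonneg R w')]
    have h1 := mul_le_mul (abs_cutoff_sub_le R w w') (h t w w hw hw).1 (norm_nonneg _)
      (norm_nonneg _)
    have h2 := mul_le_mul (cutoff_le_one R w') (h t w w' hw hw').2 (norm_nonneg _) zero_le_one
    linarith
  · exact hone t w w' hw hw'
  · rw [norm_sub_rev, norm_sub_rev w w']
    exact hone t w' w hw' hw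
  · rw [cutoff_eq_zero hw, cutoff_eq_zero hw', zero_smul, zero_smul, sub_self, norm_zero]
    positivity

/-- Solutions of a truncated equation exist on arbitrarily long intervals. -/
lemma BddLip.exists_truncated_solution [CompleteSpace X] {F : ℝ → X → X} (hF : BddLip F)
    (hc : ∀ w, Continuous fun t => F t w) (w₀ : X) (R : ℝ) {T : ℝ} (hT : 0 ≤ T) :
    ∃ w : ℝ → X, w 0 = w₀ ∧
      ∀ t ∈ Icc 0 T, HasDerivWithinAt w (cutoff R (w t) • F t (w t)) (Icc 0 T) t := by
  obtain ⟨K, hK, h⟩ := hF.exists_truncated R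
  have hPL : IsPicardLindelof (fun t w => cutoff R w • F t w) (⟨0, le_rfl, hT⟩ : Icc (0 : ℝ) T)
      w₀ ⟨K * T, by positivity⟩ 0 ⟨K, hK⟩ ⟨2 * K, by positivity⟩ := by
    refine ⟨fun t _ => ?_, fun w _ => ?_, fun t _ w _ => (h t w w).1, ?_⟩
    · refine LipschitzOnWith.of_dist_le_mul fun w _ w' _ => ?_
      rw [dist_eq_norm, dist_eq_norm]
      exact (h t w w').2
    · exact (continuous_const.smul (hc w)).continuousOn
    · simp only [sub_zero, sub_self, max_eq_left hT]
      simp only [NNReal.coe_zero, sub_zero]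
      exact le_rfl
  exact hPL.exists_eq_forall_mem_Icc_hasDerivWithinAt₀

/-- Global existence from an a priori bound that is uniform with respect to slowing down the
equation by a factor `χ(t) ∈ [0, 1]`. The factor makes room for truncations of the vector field. -/
theorem BddLip.exists_global [CompleteSpace X] {F : ℝ → X → X} (hF : BddLip F)
    (hc : ∀ w, Continuous fun t => F t w) (w₀ : X)
    (apriori : ∀ T : ℝ, 0 ≤ T → ∃ M : ℝ, ∀ (χ : ℝ → ℝ) (w : ℝ → X),
      (∀ t, 0 ≤ χ t ∧ χ t ≤ 1) → w 0 = w₀ →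
      (∀ t ∈ Icc 0 T, HasDerivWithinAt w (χ t • F t (w t)) (Icc 0 T) t) →
      ∀ t ∈ Icc 0 T, ‖w t‖ ≤ M) :
    ∃ w : ℝ → X, w 0 = w₀ ∧ ∀ t, 0 ≤ t → HasDerivWithinAt w (F t (w t)) (Ici 0) t := by
  have h1 : ∀ N : ℕ, ∃ w : ℝ → X, w 0 = w₀ ∧
      ∀ t ∈ Icc (0 : ℝ) N, HasDerivWithinAt w (F t (w t)) (Icc (0 : ℝ) N) t := by
    intro N
    obtain ⟨M, hM⟩ := apriori N N.cast_nonneg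
    obtain ⟨w, hw0, hw⟩ := hF.exists_truncated_solution hc w₀ M (T := N) N.cast_nonneg
    refine ⟨w, hw0, fun t ht => ?_⟩
    -- with the truncation at the radius of the a priori bound, the cut-off is never active
    have h2 := hM (fun t => cutoff M (w t)) w
      (fun t => ⟨cutoff_nonneg _ _, cutoff_le_one _ _⟩) hw0 hw t ht
    have h3 := hw t ht
    rwa [cutoff_eq_one h2, one_smul] at h3
  choose W hW0 hW using h1
  have hmono : ∀ {m n : ℕ}, m ≤ n → EqOn (W n) (W m) (Icc (0 : ℝ) m) := by
    intro m n hmn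
    have hs : Icc (0 : ℝ) m ⊆ Icc (0 : ℝ) n := Icc_subset_Icc_right (by exact_mod_cast hmn)
    exact hF.unique (fun t ht => (hW n t (hs ht)).mono hs) (hW m) (by rw [hW0, hW0])
  let w : ℝ → X := fun t => W (⌈t⌉₊ + 1) t
  have hw : ∀ N : ℕ, EqOn w (W N) (Icc (0 : ℝ) N) := by
    intro N t ht
    change W (⌈t⌉₊ + 1) t = W N t
    have h2 : t ≤ ((⌈t⌉₊ + 1 : ℕ) : ℝ) := by
      push_cast
      linarith [Nat.le_ceil t]
    rcases le_total (⌈t⌉₊ + 1) N with h | h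
    · exact (hmono h ⟨ht.1, h2⟩).symm
    · exact hmono h ht
  refine ⟨w, hW0 _, fun t ht => ?_⟩
  obtain ⟨N, hN⟩ := exists_nat_gt t
  have htN : t ∈ Icc (0 : ℝ) N := ⟨ht, hN.le⟩
  have h3 := (hW N t htN).congr (fun x hx => hw N hx) (hw N htN)
  rw [← hw N htN] at h3
  refine h3.mono_of_mem_nhdsWithin ?_
  filter_upwards [self_mem_nhdsWithin, mem_nhdsWithin_of_mem_nhds (Iio_mem_nhds hN)] with x h4 h5
  exact ⟨h4, h5.le⟩

/-- A function that is differentiable only in a weaker norm is differentiable as soon as its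
derivative is a continuous function in the stronger norm. -/
lemma hasDerivWithinAt_of_injective [CompleteSpace X] (A : X →L[ℝ] Y)
    (hA : Function.Injective A) {f g : ℝ → X} (hg : ContinuousOn g (Ici 0))
    (h : ∀ t, 0 ≤ t → HasDerivWithinAt (fun τ => A (f τ)) (A (g t)) (Ici 0) t) :
    ∀ t, 0 ≤ t → HasDerivWithinAt f (g t) (Ici 0) t := by
  let g' : ℝ → X := fun t => g (max t 0)
  have hg' : Continuous g' := by
    refine continuousOn_univ.1 (hg.comp (by fun_prop) fun t _ => le_max_right t 0)
  have hgg : ∀ t, 0 ≤ t → g' t = g t := fun t ht => by simp only [g', max_eq_left ht]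
  -- the primitive of `g` in the stronger norm, which turns out to be `f`
  let y : ℝ → X := fun t => f 0 + ∫ τ in (0 : ℝ)..t, g' τ
  have hy : ∀ t, HasDerivAt y (g' t) t := fun t =>
    (intervalIntegral.integral_hasDerivAt_right (hg'.intervalIntegrable _ _)
      (hg'.stronglyMeasurableAtFilter _ _) hg'.continuousAt).const_add _
  have hz : ∀ t, 0 ≤ t →
      HasDerivWithinAt (fun τ => A (y τ) - A (f τ)) 0 (Ici 0) t := by
    intro t ht
    have h1 := ((A.hasFDerivAt.comp_hasDerivAt t (hy t)).hasDerivWithinAt (s := Ici 0)).sub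
      (h t ht)
    rw [hgg t ht, sub_self] at h1
    exact h1
  have heq : ∀ t, 0 ≤ t → y t = f t := by
    intro t ht
    have h2 := constant_of_derivWithin_zero (f := fun τ => A (y τ) - A (f τ)) (a := 0) (b := t)
      (fun s hs => ((hz s hs.1).mono Icc_subset_Ici_self).differentiableWithinAt)
      (fun s hs => by
        refine ((hz s hs.1).mono Icc_subset_Ici_self).derivWithin ?_
        exact uniqueDiffOn_Icc (hs.1.trans_lt hs.2) s ⟨hs.1, hs.2.le⟩) t ⟨ht, le_rfl⟩
    have h3 : y 0 = f 0 := by simp [y]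
    simp only [h3, sub_self] at h2
    exact hA (sub_eq_zero.1 h2)
  intro t ht
  have h4 := (hy t).hasDerivWithinAt (s := Ici 0)
  rw [hgg t ht] at h4
  exact h4.congr (fun x hx => (heq x hx).symm) (heq t ht).symm

end ODE

/-! ### Oscillating multipliers -/

/-- The symbol `exp (-i t θ(ξ))`. -/
def oscSym (θ : Space d → ℝ) (t : ℝ) (ξ : Space d) : ℂ :=
  Complex.exp (Complex.I * ((-(t * θ ξ) : ℝ) : ℂ))

/-- The unitary group with the symbol `exp (-i t θ(ξ))`. -/
def osc (θ : Space d → ℝ) (t : ℝ) : L2 d →L[ℝ] L2 d := mulOp (oscSym θ t)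

section

variable {θ : Space d → ℝ}

lemma norm_oscSym (t : ℝ) (ξ : Space d) : ‖oscSym θ t ξ‖ = 1 := by
  rw [oscSym, mul_comm, Complex.norm_exp_ofReal_mul_I]

lemma measurable_oscSym (hθ : Measurable θ) (t : ℝ) : Measurable (oscSym θ t) := by
  unfold oscSym; fun_prop

lemma bddSym_oscSym (hθ : Measurable θ) (t : ℝ) : BddSym (oscSym θ t) :=
  ⟨measurable_oscSym hθ t, 1, fun ξ => (norm_oscSym t ξ).le⟩

lemma norm_osc (hθ : Measurable θ) (t : ℝ) (f : L2 d) : ‖osc θ t f‖ = ‖f‖ :=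
  norm_mulOp_unimodular (measurable_oscSym hθ t) (norm_oscSym t) f

lemma oscSym_add (s t : ℝ) (ξ : Space d) : oscSym θ (s + t) ξ = oscSym θ s ξ * oscSym θ t ξ := by
  rw [oscSym, oscSym, oscSym, ← Complex.exp_add]
  congr 1
  push_cast
  ring

lemma oscSym_zero (ξ : Space d) : oscSym θ 0 ξ = 1 := by simp [oscSym]

lemma osc_osc (hθ : Measurable θ) (s t : ℝ) (f : L2 d) :
    osc θ s (osc θ t f) = osc θ (s + t) f :=
  mulOp_mulOp_eq (bddSym_oscSym hθ s) (bddSym_oscSym hθ t) (fun ξ => (oscSym_add s t ξ).symm) f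

lemma osc_zero (f : L2 d) : osc θ 0 f = f := mulOp_eq_self oscSym_zero f

lemma osc_osc_neg (hθ : Measurable θ) (t : ℝ) (f : L2 d) : osc θ t (osc θ (-t) f) = f := by
  rw [osc_osc hθ, add_neg_cancel, osc_zero]

lemma osc_mulOp (hθ : Measurable θ) (t : ℝ) {m : Space d → ℂ} (hm : BddSym m) (f : L2 d) :
    osc θ t (mulOp m f) = mulOp m (osc θ t f) := mulOp_comm (bddSym_oscSym hθ t) hm f

lemma continuous_oscSym (ξ : Space d) : Continuous fun t => oscSym θ t ξ := by
  unfold oscSym; fun_prop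

/-- Strong continuity of the group. -/
lemma continuous_osc (hθ : Measurable θ) (f : L2 d) : Continuous fun t => osc θ t f := by
  rw [continuous_iff_continuousAt]
  intro t
  exact tendsto_mulOp (C := 1) (fun s => measurable_oscSym hθ s) (measurable_oscSym hθ t)
    (fun s ξ => (norm_oscSym s ξ).le) (fun ξ => (norm_oscSym t ξ).le)
    (fun ξ => (continuous_oscSym ξ).tendsto t) f

lemma tendsto_osc (hθ : Measurable θ) {ι : Type*} {l : Filter ι} {τ : ι → ℝ} {t : ℝ}
    {f : ι → L2 d} {g : L2 d} (hτ : Tendsto τ l (𝓝 t)) (hf : Tendsto f l (𝓝 g)) :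
    Tendsto (fun i => osc θ (τ i) (f i)) l (𝓝 (osc θ t g)) := by
  have h1 : Tendsto (fun i => osc θ (τ i) (f i - g)) l (𝓝 0) := by
    rw [tendsto_zero_iff_norm_tendsto_zero]
    simp_rw [norm_osc hθ]
    exact tendsto_zero_iff_norm_tendsto_zero.1 (tendsto_sub_nhds_zero_iff.2 hf)
  have h2 : Tendsto (fun i => osc θ (τ i) g) l (𝓝 (osc θ t g)) :=
    ((continuous_osc hθ g).tendsto t).comp hτ
  have h3 := h1.add h2
  rw [zero_add] at h3
  refine h3.congr fun i => ?_
  rw [map_sub, sub_add_cancel]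

lemma continuousOn_osc_apply (hθ : Measurable θ) {τ : ℝ → ℝ} (hτ : Continuous τ)
    {f : ℝ → L2 d} {s : Set ℝ} (hf : ContinuousOn f s) :
    ContinuousOn (fun t => osc θ (τ t) (f t)) s := fun t ht =>
  tendsto_osc hθ ((hτ.tendsto t).mono_left nhdsWithin_le_nhds) (hf t ht)

/-- The symbol `-iθ(ξ) b(ξ)`. -/
def genSym (θ : Space d → ℝ) (b : Space d → ℂ) (ξ : Space d) : ℂ :=
  -(Complex.I * (θ ξ : ℂ)) * b ξ

/-- Strong differentiability of the group on functions in the domain of its generator. -/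
lemma hasDerivAt_osc (hθ : Measurable θ) {b : Space d → ℂ} (hb : BddSym b)
    (hθb : BddSym (genSym θ b)) (f : L2 d) (t : ℝ) :
    HasDerivAt (fun τ => osc θ τ (mulOp b f)) (osc θ t (mulOp (genSym θ b) f)) t := by
  obtain ⟨C, hC⟩ := hθb.2
  rw [hasDerivAt_iff_tendsto_slope_zero]
  let q : ℝ → Space d → ℂ := fun h ξ => ((h⁻¹ : ℝ) : ℂ) * (oscSym θ h ξ + -1) * b ξ
  have hqm : ∀ h, Measurable (q h) := fun h =>
    (measurable_const.mul ((measurable_oscSym hθ h).add measurable_const)).mul hb.1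
  have hqC : ∀ h ξ, ‖q h ξ‖ ≤ C := by
    intro h ξ
    refine le_trans ?_ (hC ξ)
    rw [genSym, norm_mul, norm_mul, norm_mul, norm_neg, norm_mul, Complex.norm_I, one_mul]
    refine mul_le_mul_of_nonneg_right ?_ (norm_nonneg _)
    have h1 : ‖oscSym θ h ξ + -1‖ ≤ |h| * ‖(θ ξ : ℂ)‖ := by
      have := Real.norm_exp_I_mul_ofReal_sub_one_le (x := -(h * θ ξ))
      rw [norm_neg, norm_mul] at this
      rw [← sub_eq_add_neg, oscSym, Complex.norm_real]
      exact this
    rw [Complex.norm_real, Real.norm_eq_abs, abs_inv]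
    rcases eq_or_ne h 0 with rfl | hh
    · simp
    · rw [inv_mul_le_iff₀ (abs_pos.2 hh)]
      exact h1
  have hqb : ∀ h, BddSym (q h) := fun h => ⟨hqm h, C, hqC h⟩
  have hlim : Tendsto (fun h => mulOp (q h) f) (𝓝[≠] 0) (𝓝 (mulOp (genSym θ b) f)) := by
    refine tendsto_mulOp hqm hθb.1 hqC hC (fun ξ => ?_) f
    have h1 : HasDerivAt (fun τ => oscSym θ τ ξ) (-(Complex.I * (θ ξ : ℂ))) 0 := by
      have h2 : HasDerivAt (fun τ : ℝ => Complex.I * ((-(τ * θ ξ) : ℝ) : ℂ))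
          (Complex.I * ((-(1 * θ ξ) : ℝ) : ℂ)) 0 :=
        (((hasDerivAt_id (0 : ℝ)).mul_const (θ ξ)).neg.ofReal_comp).const_mul _
      have h3 := h2.cexp
      simpa [oscSym] using h3
    have h4 := hasDerivAt_iff_tendsto_slope_zero.1 h1
    simp only [zero_add, oscSym_zero] at h4
    have h5 := h4.mul_const (b ξ)
    refine h5.congr fun h => ?_
    simp only [q, Complex.real_smul, sub_eq_add_neg]
  have h6 := ((osc θ t).continuous.tendsto _).comp hlim
  refine h6.congr fun h => ?_
  have h7 : mulOp (q h) f = h⁻¹ • (osc θ h (mulOp b f) - mulOp b f) := by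
    have h8 : BddSym (fun ξ => oscSym θ h ξ + -1) :=
      (bddSym_oscSym hθ h).add (bddSym_const _)
    have h9 : mulOp (q h) f = mulOp (fun _ => ((h⁻¹ : ℝ) : ℂ))
        (mulOp (fun ξ => oscSym θ h ξ + -1) (mulOp b f)) := by
      rw [mulOp_mulOp h8 hb, mulOp_mulOp (bddSym_const _) (h8.mul hb)]
      simp only [q, mul_assoc]
    rw [h9, mulOp_const, mulOp_add_sym (bddSym_oscSym hθ h) (bddSym_const _), mulOp_const,
      neg_one_smul, ← sub_eq_add_neg]
    refine Lp.ext ?_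
    filter_upwards [Lp.coeFn_smul ((h⁻¹ : ℝ) : ℂ) (mulOp (oscSym θ h) (mulOp b f) - mulOp b f),
      Lp.coeFn_smul (h⁻¹ : ℝ) (osc θ h (mulOp b f) - mulOp b f)] with ξ e1 e2
    rw [e1, e2, Pi.smul_apply, Pi.smul_apply, Complex.real_smul, smul_eq_mul]
    rfl
  rw [Function.comp_apply, h7, map_smul, map_sub, osc_osc hθ]

/-- The product rule for the group acting on a curve. -/
lemma hasDerivWithinAt_osc_apply (hθ : Measurable θ) {f : ℝ → L2 d} {f' g : L2 d} {s : Set ℝ}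
    {t : ℝ} (hf : HasDerivWithinAt f f' s t)
    (hg : HasDerivAt (fun τ => osc θ τ (f t)) g t) :
    HasDerivWithinAt (fun τ => osc θ τ (f τ)) (osc θ t f' + g) s t := by
  have h1 : HasDerivWithinAt (fun τ => osc θ τ (f τ - f t)) (osc θ t f') s t := by
    rw [hasDerivWithinAt_iff_tendsto_slope] at hf ⊢
    have h2 := tendsto_osc hθ (l := 𝓝[s \ {t}] t) (τ := fun τ => τ)
      (tendsto_id.mono_left nhdsWithin_le_nhds) hf
    refine h2.congr fun τ => ?_
    rw [slope_def_module, slope_def_module, map_smul, sub_self, map_zero, sub_zero]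
  have h3 := h1.add (hg.hasDerivWithinAt (s := s))
  refine h3.congr_of_eventuallyEq (Eventually.of_forall fun τ => ?_) ?_
  · simp only [Pi.add_apply, map_sub, sub_add_cancel]
  · simp

end

/-! ### The symbols of the system -/

/-- The symbol `1 + ε² |2πξ|⁴` of `1 + ε² Δ²`. -/
def regSym (ε : ℝ) (ξ : Space d) : ℝ := 1 + ε ^ 2 * wn ξ ^ 4

/-- The frequency `(|2πξ|² + |2πξ|⁴)^{1/2}` of the equation for `B`. -/
def magFreq (ξ : Space d) : ℝ := wn ξ * √(1 + wn ξ ^ 2)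

/-- The symbol of `∇ div - α curl curl`, from a level of regularity to the one four orders below,
where all terms of the equation for `E` are formed. -/
def linSym (α : ℝ) (i j : Fin 3) (ξ : Space d) : ℂ :=
  (((α - 1) * kap i ξ * kap j ξ - if i = j then α * wn ξ ^ 2 else 0 : ℝ) : ℂ) * (jb (-4) ξ : ℂ)

/-- The symbol of `i (1 + ε² Δ²)⁻¹`, from a level of regularity to the one four orders above. -/
def resSym (ε : ℝ) (ξ : Space d) : ℂ := Complex.I * (((regSym ε ξ)⁻¹ * jb 4 ξ : ℝ) : ℂ)

/-- The square root of `1 + ε² Δ²`, from level `σ` to `L²`. -/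
def massSym (ε σ : ℝ) (ξ : Space d) : ℂ := ((√(regSym ε ξ) * jb (-σ) ξ : ℝ) : ℂ)

/-- The symbol `|2πξ|` of order one. -/
def waveSym (ξ : Space d) : ℂ := ((wn ξ * jb (-1) ξ : ℝ) : ℂ)

/-- The symbol `i |2πξ|⁴ / ω(ξ)` of order two, where `ω = magFreq`. -/
def magSym (ξ : Space d) : ℂ :=
  Complex.I * ((wn ξ ^ 3 / √(1 + wn ξ ^ 2) * jb (-2) ξ : ℝ) : ℂ)

lemma jb_four (ξ : Space d) : jb 4 ξ = (1 + ‖ξ‖ ^ 2) ^ 2 := by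
  rw [← jb_two, sq, ← jb_add]; norm_num

lemma two_pi_ge : (1 : ℝ) ≤ 2 * Real.pi := by linarith [Real.pi_gt_three]

lemma norm_le_wn (ξ : Space d) : ‖ξ‖ ≤ wn ξ :=
  le_mul_of_one_le_left (norm_nonneg ξ) two_pi_ge

lemma wn_sq_le (ξ : Space d) : wn ξ ^ 2 ≤ (2 * Real.pi) ^ 2 * jb 2 ξ := by
  have := pow_le_pow_left₀ (wn_nonneg ξ) (wn_le ξ) 2
  rwa [mul_pow, jb_one_sq, ← jb_two] at this

lemma wn_neg (ξ : Space d) : wn (-ξ) = wn ξ := by simp [wn]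

lemma abs_kap_le (i : Fin 3) (ξ : Space d) : |kap i ξ| ≤ wn ξ := by
  unfold kap wn
  split_ifs with h
  · rw [abs_mul, abs_of_nonneg Real.two_pi_pos.le]
    exact mul_le_mul_of_nonneg_left (by simpa using PiLp.norm_apply_le ξ ⟨i, h⟩)
      Real.two_pi_pos.le
  · simp only [abs_zero]; positivity

lemma measurable_kap (i : Fin 3) : Measurable (kap (d := d) i) := by
  unfold kap
  split_ifs with h
  · fun_prop
  · exact measurable_const

lemma measurable_regSym (ε : ℝ) : Measurable (regSym (d := d) ε) := by
  have := measurable_wn (d := d); unfold regSym; fun_prop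

lemma one_le_regSym (ε : ℝ) (ξ : Space d) : 1 ≤ regSym ε ξ := by
  unfold regSym
  have := mul_nonneg (sq_nonneg ε) (pow_nonneg (wn_nonneg ξ) 4)
  linarith

lemma regSym_pos (ε : ℝ) (ξ : Space d) : 0 < regSym ε ξ :=
  one_pos.trans_le (one_le_regSym ε ξ)

/-- Ellipticity of `1 + ε² Δ²`. -/
lemma jb_four_le {ε : ℝ} (hε : ε ∈ Ioo (0 : ℝ) 1) (ξ : Space d) :
    jb 4 ξ ≤ (2 / ε) ^ 2 * regSym ε ξ := by
  have h0 := hε.1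
  have h1 : ‖ξ‖ ^ 4 ≤ wn ξ ^ 4 := pow_le_pow_left₀ (norm_nonneg ξ) (norm_le_wn ξ) 4
  have h2 : (2 / ε) ^ 2 * regSym ε ξ = 4 * (1 / ε ^ 2) + 4 * wn ξ ^ 4 := by
    unfold regSym; field_simp; ring
  have h3 : 1 ≤ 1 / ε ^ 2 := by
    rw [le_div_iff₀ (by positivity)]; nlinarith [hε.2]
  rw [h2, jb_four]
  nlinarith [sq_nonneg (1 - ‖ξ‖ ^ 2), sq_nonneg (‖ξ‖ ^ 2)]

lemma regSym_le (ε : ℝ) (ξ : Space d) :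
    regSym ε ξ ≤ (1 + |ε| * (2 * Real.pi) ^ 2) ^ 2 * jb 4 ξ := by
  have h1 := pow_le_pow_left₀ (sq_nonneg _) (wn_sq_le ξ) 2
  rw [mul_pow, jb_two, ← jb_four, ← pow_mul] at h1
  have h2 := one_le_jb (by norm_num : (0 : ℝ) ≤ 4) ξ
  have h3 := mul_le_mul_of_nonneg_left h1 (sq_nonneg ε)
  have h4 : 0 ≤ 2 * (|ε| * (2 * Real.pi) ^ 2) * jb 4 ξ := by
    have := jb_nonneg 4 ξ; positivity
  have h5 := sq_abs ε
  unfold regSym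
  norm_num at h3
  calc 1 + ε ^ 2 * wn ξ ^ 4 ≤ jb 4 ξ + |ε| ^ 2 * (((2 * Real.pi) ^ 2) ^ 2 * jb 4 ξ) := by
        rw [h5]; linarith
    _ ≤ _ := by nlinarith

lemma sqrt_regSym_le (ε : ℝ) (ξ : Space d) :
    √(regSym ε ξ) ≤ (1 + |ε| * (2 * Real.pi) ^ 2) * jb 2 ξ := by
  rw [Real.sqrt_le_left (by have := jb_nonneg 2 ξ; positivity), mul_pow, jb_two, ← jb_four]
  exact regSym_le ε ξ

lemma jb_two_le {ε : ℝ} (hε : ε ∈ Ioo (0 : ℝ) 1) (ξ : Space d) :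
    jb 2 ξ ≤ 2 / ε * √(regSym ε ξ) := by
  have h0 := hε.1
  refine le_of_sq_le_sq ?_ (by positivity)
  rw [mul_pow, Real.sq_sqrt (regSym_pos ε ξ).le, jb_two, ← jb_four]
  exact jb_four_le hε ξ

lemma bddSym_ofReal_mul_jb {f : Space d → ℝ} (hf : Measurable f) {C s : ℝ}
    (h : ∀ ξ, |f ξ| ≤ C * jb (-s) ξ) : BddSym (fun ξ => ((f ξ * jb s ξ : ℝ) : ℂ)) := by
  refine BddSym.of_le (by have := measurable_jb (d := d) s; fun_prop) C fun ξ => ?_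
  rw [Complex.norm_real, Real.norm_eq_abs, abs_mul, abs_of_nonneg (jb_nonneg s ξ)]
  refine (mul_le_mul_of_nonneg_right (h ξ) (jb_nonneg s ξ)).trans ?_
  rw [mul_assoc, jb_neg, inv_mul_cancel₀ (jb_ne s ξ), mul_one]

lemma bddSym_linSym (α : ℝ) (i j : Fin 3) : BddSym (linSym (d := d) α i j) := by
  have h : BddSym (fun ξ : Space d => ((((α - 1) * kap i ξ * kap j ξ -
      if i = j then α * wn ξ ^ 2 else 0) * jb (-4) ξ : ℝ) : ℂ)) := by
    refine bddSym_ofReal_mul_jb (C := (|α - 1| + |α|) * (2 * Real.pi) ^ 2) ?_ fun ξ => ?_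
    · have := measurable_kap (d := d) i
      have := measurable_kap (d := d) j
      have := measurable_wn (d := d)
      split_ifs <;> fun_prop
    · have h1 : wn ξ ^ 2 ≤ (2 * Real.pi) ^ 2 * jb 4 ξ := (wn_sq_le ξ).trans
        (mul_le_mul_of_nonneg_left (jb_mono (by norm_num) ξ) (by positivity))
      have h2 : |(α - 1) * kap i ξ * kap j ξ| ≤ |α - 1| * wn ξ ^ 2 := by
        rw [abs_mul, abs_mul, mul_assoc, sq]
        exact mul_le_mul_of_nonneg_left (mul_le_mul (abs_kap_le i ξ) (abs_kap_le j ξ)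
          (abs_nonneg _) (wn_nonneg ξ)) (abs_nonneg _)
      have h3 : |if i = j then α * wn ξ ^ 2 else 0| ≤ |α| * wn ξ ^ 2 := by
        split_ifs
        · rw [abs_mul, abs_of_nonneg (sq_nonneg (wn ξ))]
        · rw [abs_zero]; positivity
      rw [neg_neg]
      calc _ ≤ (|α - 1| + |α|) * wn ξ ^ 2 := by
            rw [add_mul]; exact (abs_sub _ _).trans (add_le_add h2 h3)
        _ ≤ _ := by
            rw [mul_assoc (|α - 1| + |α|)]
            exact mul_le_mul_of_nonneg_left h1 (by positivity)
  convert h using 2 with ξ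
  rw [linSym, Complex.ofReal_mul]

lemma bddSym_resSym {ε : ℝ} (hε : ε ∈ Ioo (0 : ℝ) 1) : BddSym (resSym (d := d) ε) := by
  refine (bddSym_const Complex.I).mul (bddSym_ofReal_mul_jb
    (f := fun ξ => (regSym ε ξ)⁻¹) (measurable_regSym ε).inv (C := (2 / ε) ^ 2) fun ξ => ?_)
  have := regSym_pos ε ξ
  rw [abs_of_pos (by positivity), jb_neg, ← div_eq_mul_inv, le_div_iff₀ (jb_pos 4 ξ),
    inv_mul_le_iff₀ this, mul_comm (regSym ε ξ)]
  exact jb_four_le hε ξ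

lemma bddSym_massSym (ε : ℝ) {σ : ℝ} (hσ : 2 ≤ σ) : BddSym (massSym (d := d) ε σ) := by
  refine bddSym_ofReal_mul_jb (measurable_regSym ε).sqrt
    (C := 1 + |ε| * (2 * Real.pi) ^ 2) fun ξ => ?_
  rw [abs_of_nonneg (Real.sqrt_nonneg _), neg_neg]
  exact (sqrt_regSym_le ε ξ).trans (mul_le_mul_of_nonneg_left (jb_mono hσ ξ) (by positivity))

lemma bddSym_waveSym : BddSym (waveSym (d := d)) := by
  refine bddSym_ofReal_mul_jb measurable_wn (C := 2 * Real.pi) fun ξ => ?_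
  rw [abs_of_nonneg (wn_nonneg ξ), neg_neg]
  exact wn_le ξ

lemma bddSym_magSym : BddSym (magSym (d := d)) := by
  have hw := measurable_wn (d := d)
  refine (bddSym_const Complex.I).mul (bddSym_ofReal_mul_jb (by fun_prop)
    (C := (2 * Real.pi) ^ 2) fun ξ => ?_)
  have h0 := wn_nonneg ξ
  rw [abs_of_nonneg (by positivity), neg_neg]
  refine le_trans ?_ (wn_sq_le ξ)
  rw [div_le_iff₀ (by positivity), pow_succ]
  refine mul_le_mul_of_nonneg_left (Real.le_sqrt_of_sq_le (by linarith)) (by positivity)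

/-! ### Dispersion relations -/

/-- `θ` is an even frequency of order `κ` which is elliptic for `|ξ| ≥ 1` and at least `|ξ|` near
the origin. -/
structure Dispersion (θ : Space d → ℝ) (κ : ℝ) : Prop where
  meas : Measurable θ
  order_nonneg : 0 ≤ κ
  even : ∀ ξ, θ (-ξ) = θ ξ
  upper : ∃ C, ∀ ξ, |θ ξ| ≤ C * jb κ ξ
  low : ∀ ξ, ‖ξ‖ ≤ θ ξ
  high : ∃ C, ∀ ξ, 1 ≤ ‖ξ‖ → jb κ ξ ≤ C * θ ξ

lemma jb_one_le_of_one_le {ξ : Space d} (h : 1 ≤ ‖ξ‖) : jb 1 ξ ≤ 2 * ‖ξ‖ := by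
  refine le_of_sq_le_sq ?_ (by positivity)
  rw [jb_one_sq]
  nlinarith

lemma dispersion_wn : Dispersion (wn (d := d)) 1 where
  meas := measurable_wn
  order_nonneg := zero_le_one
  even := wn_neg
  upper := ⟨2 * Real.pi, fun ξ => by rw [abs_of_nonneg (wn_nonneg ξ)]; exact wn_le ξ⟩
  low := norm_le_wn
  high := ⟨2, fun ξ h => (jb_one_le_of_one_le h).trans (by linarith [norm_le_wn ξ])⟩

lemma magFreq_nonneg (ξ : Space d) : 0 ≤ magFreq ξ := mul_nonneg (wn_nonneg ξ) (Real.sqrt_nonneg _)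

lemma magFreq_sq (ξ : Space d) : magFreq ξ ^ 2 = wn ξ ^ 2 + wn ξ ^ 4 := by
  rw [magFreq, mul_pow, Real.sq_sqrt (by positivity)]; ring

lemma dispersion_magFreq : Dispersion (magFreq (d := d)) 2 where
  meas := by have := measurable_wn (d := d); unfold magFreq; fun_prop
  order_nonneg := zero_le_two
  even := fun ξ => by simp only [magFreq, wn_neg]
  upper := by
    refine ⟨2 * (2 * Real.pi) ^ 2, fun ξ => ?_⟩
    have h1 := wn_sq_le ξ
    have h2 := one_le_jb (zero_le_two : (0 : ℝ) ≤ 2) ξ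
    have h3 := mul_le_mul (pow_le_pow_left₀ zero_le_one two_pi_ge 2) h2 zero_le_one
      (by positivity)
    rw [abs_of_nonneg (magFreq_nonneg ξ)]
    refine le_of_sq_le_sq ?_ (by linarith)
    rw [magFreq_sq]
    nlinarith [sq_nonneg (wn ξ)]
  low := fun ξ => (norm_le_wn ξ).trans (le_mul_of_one_le_right (wn_nonneg ξ)
    (Real.one_le_sqrt.2 (by nlinarith [sq_nonneg (wn ξ)])))
  high := by
    refine ⟨4, fun ξ h => ?_⟩
    have h1 := norm_le_wn ξ
    have h2 : wn ξ ≤ √(1 + wn ξ ^ 2) := Real.le_sqrt_of_sq_le (by linarith)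
    have h3 := mul_le_mul_of_nonneg_left h2 (wn_nonneg ξ)
    have h4 := mul_le_mul h1 h1 (norm_nonneg ξ) (wn_nonneg ξ)
    rw [jb_two, magFreq]
    nlinarith

/-! ### The nonlinear terms -/

/-- Three components of a vector field. -/
abbrev Vec (d : ℕ) : Type := Fin 3 → L2 d

/-- The cross product formed with the bilinear operation `T`. -/
def crossOp (T : L2 d →L[ℝ] L2 d →L[ℝ] L2 d) (e b : Vec d) : Vec d :=
  fun i => T (e (i + 1)) (b (i + 2)) - T (e (i + 2)) (b (i + 1))

/-- `∇ div E - α curl curl E - n E + i E × B` at level `ρ - 3`, where `E`, `n`, `B` are given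
by `e`, `p`, `b` at the levels `ρ + 1`, `ρ`, `ρ - 1`. -/
def elecForce (α ρ : ℝ) (e : Vec d) (p : L2 d) (b : Vec d) : Vec d := fun i =>
  ∑ j, mulOp (linSym α i j) (e j) - convOp ρ (ρ + 1) (ρ - 3) p (e i)
    + mulOp (fun _ => Complex.I) (crossOp (convOp (ρ - 1) (ρ + 1) (ρ - 3)).flip e b i)

/-- The time derivative of `E` at level `ρ + 1` prescribed by the equation; the regularization
regains the four derivatives lost in `elecForce`. -/
def elec (α ε ρ : ℝ) (e : Vec d) (p : L2 d) (b : Vec d) : Vec d := fun i =>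
  mulOp (resSym ε) (elecForce α ρ e p b i)

/-- `|E|²` at level `σ`. -/
def dens (σ : ℝ) (e : Vec d) : L2 d := ∑ i, convOp σ σ σ (e i) (conjRefl (e i))

/-- `E × Ē` at level `σ`. -/
def mag (σ : ℝ) (e : Vec d) : Vec d := crossOp (convOp σ σ σ) e (fun i => conjRefl (e i))

lemma convAdm_elec (hd : d ≤ 3) {ρ : ℝ} (hρ : 5 ≤ ρ) : ConvAdm d ρ (ρ + 1) (ρ - 3) :=
  ⟨hd, by linarith, by linarith, by linarith, by linarith, by linarith⟩

lemma convAdm_cross (hd : d ≤ 3) {ρ : ℝ} (hρ : 5 ≤ ρ) : ConvAdm d (ρ - 1) (ρ + 1) (ρ - 3) :=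
  ⟨hd, by linarith, by linarith, by linarith, by linarith, by linarith⟩

lemma convAdm_self (hd : d ≤ 3) {σ : ℝ} (hσ : 2 ≤ σ) : ConvAdm d σ σ σ :=
  ⟨hd, by linarith, le_rfl, le_rfl, hσ, hσ⟩

lemma norm_crossOp_le {T : L2 d →L[ℝ] L2 d →L[ℝ] L2 d} {e b : Vec d} {C : ℝ} {A : L2 d →L[ℝ] L2 d}
    (h : ∀ i j, ‖A (T (e i) (b j))‖ ≤ C) (i : Fin 3) : ‖A (crossOp T e b i)‖ ≤ 2 * C := by
  rw [crossOp, map_sub]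
  refine (norm_sub_le _ _).trans ?_
  linarith [h (i + 1) (i + 2), h (i + 2) (i + 1)]

lemma continuousOn_elec (α ε ρ : ℝ) {s : Set ℝ} {e b : ℝ → Vec d} {p : ℝ → L2 d}
    (he : ContinuousOn e s) (hp : ContinuousOn p s) (hb : ContinuousOn b s) :
    ContinuousOn (fun t => elec α ε ρ (e t) (p t) (b t)) s := by
  unfold elec elecForce crossOp
  fun_prop

lemma continuous_dens (σ : ℝ) : Continuous (dens (d := d) σ) := by
  unfold dens; fun_prop

lemma continuous_mag (σ : ℝ) : Continuous (mag (d := d) σ) := by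
  unfold mag crossOp; fun_prop

lemma exists_norm_lin_le (α : ℝ) : ∃ K : ℝ, 0 ≤ K ∧ ∀ (i : Fin 3) (e : Vec d),
    ‖∑ j, mulOp (linSym α i j) (e j)‖ ≤ K * ‖e‖ := by
  refine ⟨∑ i : Fin 3, ∑ j, ‖mulOp (linSym (d := d) α i j)‖, by positivity, fun i e => ?_⟩
  refine (norm_sum_le _ _).trans ?_
  calc ∑ j, ‖mulOp (linSym α i j) (e j)‖ ≤ ∑ j, ‖mulOp (linSym (d := d) α i j)‖ * ‖e‖ :=
        Finset.sum_le_sum fun j _ => (ContinuousLinearMap.le_opNorm _ _).trans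
          (mul_le_mul_of_nonneg_left (norm_le_pi_norm e j) (norm_nonneg _))
    _ = (∑ j, ‖mulOp (linSym (d := d) α i j)‖) * ‖e‖ := (Finset.sum_mul _ _ _).symm
    _ ≤ _ := mul_le_mul_of_nonneg_right (Finset.single_le_sum
        (f := fun i : Fin 3 => ∑ j, ‖mulOp (linSym (d := d) α i j)‖)
        (fun i _ => by positivity) (Finset.mem_univ i)) (norm_nonneg _)

/-- The tame estimate: the top order norms enter linearly, with a coefficient that only involves
the `H²` norm of `E` and the `L²` norms of `n` and `B`. -/
lemma norm_elec_le (hd : d ≤ 3) (α : ℝ) {ε ρ : ℝ} (hε : ε ∈ Ioo (0 : ℝ) 1) (hρ : 5 ≤ ρ) :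
    ∃ C : ℝ, 0 ≤ C ∧ ∀ (e : Vec d) (p : L2 d) (b : Vec d) (m l : ℝ),
      (∀ i, ‖jop (2 - (ρ + 1)) (e i)‖ ≤ m) → ‖jop (-ρ) p‖ ≤ l →
      (∀ i, ‖jop (-(ρ - 1)) (b i)‖ ≤ l) → ∀ i,
      ‖elec α ε ρ e p b i‖ ≤ C * (1 + m + l) * (‖e‖ + ‖p‖ + ‖b‖) := by
  obtain ⟨Cr, hCr⟩ := (bddSym_resSym (d := d) hε).2
  have hr : ∀ f : L2 d, ‖mulOp (resSym ε) f‖ ≤ Cr * ‖f‖ := norm_mulOp_le (bddSym_resSym hε) hCr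
  have hCr0 : 0 ≤ Cr := (norm_nonneg _).trans (hCr 0)
  obtain ⟨K, hK, h1⟩ := exists_norm_lin_le (d := d) α
  obtain ⟨c, hc, h2'⟩ : ∃ c, 0 ≤ c ∧ convConst d (ρ - 3) = c := ⟨_, convConst_nonneg d _, rfl⟩
  refine ⟨Cr * (K + 3 * c), by positivity, fun e p b m l hm hl hl' i => ?_⟩
  have hm0 : 0 ≤ m := (norm_nonneg _).trans (hm 0)
  have hl0 : 0 ≤ l := (norm_nonneg _).trans hl
  have he := norm_nonneg e
  have hp := norm_nonneg p
  have hb := norm_nonneg b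
  have hei := norm_le_pi_norm e
  have hbi := norm_le_pi_norm b
  have h2 : ‖convOp ρ (ρ + 1) (ρ - 3) p (e i)‖ ≤ c * (‖p‖ * m + l * ‖e‖) := by
    rw [← h2']
    refine (norm_convOp_le' (convAdm_elec hd hρ) (by linarith) p (e i)).trans
      (mul_le_mul_of_nonneg_left (add_le_add ?_ ?_) (convConst_nonneg d _))
    · exact mul_le_mul_of_nonneg_left (hm i) hp
    · exact mul_le_mul hl (hei i) (norm_nonneg _) hl0
  have h3' : ∀ i j, ‖(convOp (ρ - 1) (ρ + 1) (ρ - 3)).flip (e i) (b j)‖ ≤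
      c * (‖b‖ * m + l * ‖e‖) := by
    intro i j
    rw [ContinuousLinearMap.flip_apply, ← h2']
    refine (norm_convOp_le' (convAdm_cross hd hρ) (by linarith) (b j) (e i)).trans
      (mul_le_mul_of_nonneg_left (add_le_add ?_ ?_) (convConst_nonneg d _))
    · exact mul_le_mul (hbi j) (hm i) (norm_nonneg _) hb
    · exact mul_le_mul (hl' j) (hei i) (norm_nonneg _) hl0
  have h3 : ‖crossOp (convOp (ρ - 1) (ρ + 1) (ρ - 3)).flip e b i‖ ≤
      2 * (c * (‖b‖ * m + l * ‖e‖)) := by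
    refine (norm_sub_le _ _).trans ?_
    linarith [h3' (i + 1) (i + 2), h3' (i + 2) (i + 1)]
  have h4 : ‖elecForce α ρ e p b i‖ ≤
      K * ‖e‖ + c * (‖p‖ * m + l * ‖e‖) + 2 * (c * (‖b‖ * m + l * ‖e‖)) := by
    refine (norm_add_le _ _).trans (add_le_add ((norm_sub_le _ _).trans (add_le_add (h1 i e) h2)) ?_)
    rw [mulOp_const, norm_smul, Complex.norm_I, one_mul]
    exact h3
  refine (hr _).trans ?_
  rw [mul_assoc Cr, mul_assoc Cr]
  refine mul_le_mul_of_nonneg_left (h4.trans ?_) hCr0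
  have h5 := mul_nonneg hm0 he
  have h6 := mul_nonneg hl0 he
  have h7 := mul_nonneg hm0 hp
  have h8 := mul_nonneg hl0 hp
  have h9 := mul_nonneg hm0 hb
  have h10 := mul_nonneg hl0 hb
  have e1 : K * ‖e‖ ≤ K * ((1 + m + l) * (‖e‖ + ‖p‖ + ‖b‖)) :=
    mul_le_mul_of_nonneg_left (by linarith) hK
  have e2 : c * (‖p‖ * m + l * ‖e‖) ≤ c * ((1 + m + l) * (‖e‖ + ‖p‖ + ‖b‖)) :=
    mul_le_mul_of_nonneg_left (by linarith) hc
  have e3 : c * (‖b‖ * m + l * ‖e‖) ≤ c * ((1 + m + l) * (‖e‖ + ‖p‖ + ‖b‖)) :=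
    mul_le_mul_of_nonneg_left (by linarith) hc
  linarith

lemma jop_conjRefl {s : ℝ} (hs : s ≤ 0) (f : L2 d) :
    jop s (conjRefl f) = conjRefl (jop s f) :=
  (conjRefl_mulOp (bddSym_jb hs) (bddSym_jb hs) (fun ξ => by
    rw [jb_neg_arg, RCLike.star_def, Complex.conj_ofReal]) f).symm

/-- The quadratic terms, at a level `τ` between `2` and `σ`, are bounded by the `H²` norm
of `E` times the norm of `E` at level `τ`. -/
lemma norm_jop_quad_le (hd : d ≤ 3) {σ τ m : ℝ} (hτ : 2 ≤ τ) (hτσ : τ ≤ σ) {e : Vec d}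
    (hm : ∀ i, ‖jop (2 - σ) (e i)‖ ≤ m) {M : ℝ} (hM : ∀ i, ‖jop (τ - σ) (e i)‖ ≤ M) :
    ‖jop (τ - σ) (dens σ e)‖ ≤ 6 * convConst d τ * (m * M) ∧
      ∀ i, ‖jop (τ - σ) (mag σ e i)‖ ≤ 4 * convConst d τ * (m * M) := by
  have hm0 : 0 ≤ m := (norm_nonneg _).trans (hm 0)
  have hM0 : 0 ≤ M := (norm_nonneg _).trans (hM 0)
  have h : ∀ i j, ‖jop (τ - σ) (convOp σ σ σ (e i) (conjRefl (e j)))‖ ≤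
      2 * convConst d τ * (m * M) := by
    intro i j
    refine (norm_jop_convOp_le (convAdm_self hd (hτ.trans hτσ)) (by linarith) hτσ _ _).trans ?_
    rw [jop_conjRefl (by linarith), jop_conjRefl (by linarith), norm_conjRefl, norm_conjRefl,
      mul_comm 2, mul_assoc]
    refine mul_le_mul_of_nonneg_left ?_ (convConst_nonneg d τ)
    have h1 := mul_le_mul (hM i) (hm j) (norm_nonneg _) hM0
    have h2 := mul_le_mul (hm i) (hM j) (norm_nonneg _) hm0
    linarith
  constructor
  · rw [dens, map_sum]
    refine (norm_sum_le _ _).trans ?_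
    rw [Fin.sum_univ_three]
    linarith [h 0 0, h 1 1, h 2 2]
  · intro i
    have := norm_crossOp_le (A := jop (τ - σ)) (T := convOp σ σ σ) (e := e)
      (b := fun i => conjRefl (e i)) h i
    rw [mag]
    linarith

/-! ### The evolution equation in the interaction picture -/

/-- The state space: the first component stands for `E`, the other two for `n + i |∇|⁻¹ ∂ₜ n` and
`B + i ω⁻¹ ∂ₜ B`, from which the free oscillations have been removed. -/
abbrev State (d : ℕ) : Type := Vec d × L2 d × Vec d

/-- The contribution `-i G` of a force `G`, transported back to time `0`. -/
def oscForce (θ : Space d → ℝ) (t : ℝ) (G : L2 d) : L2 d :=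
  osc θ (-t) (mulOp (fun _ => -Complex.I) G)

/-- The right-hand side of the evolution equation of states. -/
def stateField (α ε ρ t : ℝ) (w : State d) : State d :=
  (elec α ε ρ w.1 (symPart (osc wn t w.2.1)) (fun i => symPart (osc magFreq t (w.2.2 i))),
    oscForce wn t (mulOp waveSym (dens (ρ + 1) w.1)),
    fun i => oscForce magFreq t (mulOp magSym (mag (ρ + 1) w.1 i)))

lemma norm_oscForce {θ : Space d → ℝ} (hθ : Measurable θ) (t : ℝ) (G : L2 d) :
    ‖oscForce θ t G‖ = ‖G‖ := by
  rw [oscForce, norm_osc hθ, mulOp_const, norm_smul, norm_neg, Complex.norm_I, one_mul]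

lemma measurable_magFreq : Measurable (magFreq (d := d)) := dispersion_magFreq.meas

lemma BddLip.crossOp {X : Type*} [NormedAddCommGroup X] [NormedSpace ℝ X]
    {F G : ℝ → X → Vec d} (hF : ∀ i, BddLip (fun t w => F t w i))
    (hG : ∀ i, BddLip (fun t w => G t w i)) (T : L2 d →L[ℝ] L2 d →L[ℝ] L2 d) (i : Fin 3) :
    BddLip (fun t w => crossOp T (F t w) (G t w) i) :=
  ((hF _).bilin (hG _) T).sub ((hF _).bilin (hG _) T)

lemma bddLip_stateField (α ε ρ : ℝ) : BddLip (stateField (d := d) α ε ρ) := by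
  have hE : ∀ i, BddLip (fun (_ : ℝ) (w : State d) => w.1 i) := fun i =>
    BddLip.clm ((ContinuousLinearMap.proj (R := ℝ) i).comp
      (ContinuousLinearMap.fst ℝ (Vec d) (L2 d × Vec d)))
  have hZ : BddLip (fun (_ : ℝ) (w : State d) => w.2.1) :=
    BddLip.clm ((ContinuousLinearMap.fst ℝ (L2 d) (Vec d)).comp
      (ContinuousLinearMap.snd ℝ (Vec d) (L2 d × Vec d)))
  have hY : ∀ i, BddLip (fun (_ : ℝ) (w : State d) => w.2.2 i) := fun i =>
    BddLip.clm ((ContinuousLinearMap.proj (R := ℝ) i).comp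
      ((ContinuousLinearMap.snd ℝ (L2 d) (Vec d)).comp
        (ContinuousLinearMap.snd ℝ (Vec d) (L2 d × Vec d))))
  have hp : BddLip (fun t (w : State d) => symPart (osc wn t w.2.1)) :=
    (hZ.clm_family (fun t => osc wn t) zero_le_one
      (fun t y => by rw [norm_osc measurable_wn, one_mul])).clm_comp symPart
  have hb : ∀ i, BddLip (fun t (w : State d) => symPart (osc magFreq t (w.2.2 i))) := fun i =>
    ((hY i).clm_family (fun t => osc magFreq t) zero_le_one
      (fun t y => by rw [norm_osc measurable_magFreq, one_mul])).clm_comp symPart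
  have hc : ∀ i, BddLip (fun (_ : ℝ) (w : State d) => conjRefl (w.1 i)) := fun i =>
    (hE i).clm_comp conjRefl
  have hF : ∀ {θ : Space d → ℝ}, Measurable θ → ∀ {G : ℝ → State d → L2 d}, BddLip G →
      BddLip (fun t w => oscForce θ t (G t w)) := fun {θ} hθ G hG =>
    (hG.clm_comp (mulOp fun _ => -Complex.I)).clm_family (fun t => osc θ (-t)) zero_le_one
      (fun t y => by rw [norm_osc hθ, one_mul])
  refine BddLip.prodMk (BddLip.pi fun i => BddLip.clm_comp (BddLip.add (BddLip.sub ?_ ?_) ?_) _)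
    (BddLip.prodMk (hF measurable_wn (BddLip.clm_comp ?_ _))
      (BddLip.pi fun i => hF measurable_magFreq (BddLip.clm_comp ?_ _)))
  · exact BddLip.sum _ fun j => (hE j).clm_comp _
  · exact hp.bilin (hE i) _
  · exact (BddLip.crossOp hE hb _ i).clm_comp _
  · exact BddLip.sum _ fun j => (hE j).bilin (hc j) _
  · exact BddLip.crossOp hE hc _ i

lemma continuousOn_oscForce {θ : Space d → ℝ} (hθ : Measurable θ) {G : ℝ → L2 d} {s : Set ℝ}
    (hG : ContinuousOn G s) : ContinuousOn (fun t => oscForce θ t (G t)) s :=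
  continuousOn_osc_apply hθ continuous_neg ((ContinuousLinearMap.continuous _).comp_continuousOn hG)

lemma continuous_stateField (α ε ρ : ℝ) (w : State d) :
    Continuous fun t => stateField α ε ρ t w := by
  rw [← continuousOn_univ]
  refine ContinuousOn.prodMk (continuousOn_elec α ε ρ continuousOn_const ?_ ?_)
    (ContinuousOn.prodMk (continuousOn_oscForce measurable_wn continuousOn_const)
      (continuousOn_pi.2 fun i => continuousOn_oscForce measurable_magFreq continuousOn_const))
  · exact (symPart.continuous.comp (continuous_osc measurable_wn _)).continuousOn
  · exact continuousOn_pi.2 fun i =>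
      (symPart.continuous.comp (continuous_osc measurable_magFreq _)).continuousOn

/-! ### Conservation of mass -/

lemma mulOp_neg_sym {m : Space d → ℂ} (h : BddSym m) (f : L2 d) :
    mulOp (fun ξ => -m ξ) f = -mulOp m f := by
  rw [← mulOp_mulOp_eq (bddSym_const (-1)) h (fun ξ => neg_one_mul (m ξ)), mulOp_const,
    neg_one_smul]

lemma inner_mulOp {m₁ m₂ m₁' m₂' : Space d → ℂ} (h₁ : BddSym m₁) (h₂ : BddSym m₂)
    (h₁' : BddSym m₁') (h₂' : BddSym m₂')
    (hm : ∀ ξ, star (m₁ ξ) * m₂ ξ = star (m₁' ξ) * m₂' ξ) (f g : L2 d) :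
    inner ℝ (mulOp m₁ f) (mulOp m₂ g) = inner ℝ (mulOp m₁' f) (mulOp m₂' g) := by
  rw [L2.inner_def, L2.inner_def]
  refine integral_congr_ae ?_
  filter_upwards [mulOp_ae h₁ f, mulOp_ae h₂ g, mulOp_ae h₁' f, mulOp_ae h₂' g]
    with ξ e1 e2 e3 e4
  rw [e1, e2, e3, e4, Complex.inner, Complex.inner, map_mul, map_mul]
  have hm' := hm ξ
  simp only [RCLike.star_def] at hm'
  congr 1
  linear_combination (starRingEnd ℂ (f ξ) * g ξ) * hm'

lemma integrable_star_mul {f g : Space d → ℂ} (hf : MemLp f 2 volume) (hg : MemLp g 2 volume) :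
    Integrable (fun x => star (f x) * g x) volume :=
  (MemLp.star hf).integrable_mul hg

/-- Plancherel for two functions given at different levels. -/
lemma inner_jop (hd : d ≤ 3) {σ τ : ℝ} (hσ : 2 ≤ σ) (hτ : 2 ≤ τ) (f g : L2 d) :
    inner ℝ (jop (-σ) f) (jop (-τ) g) = ∫ x, (star (phys σ f x) * phys τ g x).re := by
  have h1 : inner ℝ (jop (-σ) f) (jop (-τ) g) = ∫ ξ, (star (rep σ f ξ) * rep τ g ξ).re := by
    rw [L2.inner_def]
    refine integral_congr_ae ?_
    filter_upwards [mulOp_ae (bddSym_jb (by linarith : -σ ≤ 0)) f,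
      mulOp_ae (bddSym_jb (by linarith : -τ ≤ 0)) g] with ξ e1 e2
    rw [e1, e2, Complex.inner, mul_comm]
    rfl
  rw [h1]
  have h2 := integral_re (integrable_star_mul (memLp_rep (by linarith : 0 ≤ σ) f)
    (memLp_rep (by linarith : 0 ≤ τ) g))
  have h3 := integral_re (integrable_star_mul (memLp_phys hd hσ f) (memLp_phys hd hτ g))
  rw [integral_rep_mul hd hσ hτ] at h2
  exact h2.trans h3.symm

lemma phys_crossOp (hd : d ≤ 3) {σ : ℝ} (hσ : 2 ≤ σ) {T : L2 d →L[ℝ] L2 d →L[ℝ] L2 d}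
    {e b : Vec d} {x : Space d} {E B : Fin 3 → ℂ}
    (h : ∀ i j, phys σ (T (e i) (b j)) x = E i * B j) (i : Fin 3) :
    phys σ (crossOp T e b i) x = (E ⨯₃ B) i := by
  rw [crossOp, phys_sub hd hσ, h, h, cross_apply]
  fin_cases i <;> simp

/-- The real vector field `B` given by the real parts of `y`. -/
def rePhys (σ : ℝ) (y : Vec d) (x : Space d) : Fin 3 → ℝ := fun i => (phys σ (y i) x).re

lemma phys_cross_symPart (hd : d ≤ 3) {ρ : ℝ} (hρ : 5 ≤ ρ) (e y : Vec d) (x : Space d)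
    (i : Fin 3) :
    phys (ρ - 3) (crossOp (convOp (ρ - 1) (ρ + 1) (ρ - 3)).flip e (fun j => symPart (y j)) i) x =
      ((fun j => phys (ρ + 1) (e j) x) ⨯₃ complexify (rePhys (ρ - 1) y) x) i := by
  refine phys_crossOp hd (by linarith) (fun i j => ?_) i
  rw [ContinuousLinearMap.flip_apply, phys_mul (convAdm_cross hd hρ),
    phys_symPart hd (by linarith), mul_comm]
  rfl

/-- The potential and the magnetic term do no work. -/
lemma re_force_eq_zero (E : Fin 3 → ℂ) (n : ℝ) (B : Fin 3 → ℝ) :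
    ∑ i, (star (E i) * (Complex.I * (-((n : ℂ) * E i)
      + Complex.I * (E ⨯₃ fun j => (B j : ℂ)) i))).re = 0 := by
  rw [Fin.sum_univ_three]
  simp only [cross_apply, Matrix.cons_val_zero, Matrix.cons_val_one, Matrix.cons_val,
    Complex.mul_re, Complex.mul_im, Complex.add_re, Complex.add_im, Complex.neg_re, Complex.neg_im,
    Complex.sub_re, Complex.sub_im, Complex.I_re, Complex.I_im, Complex.ofReal_re,
    Complex.ofReal_im, RCLike.star_def, Complex.conj_re, Complex.conj_im]
  ring

/-- The quantity `∑ᵢ ∫ (|Eᵢ|² + ε² |ΔEᵢ|²)` is conserved by the equation for `E`. -/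
lemma inner_elec_eq_zero (hd : d ≤ 3) (α : ℝ) {ε ρ : ℝ} (hε : ε ∈ Ioo (0 : ℝ) 1) (hρ : 5 ≤ ρ)
    (e : Vec d) (z : L2 d) (y : Vec d) :
    ∑ i, inner ℝ (mulOp (massSym ε (ρ + 1)) (e i)) (mulOp (massSym ε (ρ + 1))
      (elec α ε ρ e (symPart z) (fun j => symPart (y j)) i)) = 0 := by
  have hS := bddSym_massSym (d := d) ε (by linarith : 2 ≤ ρ + 1)
  have hR := bddSym_resSym (d := d) hε
  have h1 : BddSym (fun ξ : Space d => (jb (-(ρ + 1)) ξ : ℂ)) := bddSym_jb (by linarith)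
  have h3 : BddSym (fun ξ : Space d => (jb (-(ρ - 3)) ξ : ℂ)) := bddSym_jb (by linarith)
  have hI3 := (bddSym_const (d := d) Complex.I).mul h3
  -- the weights cancel against the resolvent
  have hcancel : ∀ i (f : L2 d), inner ℝ (mulOp (massSym ε (ρ + 1)) (e i))
      (mulOp (massSym ε (ρ + 1)) (mulOp (resSym ε) f)) =
      inner ℝ (jop (-(ρ + 1)) (e i)) (mulOp (fun ξ => Complex.I * (jb (-(ρ - 3)) ξ : ℂ)) f) := by
    intro i f
    rw [mulOp_mulOp hS hR]
    refine inner_mulOp hS (hS.mul hR) h1 hI3 (fun ξ => ?_) _ _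
    have ha := regSym_pos ε ξ
    have e1 : (√(regSym ε ξ) : ℂ) * √(regSym ε ξ) = regSym ε ξ := by
      rw [← Complex.ofReal_mul, Real.mul_self_sqrt ha.le]
    have e2 : (regSym ε ξ : ℂ) * (regSym ε ξ : ℂ)⁻¹ = 1 :=
      mul_inv_cancel₀ (Complex.ofReal_ne_zero.2 ha.ne')
    have e3 : jb (-(ρ - 3)) ξ = jb 4 ξ * jb (-(ρ + 1)) ξ := by rw [← jb_add]; congr 1; ring
    rw [massSym, resSym, RCLike.star_def, Complex.conj_ofReal,
      Complex.conj_ofReal, e3]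
    push_cast
    linear_combination (Complex.I * jb (-(ρ + 1)) ξ ^ 2 * jb 4 ξ * (regSym ε ξ : ℂ)⁻¹) * e1
      + (Complex.I * jb (-(ρ + 1)) ξ ^ 2 * jb 4 ξ) * e2
  simp only [elec, hcancel]
  -- the linear part is skew-symmetric
  let A : Fin 3 → Fin 3 → ℝ := fun i j => inner ℝ (jop (-(ρ + 1)) (e i))
    (mulOp (fun ξ => Complex.I * (jb (-(ρ - 3)) ξ : ℂ)) (mulOp (linSym α i j) (e j)))
  have hA : ∀ i j, A i j = -A j i := by
    intro i j
    have hL := hI3.mul (bddSym_linSym (d := d) α i j)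
    have hL' := hI3.mul (bddSym_linSym (d := d) α j i)
    simp only [A]
    rw [mulOp_mulOp hI3 (bddSym_linSym α i j), mulOp_mulOp hI3 (bddSym_linSym α j i),
      ← inner_neg_right, ← mulOp_neg_sym hL', real_inner_comm _ (jop (-(ρ + 1)) (e j))]
    refine inner_mulOp h1 hL ?_ h1 (fun ξ => ?_) _ _
    · simpa using (bddSym_const (d := d) (-1)).mul hL'
    · have hsymm : linSym α j i ξ = linSym α i j ξ := by
        simp only [linSym, eq_comm (a := j), mul_assoc, mul_comm (kap j ξ)]
      have hreal : (starRingEnd ℂ) (linSym α i j ξ) = linSym α i j ξ := by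
        rw [linSym, map_mul, Complex.conj_ofReal, Complex.conj_ofReal]
      rw [hsymm, RCLike.star_def]
      simp only [map_neg, map_mul, Complex.conj_ofReal, Complex.conj_I, hreal]
      ring
  have hAsum : ∑ i, ∑ j, A i j = 0 := by
    have : ∑ i, ∑ j, A i j = -∑ i, ∑ j, A i j := by
      conv_lhs => rw [Finset.sum_comm]
      simp only [← Finset.sum_neg_distrib]
      exact Finset.sum_congr rfl fun i _ => Finset.sum_congr rfl fun j _ => hA j i
    linarith
  -- the remaining part vanishes pointwise in physical space
  let g : Vec d := fun i => -convOp ρ (ρ + 1) (ρ - 3) (symPart z) (e i)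
    + mulOp (fun _ => Complex.I)
      (crossOp (convOp (ρ - 1) (ρ + 1) (ρ - 3)).flip e (fun j => symPart (y j)) i)
  have hsplit : ∀ i, elecForce α ρ e (symPart z) (fun j => symPart (y j)) i =
      ∑ j, mulOp (linSym α i j) (e j) + g i := by
    intro i; simp only [elecForce, g, sub_eq_add_neg, add_assoc]
  have hg : ∀ i, mulOp (fun ξ => Complex.I * (jb (-(ρ - 3)) ξ : ℂ)) (g i) =
      jop (-(ρ - 3)) (Complex.I • g i) := fun i => by
    rw [← mulOp_const, mulOp_mulOp h3 (bddSym_const _)]; simp only [mul_comm]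
  have hgx : ∀ i x, phys (ρ - 3) (Complex.I • g i) x = Complex.I *
      (-(((phys ρ z x).re : ℂ) * phys (ρ + 1) (e i) x) + Complex.I *
        ((fun j => phys (ρ + 1) (e j) x) ⨯₃ complexify (rePhys (ρ - 1) y) x) i) := by
    intro i x
    rw [phys_smul, phys_add hd (by linarith), phys_neg, mulOp_const, phys_smul,
      phys_cross_symPart hd hρ, phys_mul (convAdm_elec hd hρ), phys_symPart hd (by linarith)]
  have hsum : ∑ i, inner ℝ (jop (-(ρ + 1)) (e i)) (jop (-(ρ - 3)) (Complex.I • g i)) = 0 := by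
    simp only [fun i => inner_jop hd (by linarith : 2 ≤ ρ + 1) (by linarith : 2 ≤ ρ - 3) (e i)
      (Complex.I • g i)]
    refine (integral_finsetSum _ fun i _ => (integrable_star_mul
      (memLp_phys hd (by linarith : 2 ≤ ρ + 1) (e i))
      (memLp_phys hd (by linarith : 2 ≤ ρ - 3) (Complex.I • g i))).re).symm.trans ?_
    rw [← integral_zero (Space d) ℝ]
    congr 1
    funext x
    simp only [hgx]
    exact re_force_eq_zero _ _ _
  simp only [hsplit, map_add, inner_add_right, map_sum, inner_sum, Finset.sum_add_distrib, hg,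
    hsum, add_zero]
  exact hAsum

/-! ### The global flow -/

lemma hasDerivWithinAt_clm {X Y : Type*} [NormedAddCommGroup X] [NormedSpace ℝ X]
    [NormedAddCommGroup Y] [NormedSpace ℝ Y] (A : X →L[ℝ] Y) {f : ℝ → X} {f' : X} {s : Set ℝ}
    {t : ℝ} (h : HasDerivWithinAt f f' s t) :
    HasDerivWithinAt (fun τ => A (f τ)) (A f') s t :=
  A.hasFDerivAt.comp_hasDerivWithinAt t h

/-- The electric component of a state. -/
def stateE (i : Fin 3) : State d →L[ℝ] L2 d :=
  (ContinuousLinearMap.proj (R := ℝ) i).comp (ContinuousLinearMap.fst ℝ (Vec d) (L2 d × Vec d))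

/-- The density component of a state. -/
def stateZ : State d →L[ℝ] L2 d :=
  (ContinuousLinearMap.fst ℝ (L2 d) (Vec d)).comp
    (ContinuousLinearMap.snd ℝ (Vec d) (L2 d × Vec d))

/-- The magnetic component of a state. -/
def stateY (i : Fin 3) : State d →L[ℝ] L2 d :=
  (ContinuousLinearMap.proj (R := ℝ) i).comp ((ContinuousLinearMap.snd ℝ (L2 d) (Vec d)).comp
    (ContinuousLinearMap.snd ℝ (Vec d) (L2 d × Vec d)))

lemma jop_osc {θ : Space d → ℝ} (hθ : Measurable θ) {s : ℝ} (hs : s ≤ 0) (t : ℝ) (f : L2 d) :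
    jop s (osc θ t f) = osc θ t (jop s f) := (osc_mulOp hθ t (bddSym_jb hs) f).symm

lemma jop_symPart {s : ℝ} (hs : s ≤ 0) (f : L2 d) : jop s (symPart f) = symPart (jop s f) := by
  rw [symPart_apply, symPart_apply, map_smul, map_add, jop_conjRefl hs]

lemma norm_jop_symPart_osc_le {θ : Space d → ℝ} (hθ : Measurable θ) {s : ℝ} (hs : s ≤ 0) (t : ℝ)
    (f : L2 d) : ‖jop s (symPart (osc θ t f))‖ ≤ ‖jop s f‖ := by
  rw [jop_symPart hs, jop_osc hθ hs]
  exact (norm_symPart_le _).trans (norm_osc hθ t _).le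

lemma norm_jop_oscForce_le {θ : Space d → ℝ} (hθ : Measurable θ) {s : ℝ} (hs : s ≤ 0)
    {m : Space d → ℂ} (hm : BddSym m) {C : ℝ} (hC : ∀ ξ, ‖m ξ‖ ≤ C) (t : ℝ) (f : L2 d) :
    ‖jop s (oscForce θ t (mulOp m f))‖ ≤ C * ‖jop s f‖ := by
  rw [oscForce, jop_osc hθ hs, norm_osc hθ, mulOp_comm (bddSym_jb hs) (bddSym_const _),
    mulOp_const, norm_smul, norm_neg, Complex.norm_I, one_mul, mulOp_comm (bddSym_jb hs) hm]
  exact norm_mulOp_le hm hC _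

/-- The vector field of the evolution is linearly bounded as long as the `H²` norm of `E` and the
`L²` norms of the wave components remain bounded. -/
lemma norm_stateField_le (hd : d ≤ 3) (α : ℝ) {ε ρ : ℝ} (hε : ε ∈ Ioo (0 : ℝ) 1) (hρ : 5 ≤ ρ)
    {m l : ℝ} (hm0 : 0 ≤ m) (hl0 : 0 ≤ l) :
    ∃ K : ℝ, 0 ≤ K ∧ ∀ (t : ℝ) (w : State d), (∀ i, ‖jop (2 - (ρ + 1)) (w.1 i)‖ ≤ m) →
      ‖jop (-ρ) w.2.1‖ ≤ l → (∀ i, ‖jop (-(ρ - 1)) (w.2.2 i)‖ ≤ l) →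
      ‖stateField α ε ρ t w‖ ≤ K * ‖w‖ := by
  obtain ⟨C, hC, h⟩ := norm_elec_le hd α hε hρ
  obtain ⟨Cw, hCw⟩ := (bddSym_waveSym (d := d)).2
  obtain ⟨Cm, hCm⟩ := (bddSym_magSym (d := d)).2
  have hCw0 : 0 ≤ Cw := (norm_nonneg _).trans (hCw 0)
  have hCm0 : 0 ≤ Cm := (norm_nonneg _).trans (hCm 0)
  obtain ⟨c, hc⟩ : ∃ c, convConst d (ρ + 1) = c := ⟨_, rfl⟩
  have hc0 : 0 ≤ c := by rw [← hc]; exact convConst_nonneg d _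
  refine ⟨C * (1 + m + l) * 3 + Cw * (6 * c * m) + Cm * (4 * c * m), by positivity,
    fun t w hm hl hl' => ?_⟩
  have hw := norm_nonneg w
  have n1 : ‖w.1‖ ≤ ‖w‖ := norm_fst_le w
  have n2 : ‖w.2.1‖ ≤ ‖w‖ := (norm_fst_le w.2).trans (norm_snd_le w)
  have n3 : ‖w.2.2‖ ≤ ‖w‖ := (norm_snd_le w.2).trans (norm_snd_le w)
  have q := norm_jop_quad_le hd (σ := ρ + 1) (τ := ρ + 1) (by linarith) le_rfl (e := w.1) hm
    (M := ‖w‖) (fun i => by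
      rw [sub_self, jop_zero]; exact (norm_le_pi_norm w.1 i).trans n1)
  simp only [sub_self, jop_zero, hc] at q
  have p1 : 0 ≤ C * (1 + m + l) * 3 * ‖w‖ := by positivity
  have p2 : 0 ≤ Cw * (6 * c * m) * ‖w‖ := by positivity
  have p3 : 0 ≤ Cm * (4 * c * m) * ‖w‖ := by positivity
  have hE : ‖(stateField α ε ρ t w).1‖ ≤ C * (1 + m + l) * 3 * ‖w‖ := by
    refine (pi_norm_le_iff_of_nonneg p1).2 fun i => ?_
    refine (h w.1 _ _ m l hm ((norm_jop_symPart_osc_le measurable_wn (by linarith) t _).trans hl)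
      (fun j => (norm_jop_symPart_osc_le measurable_magFreq (by linarith) t _).trans (hl' j))
      i).trans ?_
    rw [mul_assoc _ 3]
    refine mul_le_mul_of_nonneg_left ?_ (by positivity)
    have e1 : ‖symPart (osc wn t w.2.1)‖ ≤ ‖w‖ :=
      (norm_symPart_le _).trans ((norm_osc measurable_wn t _).le.trans n2)
    have e2 : ‖fun i => symPart (osc magFreq t (w.2.2 i))‖ ≤ ‖w‖ :=
      (pi_norm_le_iff_of_nonneg hw).2 fun i => (norm_symPart_le _).trans
        ((norm_osc measurable_magFreq t _).le.trans ((norm_le_pi_norm w.2.2 i).trans n3))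
    linarith
  have hZ : ‖(stateField α ε ρ t w).2.1‖ ≤ Cw * (6 * c * m) * ‖w‖ := by
    refine (norm_oscForce measurable_wn t _).le.trans ?_
    refine (norm_mulOp_le bddSym_waveSym hCw _).trans ?_
    rw [mul_assoc Cw, mul_assoc (6 * c)]
    exact mul_le_mul_of_nonneg_left q.1 hCw0
  have hY : ‖(stateField α ε ρ t w).2.2‖ ≤ Cm * (4 * c * m) * ‖w‖ := by
    refine (pi_norm_le_iff_of_nonneg p3).2 fun i => ?_
    refine (norm_oscForce measurable_magFreq t _).le.trans ?_
    refine (norm_mulOp_le bddSym_magSym hCm _).trans ?_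
    rw [mul_assoc Cm, mul_assoc (4 * c)]
    exact mul_le_mul_of_nonneg_left (q.2 i) hCm0
  rw [Prod.norm_def, Prod.norm_def]
  exact max_le (by linarith) (max_le (by linarith) (by linarith))

lemma norm_jop_le_mass {ε ρ : ℝ} (hε : ε ∈ Ioo (0 : ℝ) 1) (hρ : 5 ≤ ρ) (f : L2 d) :
    ‖jop (2 - (ρ + 1)) f‖ ≤ 2 / ε * ‖mulOp (massSym ε (ρ + 1)) f‖ := by
  refine norm_mulOp_le_mulOp (bddSym_jb (by linarith)) (bddSym_massSym ε (by linarith))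
    (fun ξ => ?_) f
  rw [massSym, Complex.norm_real, Complex.norm_real, Real.norm_eq_abs, Real.norm_eq_abs,
    abs_of_pos (jb_pos _ ξ), abs_of_nonneg (mul_nonneg (Real.sqrt_nonneg _) (jb_nonneg _ ξ)),
    sub_eq_add_neg, jb_add, ← mul_assoc]
  exact mul_le_mul_of_nonneg_right (jb_two_le hε ξ) (jb_nonneg _ ξ)

/-- The a priori bound: the conserved mass controls `E` in `H²`, hence the `L²` norms of the wave
components grow at most linearly, and then the tame estimates give exponential bounds at top
order. -/
lemma state_apriori (hd : d ≤ 3) (α : ℝ) {ε ρ : ℝ} (hε : ε ∈ Ioo (0 : ℝ) 1) (hρ : 5 ≤ ρ)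
    (w₀ : State d) (T : ℝ) (hT : 0 ≤ T) :
    ∃ M : ℝ, ∀ (χ : ℝ → ℝ) (w : ℝ → State d), (∀ t, 0 ≤ χ t ∧ χ t ≤ 1) → w 0 = w₀ →
      (∀ t ∈ Icc 0 T, HasDerivWithinAt w (χ t • stateField α ε ρ t (w t)) (Icc 0 T) t) →
      ∀ t ∈ Icc 0 T, ‖w t‖ ≤ M := by
  obtain ⟨Cw, hCw⟩ := (bddSym_waveSym (d := d)).2
  obtain ⟨Cm, hCm⟩ := (bddSym_magSym (d := d)).2
  have hCw0 : 0 ≤ Cw := (norm_nonneg _).trans (hCw 0)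
  have hCm0 : 0 ≤ Cm := (norm_nonneg _).trans (hCm 0)
  obtain ⟨c, hc⟩ : ∃ c, convConst d 2 = c := ⟨_, rfl⟩
  have hc0 : 0 ≤ c := by rw [← hc]; exact convConst_nonneg d _
  have hε0 := hε.1
  obtain ⟨m, hmdef⟩ :
      ∃ m, 2 / ε * √(∑ i, ‖mulOp (massSym ε (ρ + 1)) (w₀.1 i)‖ ^ 2) = m := ⟨_, rfl⟩
  have hm0 : 0 ≤ m := by rw [← hmdef]; positivity
  obtain ⟨l, hldef⟩ : ∃ l, ‖w₀‖ + (Cw + Cm) * (6 * c * (m * m)) * T = l := ⟨_, rfl⟩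
  have hl0 : 0 ≤ l := by rw [← hldef]; positivity
  obtain ⟨K, hK0, hK⟩ := norm_stateField_le hd α hε hρ hm0 hl0
  refine ⟨‖w₀‖ * Real.exp (K * T), fun χ w hχ h0 hw => ?_⟩
  have hw' : ∀ t ∈ Ico 0 T, HasDerivWithinAt w (χ t • stateField α ε ρ t (w t)) (Ici t) t :=
    fun t ht => hasDerivWithinAt_Ici_of_Icc ht (hw t (Ico_subset_Icc_self ht))
  have hcont : ContinuousOn w (Icc 0 T) := fun t ht => (hw t ht).continuousWithinAt
  -- the mass is conserved for every factor `χ`, because the force is orthogonal to `E`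
  have hm : ∀ t ∈ Icc 0 T, ∀ i, ‖jop (2 - (ρ + 1)) ((w t).1 i)‖ ≤ m := by
    intro t ht i
    let S : Fin 3 → State d →L[ℝ] L2 d := fun i => (mulOp (massSym ε (ρ + 1))).comp (stateE i)
    have hconst := constant_of_has_deriv_right_zero
      (f := fun t => ∑ i, ‖S i (w t)‖ ^ 2) (a := 0) (b := T)
      (continuousOn_finsetSum _ fun i _ =>
        ((S i).continuous.comp_continuousOn hcont).norm.pow 2)
      (fun τ hτ => by
        have hsum := HasDerivWithinAt.fun_sum (u := Finset.univ) fun i _ =>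
          (hasDerivWithinAt_clm (S i) (hw' τ hτ)).norm_sq
        convert hsum using 1
        simp only [map_smul, inner_smul_right, ← Finset.mul_sum]
        have := inner_elec_eq_zero hd α hε hρ (w τ).1 (osc wn τ (w τ).2.1)
          (fun j => osc magFreq τ ((w τ).2.2 j))
        exact (mul_eq_zero_of_right _ (mul_eq_zero_of_right _ this)).symm) t ht
    refine (norm_jop_le_mass hε hρ _).trans ?_
    rw [← hmdef]
    refine mul_le_mul_of_nonneg_left (Real.le_sqrt_of_sq_le ?_) (by positivity)
    rw [← h0]
    refine le_trans ?_ hconst.le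
    exact Finset.single_le_sum (f := fun i => ‖S i (w t)‖ ^ 2) (fun i _ => by positivity)
      (Finset.mem_univ i)
  -- the forces in the wave equations are bounded in `L²`, so the wave components grow linearly
  have hlow : ∀ (A : State d →L[ℝ] L2 d), (∀ v, ‖A v‖ ≤ ‖v‖) →
      (∀ t ∈ Ico 0 T, ‖A (stateField α ε ρ t (w t))‖ ≤ (Cw + Cm) * (6 * c * (m * m))) →
      ∀ t ∈ Icc 0 T, ‖A (w t)‖ ≤ l := by
    intro A hA hb t ht
    have h1 := norm_image_sub_le_of_norm_deriv_right_le_segment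
      (A.continuous.comp_continuousOn hcont) (fun τ hτ => hasDerivWithinAt_clm A (hw' τ hτ))
      (C := (Cw + Cm) * (6 * c * (m * m))) (fun τ hτ => by
        rw [map_smul, norm_smul, Real.norm_eq_abs, abs_of_nonneg (hχ τ).1]
        exact (mul_le_of_le_one_left (norm_nonneg _) (hχ τ).2).trans (hb τ hτ)) t ht
    have h2 : ‖A (w t)‖ ≤ ‖A (w 0)‖ + ‖A (w t) - A (w 0)‖ := norm_le_norm_add_norm_sub' _ _
    have h3 : (Cw + Cm) * (6 * c * (m * m)) * (t - 0) ≤ (Cw + Cm) * (6 * c * (m * m)) * T :=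
      mul_le_mul_of_nonneg_left (by linarith [ht.2]) (by positivity)
    have h4 := hA (w 0)
    rw [h0] at h2 h4
    rw [← hldef]
    simp only [Function.comp_apply, h0] at h1
    linarith
  have hquad : ∀ t ∈ Icc 0 T, ‖jop (2 - (ρ + 1)) (dens (ρ + 1) (w t).1)‖ ≤ 6 * c * (m * m) ∧
      ∀ i, ‖jop (2 - (ρ + 1)) (mag (ρ + 1) (w t).1 i)‖ ≤ 4 * c * (m * m) := by
    intro t ht
    rw [← hc]
    exact norm_jop_quad_le hd le_rfl (by linarith) (hm t ht) (hm t ht)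
  have hmm : 0 ≤ c * (m * m) := by positivity
  have hl : ∀ t ∈ Icc 0 T, ‖jop (-ρ) (w t).2.1‖ ≤ l := by
    refine hlow ((jop (-ρ)).comp stateZ) (fun v => ?_) (fun t ht => ?_)
    · exact (norm_jop_le (by linarith) _).trans ((norm_fst_le v.2).trans (norm_snd_le v))
    · refine (norm_jop_oscForce_le measurable_wn (by linarith) bddSym_waveSym hCw t _).trans ?_
      refine mul_le_mul (by linarith) ?_ (norm_nonneg _) (by positivity)
      exact (norm_jop_mono (by linarith) (by linarith) _).trans
        (hquad t (Ico_subset_Icc_self ht)).1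
  have hl' : ∀ t ∈ Icc 0 T, ∀ i, ‖jop (-(ρ - 1)) ((w t).2.2 i)‖ ≤ l := by
    intro t ht i
    refine hlow ((jop (-(ρ - 1))).comp (stateY i)) (fun v => ?_) (fun t ht => ?_) t ht
    · exact (norm_jop_le (by linarith) _).trans ((norm_le_pi_norm v.2.2 i).trans
        ((norm_snd_le v.2).trans (norm_snd_le v)))
    · refine (norm_jop_oscForce_le measurable_magFreq (by linarith) bddSym_magSym hCm t _).trans ?_
      refine mul_le_mul (by linarith) ?_ (norm_nonneg _) (by positivity)
      refine (norm_jop_mono (by linarith) (by linarith) _).trans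
        (((hquad t (Ico_subset_Icc_self ht)).2 i).trans (by linarith))
  intro t ht
  have hG := norm_le_gronwallBound_of_norm_deriv_right_le (δ := ‖w₀‖) (K := K) (ε := 0) hcont hw'
    (by rw [h0]) (fun τ hτ => by
      have hτ' := Ico_subset_Icc_self hτ
      rw [add_zero, norm_smul, Real.norm_eq_abs, abs_of_nonneg (hχ τ).1]
      exact (mul_le_of_le_one_left (norm_nonneg _) (hχ τ).2).trans
        (hK τ (w τ) (hm τ hτ') (hl τ hτ') (hl' τ hτ'))) t ht
  rw [gronwallBound_ε0, sub_zero] at hG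
  refine hG.trans (mul_le_mul_of_nonneg_left (Real.exp_le_exp.2 ?_) (norm_nonneg _))
  exact mul_le_mul_of_nonneg_left ht.2 hK0

theorem exists_state (hd : d ≤ 3) (α : ℝ) {ε ρ : ℝ} (hε : ε ∈ Ioo (0 : ℝ) 1) (hρ : 5 ≤ ρ)
    (w₀ : State d) : ∃ w : ℝ → State d, w 0 = w₀ ∧
      ∀ t, 0 ≤ t → HasDerivWithinAt w (stateField α ε ρ t (w t)) (Ici 0) t :=
  (bddLip_stateField α ε ρ).exists_global (continuous_stateField α ε ρ) w₀
    (state_apriori hd α hε hρ w₀)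

theorem state_unique {α ε ρ : ℝ} {w w' : ℝ → State d} (h0 : w 0 = w' 0)
    (hw : ∀ t, 0 ≤ t → HasDerivWithinAt w (stateField α ε ρ t (w t)) (Ici 0) t)
    (hw' : ∀ t, 0 ≤ t → HasDerivWithinAt w' (stateField α ε ρ t (w' t)) (Ici 0) t)
    {t : ℝ} (ht : 0 ≤ t) : w t = w' t :=
  (bddLip_stateField α ε ρ).unique (T := t)
    (fun τ hτ => (hw τ hτ.1).mono Icc_subset_Ici_self)
    (fun τ hτ => (hw' τ hτ.1).mono Icc_subset_Ici_self) h0 ⟨ht, le_rfl⟩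

/-! ### Planar fields -/

/-- The signs of the reflection `x₃ ↦ -x₃` acting on vectors. -/
def planarSign : Fin 3 → ℝ := ![1, 1, -1]

lemma planarSign_mul (i : Fin 3) : planarSign (i + 1) * planarSign (i + 2) = -planarSign i := by
  fin_cases i <;> simp [planarSign]

lemma planarSign_sq (i : Fin 3) : planarSign i * planarSign i = 1 := by
  fin_cases i <;> simp [planarSign]

/-- The reflection `x₃ ↦ -x₃` on states; `E` is a vector and `B` an axial vector. -/
def planarRefl : State d →L[ℝ] State d :=
  (ContinuousLinearMap.pi fun i => planarSign i • ContinuousLinearMap.proj (R := ℝ) i).prodMap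
    ((ContinuousLinearMap.id ℝ (L2 d)).prodMap
      (ContinuousLinearMap.pi fun i => (-planarSign i) • ContinuousLinearMap.proj (R := ℝ) i))

lemma planarRefl_apply (w : State d) : planarRefl w =
    (fun i => planarSign i • w.1 i, w.2.1, fun i => (-planarSign i) • w.2.2 i) := rfl

lemma crossOp_planarRefl (T : L2 d →L[ℝ] L2 d →L[ℝ] L2 d) (e b : Vec d) (i : Fin 3) :
    crossOp T (fun j => planarSign j • e j) (fun j => planarSign j • b j) i =
      (-planarSign i) • crossOp T e b i := by
  simp only [crossOp, map_smul, smul_apply, smul_smul, smul_sub,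
    mul_comm (planarSign (i + 2)), planarSign_mul]

lemma linSym_planar (α : ℝ) (i j : Fin 3) (f : L2 2) :
    planarSign j • mulOp (linSym α i j) f = planarSign i • mulOp (linSym α i j) f := by
  have hk : ∀ ξ : Space 2, kap 2 ξ = 0 := fun ξ => dif_neg (by simp)
  have h0 : ∀ {i j : Fin 3}, i ≠ j → (i = 2 ∨ j = 2) → mulOp (linSym (d := 2) α i j) f = 0 := by
    intro i j hij h
    have : linSym (d := 2) α i j = fun _ => 0 := by
      funext ξ
      rcases h with rfl | rfl <;> simp [linSym, hk, hij]
    rw [this, mulOp_const, zero_smul]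
  by_cases hij : i = j
  · rw [hij]
  by_cases h : i = 2 ∨ j = 2
  · rw [h0 hij h, smul_zero, smul_zero]
  · push Not at h
    congr 1
    revert h
    fin_cases i <;> fin_cases j <;> simp [planarSign]

lemma elec_planarRefl (α ε ρ : ℝ) (e : Vec 2) (p : L2 2) (b : Vec 2) (i : Fin 3) :
    elec α ε ρ (fun j => planarSign j • e j) p (fun j => (-planarSign j) • b j) i =
      planarSign i • elec α ε ρ e p b i := by
  have h : (fun j => (-planarSign j) • b j) = fun j => planarSign j • (-b j) := by
    funext j; rw [neg_smul, smul_neg]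
  simp only [elec, elecForce]
  rw [h, crossOp_planarRefl]
  have h2 : crossOp (convOp (ρ - 1) (ρ + 1) (ρ - 3)).flip e (fun j => -b j) i =
      -crossOp (convOp (ρ - 1) (ρ + 1) (ρ - 3)).flip e b i := by
    simp only [crossOp, map_neg]; abel
  rw [h2, ← map_smul]
  congr 1
  simp only [map_smul, linSym_planar, smul_add, smul_sub, Finset.smul_sum, neg_smul,
    smul_neg, neg_neg]

lemma stateField_planarRefl (α ε ρ t : ℝ) (w : State 2) :
    stateField α ε ρ t (planarRefl w) = planarRefl (stateField α ε ρ t w) := by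
  rw [planarRefl_apply, planarRefl_apply]
  refine Prod.ext ?_ (Prod.ext ?_ ?_)
  · funext i
    simp only [stateField, map_smul]
    exact elec_planarRefl _ _ _ _ _ _ _
  · simp only [stateField, dens, map_smul, smul_apply, smul_smul,
      planarSign_sq, one_smul]
  · funext i
    simp only [stateField, mag, map_smul, crossOp_planarRefl, oscForce]

/-- Planar initial values give planar solutions: the reflection is a symmetry of the evolution
equation, and planar states are its fixed points. -/
lemma state_planar {α ε ρ : ℝ} {w : ℝ → State 2}
    (hw : ∀ t, 0 ≤ t → HasDerivWithinAt w (stateField α ε ρ t (w t)) (Ici 0) t)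
    (hE : (w 0).1 2 = 0) (h0 : (w 0).2.2 0 = 0) (h1 : (w 0).2.2 1 = 0) {t : ℝ} (ht : 0 ≤ t) :
    (w t).1 2 = 0 ∧ (w t).2.2 0 = 0 ∧ (w t).2.2 1 = 0 := by
  have hinit : planarRefl (w 0) = w 0 := by
    rw [planarRefl_apply]
    refine Prod.ext (funext fun i => ?_) (Prod.ext rfl (funext fun i => ?_)) <;> fin_cases i <;>
      simp [planarSign, hE, h0, h1]
  have h := state_unique (w := fun τ => planarRefl (w τ)) (w' := w) hinit (fun τ hτ => by
    rw [stateField_planarRefl]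
    exact hasDerivWithinAt_clm planarRefl (hw τ hτ)) hw ht
  have half : ∀ f : L2 2, -f = f → f = 0 := by
    intro f hf
    have h2 : (2 : ℝ) • f = 0 := by
      rw [two_smul]
      nth_rewrite 1 [← hf]
      exact neg_add_cancel f
    exact (smul_eq_zero.1 h2).resolve_left two_ne_zero
  rw [planarRefl_apply] at h
  have e2 := congrFun (congrArg Prod.fst h) 2
  have y0 := congrFun (congrArg (fun w => w.2.2) h) 0
  have y1 := congrFun (congrArg (fun w => w.2.2) h) 1
  simp only [planarSign, Matrix.cons_val, neg_smul, one_smul] at e2 y0 y1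
  exact ⟨half _ (by simpa using e2), half _ (by simpa using y0), half _ (by simpa using y1)⟩

/-! ### Real and imaginary parts in physical space -/

lemma conjRefl_smul (c : ℂ) (f : L2 d) : conjRefl (c • f) = (starRingEnd ℂ) c • conjRefl f := by
  rw [← mulOp_const, ← mulOp_const]
  exact conjRefl_mulOp (bddSym_const _) (bddSym_const _) (fun _ => rfl) f

/-- The part of a function on the Fourier side which corresponds to the imaginary part in physical
space. -/
def imPart : L2 d →L[ℝ] L2 d := symPart.comp (mulOp fun _ => -Complex.I)

lemma imPart_apply (f : L2 d) : imPart f = symPart (-Complex.I • f) := by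
  rw [← mulOp_const]; rfl

lemma conjRefl_imPart (f : L2 d) : conjRefl (imPart f) = imPart f := conjRefl_symPart _

lemma real_smul_eq (c : ℝ) (f : L2 d) : c • f = (c : ℂ) • f := by
  refine Lp.ext ?_
  filter_upwards [Lp.coeFn_smul c f, Lp.coeFn_smul (c : ℂ) f] with ξ e1 e2
  rw [e1, e2]; simp

lemma symPart_eq_self {f : L2 d} (h : conjRefl f = f) : symPart f = f := by
  rw [symPart_apply, h, ← two_smul ℝ, smul_smul]
  norm_num

lemma symPart_I_smul {f : L2 d} (h : conjRefl f = f) : symPart (Complex.I • f) = 0 := by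
  rw [symPart_apply, conjRefl_smul, h, Complex.conj_I, ← add_smul, add_neg_cancel, zero_smul,
    smul_zero]

lemma imPart_I_smul (f : L2 d) : imPart (-Complex.I • f) = -symPart f := by
  rw [imPart_apply, smul_smul, neg_mul_neg, Complex.I_mul_I, neg_one_smul, map_neg]

lemma imPart_eq_zero {f : L2 d} (h : conjRefl f = f) : imPart f = 0 := by
  rw [imPart_apply, neg_smul, map_neg, symPart_I_smul h, neg_zero]

lemma symPart_mulOp {m : Space d → ℂ} (hm : BddSym m) (h : ∀ ξ, m ξ = star (m (-ξ))) (f : L2 d) :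
    symPart (mulOp m f) = mulOp m (symPart f) := by
  rw [symPart_apply, symPart_apply, conjRefl_mulOp hm hm h, map_smul, map_add]

lemma imPart_mulOp {m : Space d → ℂ} (hm : BddSym m) (h : ∀ ξ, m ξ = star (m (-ξ))) (f : L2 d) :
    imPart (mulOp m f) = mulOp m (imPart f) := by
  rw [imPart_apply, imPart_apply, ← mulOp_smul hm, symPart_mulOp hm h]

lemma star_ofReal_neg {f : Space d → ℝ} (hf : ∀ ξ, f (-ξ) = f ξ) (ξ : Space d) :
    (f ξ : ℂ) = star (f (-ξ) : ℂ) := by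
  rw [hf, RCLike.star_def, Complex.conj_ofReal]

/-- A function is real in physical space if its transform is fixed by `conjRefl`. -/
lemma conjRefl_eq_of_phys (hd : d ≤ 3) {σ : ℝ} (hσ : 2 ≤ σ) {f g : L2 d}
    (h : ∀ x, star (phys σ f x) = phys σ g x) : conjRefl f = g :=
  phys_injective hd hσ (funext fun x => by rw [phys_conjRefl, h])

/-- The vector field in physical space at level `σ`. -/
def vecPhys (σ : ℝ) (e : Vec d) (x : Space d) : Fin 3 → ℂ := fun i => phys σ (e i) x

lemma phys_dens (hd : d ≤ 3) {σ : ℝ} (hσ : 2 ≤ σ) (e : Vec d) (x : Space d) :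
    phys σ (dens σ e) x = (normSq (vecPhys σ e) x : ℂ) := by
  rw [dens, phys_sum hd hσ, normSq, Complex.ofReal_sum]
  refine Finset.sum_congr rfl fun i _ => ?_
  rw [phys_mul (convAdm_self hd hσ), phys_conjRefl, RCLike.star_def, Complex.mul_conj',
    Complex.ofReal_pow]
  rfl

lemma phys_mag (hd : d ≤ 3) {σ : ℝ} (hσ : 2 ≤ σ) (e : Vec d) (x : Space d) (i : Fin 3) :
    phys σ (mag σ e i) x = crossConj (vecPhys σ e) x i := by
  refine phys_crossOp hd hσ (fun i j => ?_) i
  rw [phys_mul (convAdm_self hd hσ), phys_conjRefl]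
  rfl

lemma conjRefl_dens (hd : d ≤ 3) {σ : ℝ} (hσ : 2 ≤ σ) (e : Vec d) :
    conjRefl (dens σ e) = dens σ e :=
  conjRefl_eq_of_phys hd hσ fun x => by rw [phys_dens hd hσ, RCLike.star_def, Complex.conj_ofReal]

lemma star_crossConj (E : Space d → Fin 3 → ℂ) (x : Space d) (i : Fin 3) :
    star (crossConj E x i) = -crossConj E x i := by
  rw [crossConj, cross_apply]
  fin_cases i <;> simp [mul_comm]

lemma conjRefl_mag (hd : d ≤ 3) {σ : ℝ} (hσ : 2 ≤ σ) (e : Vec d) (i : Fin 3) :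
    conjRefl (mag σ e i) = -mag σ e i :=
  conjRefl_eq_of_phys hd hσ fun x => by rw [phys_mag hd hσ, phys_neg, phys_mag hd hσ, star_crossConj]

lemma conjRefl_waveForce (hd : d ≤ 3) {σ : ℝ} (hσ : 2 ≤ σ) (e : Vec d) :
    conjRefl (mulOp waveSym (dens σ e)) = mulOp waveSym (dens σ e) := by
  rw [conjRefl_mulOp bddSym_waveSym bddSym_waveSym
    (star_ofReal_neg fun ξ => by rw [wn_neg, jb_neg_arg]), conjRefl_dens hd hσ]

lemma conjRefl_magForce (hd : d ≤ 3) {σ : ℝ} (hσ : 2 ≤ σ) (e : Vec d) (i : Fin 3) :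
    conjRefl (mulOp magSym (mag σ e i)) = mulOp magSym (mag σ e i) := by
  have h : BddSym (fun ξ : Space d => -magSym ξ) := by
    simpa using (bddSym_const (d := d) (-1)).mul bddSym_magSym
  rw [conjRefl_mulOp bddSym_magSym h (fun ξ => ?_), conjRefl_mag hd hσ, mulOp_neg_sym bddSym_magSym,
    map_neg, neg_neg]
  rw [magSym, magSym, RCLike.star_def, map_mul, Complex.conj_I, Complex.conj_ofReal, wn_neg,
    jb_neg_arg, neg_mul]

/-! ### Second order equations in time -/

/-- The symbol `θ` from a level of regularity to the one `s` orders below. -/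
def freqSym (θ : Space d → ℝ) (s : ℝ) (ξ : Space d) : ℂ := ((θ ξ * jb (-s) ξ : ℝ) : ℂ)

section

variable {θ : Space d → ℝ} {κ : ℝ}

lemma Dispersion.bddSym (hθ : Dispersion θ κ) {s : ℝ} (hs : κ ≤ s) : BddSym (freqSym θ s) := by
  obtain ⟨C, hC⟩ := hθ.upper
  have hC0 : 0 ≤ C := by
    have h := (abs_nonneg _).trans (hC 0)
    by_contra! hn
    nlinarith [jb_pos κ (0 : Space d)]
  refine bddSym_ofReal_mul_jb hθ.meas (C := C) fun ξ => (hC ξ).trans ?_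
  rw [neg_neg]
  exact mul_le_mul_of_nonneg_left (jb_mono hs ξ) hC0

lemma Dispersion.freqSym_neg (hθ : Dispersion θ κ) (s : ℝ) (ξ : Space d) :
    freqSym θ s ξ = star (freqSym θ s (-ξ)) :=
  star_ofReal_neg (f := fun ξ => θ ξ * jb (-s) ξ) (fun ξ => by simp only [hθ.even, jb_neg_arg]) ξ

lemma genSym_eq (s : ℝ) : genSym θ (fun ξ => (jb (-s) ξ : ℂ)) = fun ξ => -Complex.I * freqSym θ s ξ := by
  funext ξ
  rw [genSym, freqSym]
  push_cast
  ring

lemma jb_star (s : ℝ) (ξ : Space d) : (jb s ξ : ℂ) = star (jb s (-ξ) : ℂ) :=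
  star_ofReal_neg (fun ξ => jb_neg_arg s ξ) ξ

lemma jop_mulOp {s : ℝ} (hs : s ≤ 0) {m : Space d → ℂ} (hm : BddSym m) (f : L2 d) :
    jop s (mulOp m f) = mulOp m (jop s f) := mulOp_comm (bddSym_jb hs) hm f

lemma osc_smul (hθ : Measurable θ) (t : ℝ) (c : ℂ) (f : L2 d) :
    osc θ t (c • f) = c • osc θ t f := mulOp_smul (bddSym_oscSym hθ t) c f

/-- The real and imaginary parts of a solution of `∂ₜ z = -iθz - iG`, with a real force `G`. -/
lemma Dispersion.hasDerivWithinAt_parts (hθ : Dispersion θ κ) {w : ℝ → L2 d} {G : L2 d} {t : ℝ}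
    (hG : conjRefl G = G) (hw : HasDerivWithinAt w (oscForce θ t G) (Ici 0) t) :
    HasDerivWithinAt (fun τ => jop (-κ) (symPart (osc θ τ (w τ))))
        (mulOp (freqSym θ κ) (imPart (osc θ t (w t)))) (Ici 0) t ∧
      HasDerivWithinAt (fun τ => jop (-κ) (imPart (osc θ τ (w τ))))
        (-(mulOp (freqSym θ κ) (symPart (osc θ t (w t))) + jop (-κ) G)) (Ici 0) t := by
  have hκ : -κ ≤ 0 := by linarith [hθ.order_nonneg]
  have hb := bddSym_jb (d := d) hκ
  have hf := hθ.bddSym le_rfl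
  have hgen : BddSym (genSym θ (fun ξ => (jb (-κ) ξ : ℂ))) := by
    rw [genSym_eq]; exact (bddSym_const _).mul hf
  have h1 := hasDerivWithinAt_osc_apply hθ.meas (hasDerivWithinAt_clm (jop (-κ)) hw)
    (hasDerivAt_osc hθ.meas hb hgen (w t) t)
  set X : L2 d := mulOp (freqSym θ κ) (osc θ t (w t)) + jop (-κ) G with hX
  have h2 : osc θ t (jop (-κ) (oscForce θ t G)) +
      osc θ t (mulOp (genSym θ (fun ξ => (jb (-κ) ξ : ℂ))) (w t)) = -Complex.I • X := by
    rw [oscForce, jop_osc hθ.meas hκ, osc_osc_neg hθ.meas, mulOp_const, mulOp_smul hb, genSym_eq,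
      ← mulOp_mulOp (bddSym_const _) hf, mulOp_const, osc_smul hθ.meas, osc_mulOp hθ.meas t hf,
      ← smul_add, add_comm]
  rw [h2] at h1
  have h3 : ∀ τ, osc θ τ (jop (-κ) (w τ)) = jop (-κ) (osc θ τ (w τ)) := fun τ =>
    (jop_osc hθ.meas hκ τ _).symm
  simp only [h3] at h1
  have hJ : conjRefl (jop (-κ) G) = jop (-κ) G := by rw [← jop_conjRefl hκ, hG]
  constructor
  · have h4 := hasDerivWithinAt_clm symPart h1
    simp only [← jop_symPart hκ] at h4
    refine h4.congr_deriv ?_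
    rw [← imPart_apply, hX, map_add, imPart_eq_zero hJ, add_zero, imPart_mulOp hf (hθ.freqSym_neg κ)]
  · have h4 := hasDerivWithinAt_clm imPart h1
    simp only [imPart_mulOp hb (jb_star _)] at h4
    refine h4.congr_deriv ?_
    rw [imPart_I_smul, hX, map_add, symPart_eq_self hJ, symPart_mulOp hf (hθ.freqSym_neg κ)]

lemma exists_primitive {g : ℝ → L2 d} (hg : ContinuousOn g (Ici 0)) (q₀ : L2 d) :
    ∃ Q : ℝ → L2 d, Q 0 = q₀ ∧ ∀ t, 0 ≤ t → HasDerivWithinAt Q (g t) (Ici 0) t := by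
  let g' : ℝ → L2 d := fun t => g (max t 0)
  have hg' : Continuous g' :=
    continuousOn_univ.1 (hg.comp (by fun_prop) fun t _ => le_max_right t 0)
  refine ⟨fun t => q₀ + ∫ τ in (0 : ℝ)..t, g' τ, by simp, fun t ht => ?_⟩
  have h := (hg'.integral_hasStrictDerivAt 0 t).hasDerivAt.hasDerivWithinAt (s := Ici 0)
  have h2 : g' t = g t := by simp only [g', max_eq_left ht]
  rw [h2] at h
  exact h.const_add q₀

lemma eq_of_hasDerivWithinAt_eq {f g f' : ℝ → L2 d} (h0 : f 0 = g 0)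
    (hf : ∀ t, 0 ≤ t → HasDerivWithinAt f (f' t) (Ici 0) t)
    (hg : ∀ t, 0 ≤ t → HasDerivWithinAt g (f' t) (Ici 0) t) {t : ℝ} (ht : 0 ≤ t) : f t = g t := by
  refine eq_of_has_deriv_right_eq (f' := f') (a := 0) (b := t)
    (fun τ hτ => (hf τ hτ.1).mono (Ici_subset_Ici.2 hτ.1))
    (fun τ hτ => (hg τ hτ.1).mono (Ici_subset_Ici.2 hτ.1))
    (fun τ hτ => ((hf τ hτ.1).continuousWithinAt).mono Icc_subset_Ici_self)
    (fun τ hτ => ((hg τ hτ.1).continuousWithinAt).mono Icc_subset_Ici_self) h0 t ⟨ht, le_rfl⟩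

lemma osc_neg_freq (t : ℝ) : osc (fun ξ => -θ ξ) t = osc θ (-t) := by
  unfold osc
  congr 1
  funext ξ
  rw [oscSym, oscSym, neg_mul, mul_neg]

/-- A real solution `p` of `∂ₜ² p = -θ² p - θ G` is the real part of a solution `z` of
`∂ₜ z = -iθz - iG`. Its imaginary part is found by integrating `-θ p - G` in time, which avoids
a division by `θ`. -/
lemma Dispersion.exists_interaction (hθ : Dispersion θ κ) {σ : ℝ} (hσ : 0 ≤ σ)
    {p s G : ℝ → L2 d} {q₀ : L2 d} (hp : ContinuousOn p (Ici 0)) (hG : ContinuousOn G (Ici 0))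
    (hpJ : ∀ t, 0 ≤ t → conjRefl (p t) = p t) (hGJ : ∀ t, 0 ≤ t → conjRefl (G t) = G t)
    (hqJ : conjRefl q₀ = q₀) (h0 : mulOp (freqSym θ (σ + 2 * κ)) q₀ = s 0)
    (hps : ∀ t, 0 ≤ t →
      HasDerivWithinAt (fun τ => jop (-(σ + 2 * κ)) (p τ)) (s t) (Ici 0) t)
    (hs : ∀ t, 0 ≤ t → HasDerivWithinAt s
      (-(mulOp (freqSym θ κ) (mulOp (freqSym θ (σ + κ)) (p t)) +
        mulOp (freqSym θ (σ + κ)) (G t))) (Ici 0) t) :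
    ∃ w : ℝ → L2 d, w 0 = jop (-(2 * κ)) (p 0 + Complex.I • q₀) ∧ ∀ t, 0 ≤ t →
      HasDerivWithinAt w (oscForce θ t (jop (-κ) (G t))) (Ici 0) t ∧
      symPart (osc θ t (w t)) = jop (-(2 * κ)) (p t) := by
  have hκ0 := hθ.order_nonneg
  have hκ : -κ ≤ 0 := by linarith
  have hb := bddSym_jb (d := d) hκ
  have hf := hθ.bddSym le_rfl
  have hfσ := hθ.bddSym (by linarith : κ ≤ σ + κ)
  -- `q` plays the role of `θ⁻¹ ∂ₜ p`
  obtain ⟨q, hq0, hq⟩ := exists_primitive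
    (g := fun t => -(mulOp (freqSym θ κ) (p t) + G t))
    ((((mulOp (freqSym θ κ)).continuous.comp_continuousOn hp).add hG).neg) (jop (-κ) q₀)
  have hqJ' : ∀ t, 0 ≤ t → conjRefl (q t) = q t := fun t ht =>
    eq_of_hasDerivWithinAt_eq (f := fun τ => conjRefl (q τ)) (g := q)
      (by simp only [hq0]; rw [← jop_conjRefl hκ, hqJ])
      (fun τ hτ => by
        have h := hasDerivWithinAt_clm conjRefl (hq τ hτ)
        rwa [map_neg, map_add, conjRefl_mulOp hf hf (hθ.freqSym_neg κ), hpJ τ hτ, hGJ τ hτ] at h)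
      hq ht
  have hsq : ∀ t, 0 ≤ t → s t = mulOp (freqSym θ (σ + κ)) (q t) := fun t ht =>
    eq_of_hasDerivWithinAt_eq (f := s) (g := fun τ => mulOp (freqSym θ (σ + κ)) (q τ))
      (by
        simp only [hq0]
        rw [← h0, mulOp_mulOp_eq hfσ hb (fun ξ => ?_)]
        rw [freqSym, freqSym, show -(σ + 2 * κ) = -(σ + κ) + -κ by ring, jb_add]
        push_cast
        ring)
      hs (fun τ hτ => by
        have h := hasDerivWithinAt_clm (mulOp (freqSym θ (σ + κ))) (hq τ hτ)
        rwa [map_neg, map_add, mulOp_comm hfσ hf] at h) ht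
  have hqc : ContinuousOn q (Ici 0) := fun t ht => (hq t ht).continuousWithinAt
  have hσ' : -σ ≤ 0 := by linarith
  -- the weak equation `∂ₜ p = θ q` also holds in a stronger norm, as `q` is continuous there
  have hP := hasDerivWithinAt_of_injective (jop (-σ)) (jop_injective hσ')
    (f := fun t => jop (-(2 * κ)) (p t)) (g := fun t => mulOp (freqSym θ κ) (q t))
    ((mulOp (freqSym θ κ)).continuous.comp_continuousOn hqc) (fun t ht => by
      have h := hps t ht
      rw [hsq t ht] at h
      have e1 : ∀ τ, jop (-σ) (jop (-(2 * κ)) (p τ)) = jop (-(σ + 2 * κ)) (p τ) := fun τ => by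
        rw [jop_jop hσ' (by linarith)]
        congr 3
        ring
      have e2 : jop (-σ) (mulOp (freqSym θ κ) (q t)) = mulOp (freqSym θ (σ + κ)) (q t) := by
        refine mulOp_mulOp_eq (bddSym_jb hσ') hf (fun ξ => ?_) _
        rw [freqSym, freqSym, neg_add, jb_add]
        push_cast
        ring
      simp only [e1, e2]
      exact h)
  let z : ℝ → L2 d := fun t => jop (-κ) (p t) + Complex.I • q t
  have hz : ∀ t, jop (-κ) (z t) = jop (-(2 * κ)) (p t) + Complex.I • jop (-κ) (q t) := by
    intro t
    simp only [z]
    rw [map_add, jop_jop hκ hκ, mulOp_smul hb]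
    congr 4
    ring
  have hzd : ∀ t, 0 ≤ t → HasDerivWithinAt (fun τ => jop (-κ) (z τ))
      (-Complex.I • (mulOp (freqSym θ κ) (z t) + jop (-κ) (G t))) (Ici 0) t := by
    intro t ht
    have h1 := hasDerivWithinAt_clm (mulOp fun _ => Complex.I)
      (hasDerivWithinAt_clm (jop (-κ)) (hq t ht))
    have h2 := (hP t ht).add h1
    have h3 : (fun τ => jop (-κ) (z τ)) = (fun τ => jop (-(2 * κ)) (p τ)) +
        fun τ => mulOp (fun _ => Complex.I) (jop (-κ) (q τ)) := by
      funext τ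
      rw [Pi.add_apply, mulOp_const, hz]
    rw [h3]
    refine h2.congr_deriv ?_
    · simp only [z]
      rw [mulOp_const, map_neg, map_add, map_add, jop_mulOp hκ hf, mulOp_smul hf]
      simp only [smul_add, smul_neg, neg_smul, smul_smul, neg_mul, Complex.I_mul_I, one_smul, neg_neg]
      abel
  refine ⟨fun t => osc θ (-t) (jop (-κ) (z t)), ?_, fun t ht => ⟨?_, ?_⟩⟩
  · simp only [neg_zero, osc_zero, hz, hq0]
    rw [jop_jop hκ hκ, map_add, mulOp_smul (bddSym_jb (by linarith))]
    congr 4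
    ring
  · have hm : Measurable fun ξ => -θ ξ := hθ.meas.neg
    have hg : genSym (fun ξ => -θ ξ) (fun ξ : Space d => (jb (-κ) ξ : ℂ)) =
        fun ξ => Complex.I * freqSym θ κ ξ := by
      funext ξ
      rw [genSym, freqSym]
      push_cast
      ring
    have h1 := hasDerivWithinAt_osc_apply hm (hzd t ht)
      (hasDerivAt_osc hm hb (by rw [hg]; exact (bddSym_const _).mul hf) (z t) t)
    simp only [osc_neg_freq] at h1
    convert h1 using 1
    rw [hg, ← mulOp_mulOp (bddSym_const _) hf, mulOp_const, oscForce, ← map_add, mulOp_const]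
    congr 1
    rw [smul_add]
    simp only [neg_smul]
    abel
  · simp only [osc_osc_neg hθ.meas, hz]
    rw [map_add, symPart_I_smul, add_zero, symPart_eq_self]
    · rw [← jop_conjRefl (by linarith), hpJ t ht]
    · rw [← jop_conjRefl hκ, hqJ' t ht]

end

/-! ### The operators of the system in physical space -/

lemma phys_jop {σ τ s : ℝ} (hs : s ≤ 0) (h : τ = σ + s) (f : L2 d) :
    phys τ (jop s f) = phys σ f := by
  have := phys_level (σ := σ) (τ := τ) (by linarith) f
  rwa [show τ - σ = s by linarith] at this

lemma ofReal_lap {f : Space d → ℝ} (hf : ContDiff ℝ 2 f) (x : Space d) :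
    ((lap f x : ℝ) : ℂ) = lap (fun y => (f y : ℂ)) x :=
  (ContDiffAt.laplacian_CLM_comp_left (l := Complex.ofRealCLM) hf.contDiffAt).symm

lemma lap_apply {F : Space d → Fin 3 → ℂ} (hF : ContDiff ℝ 2 F) (x : Space d) (i : Fin 3) :
    lap F x i = lap (fun y => F y i) x := by
  have h := ContDiffAt.laplacian_CLM_comp_left
    (l := (ContinuousLinearMap.proj i : (Fin 3 → ℂ) →L[ℝ] ℂ)) (hF.contDiffAt (x := x))
  unfold lap
  exact h.symm

lemma contDiff_vecPhys (hd : d ≤ 3) {σ : ℝ} (k : ℕ) (h : k + 2 ≤ σ) (e : Vec d) :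
    ContDiff ℝ k (vecPhys σ e) :=
  contDiff_pi.2 fun i => contDiff_phys hd k h (e i)

lemma lap_vecPhys (hd : d ≤ 3) {σ : ℝ} (h : 4 ≤ σ) (e : Vec d) :
    lap (vecPhys σ e) = vecPhys (σ - 2) (fun i => mulOp lapSym (e i)) := by
  funext x i
  rw [lap_apply (contDiff_vecPhys hd 2 (by norm_num; linarith) e)]
  exact congrFun (lap_phys hd h (e i)) x

lemma crossConj_vecPhys (hd : d ≤ 3) {σ : ℝ} (hσ : 2 ≤ σ) (e : Vec d) :
    crossConj (vecPhys σ e) = vecPhys σ (mag σ e) :=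
  funext fun x => funext fun i => (phys_mag hd hσ e x i).symm

lemma complexify_rePhys (hd : d ≤ 3) {σ : ℝ} (hσ : 2 ≤ σ) (y : Vec d) :
    complexify (rePhys σ y) = vecPhys σ (fun i => symPart (y i)) :=
  funext fun x => funext fun i => (phys_symPart hd hσ (y i) x).symm

lemma curl_apply (F : Space d → Fin 3 → ℂ) (x : Space d) (i : Fin 3) :
    curl F x i = partialD (i + 1) (fun y => F y (i + 2)) x
      - partialD (i + 2) (fun y => F y (i + 1)) x := by
  fin_cases i <;> rfl

lemma partialD_phys_apply (hd : d ≤ 3) {σ : ℝ} (h : 3 ≤ σ) (j : Fin 3) (f : L2 d) (x : Space d) :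
    partialD j (fun y => phys σ f y) x = phys (σ - 1) (mulOp (partSym j) f) x :=
  congrFun (partialD_phys hd h j f) x

lemma curl_vecPhys (hd : d ≤ 3) {σ : ℝ} (h : 3 ≤ σ) (e : Vec d) :
    curl (vecPhys σ e) = vecPhys (σ - 1) (fun i =>
      mulOp (partSym (i + 1)) (e (i + 2)) - mulOp (partSym (i + 2)) (e (i + 1))) := by
  funext x i
  rw [curl_apply]
  simp only [vecPhys]
  rw [phys_sub hd (by linarith), partialD_phys_apply hd h, partialD_phys_apply hd h]

lemma grad_divergence_vecPhys (hd : d ≤ 3) {σ : ℝ} (h : 4 ≤ σ) (e : Vec d) :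
    grad (divergence (vecPhys σ e)) = vecPhys (σ - 1 - 1) (fun i =>
      mulOp (partSym i) (∑ j, mulOp (partSym j) (e j))) := by
  have h1 : divergence (vecPhys σ e) = phys (σ - 1) (∑ j, mulOp (partSym j) (e j)) := by
    funext x
    rw [phys_sum hd (by linarith)]
    exact Finset.sum_congr rfl fun j _ => partialD_phys_apply hd (by linarith) j (e j) x
  rw [h1]
  funext x i
  exact partialD_phys_apply hd (by linarith) i _ x

lemma sum_kap_sq (hd : d ≤ 3) (ξ : Space d) : ∑ k, kap k ξ ^ 2 = wn ξ ^ 2 := by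
  rw [wn, mul_pow, EuclideanSpace.norm_sq_eq, Fin.sum_univ_three]
  interval_cases d <;> simp [kap, Fin.sum_univ_succ] <;> ring

lemma sum_fin_three {M : Type*} [AddCommMonoid M] (f : Fin 3 → M) (i : Fin 3) :
    ∑ j, f j = f i + f (i + 1) + f (i + 2) := by
  rw [Fin.sum_univ_three]
  fin_cases i <;> simp <;> abel

lemma smul_mulOp {m : Space d → ℂ} (hm : BddSym m) (c : ℝ) (f : L2 d) :
    c • mulOp m f = mulOp (fun ξ => (c : ℂ) * m ξ) f := by
  rw [← mulOp_mulOp (bddSym_const _) hm, mulOp_const, real_smul_eq]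

lemma partSym_mul (i j : Fin 3) (ξ : Space d) :
    (jb (-2) ξ : ℂ) * (partSym i ξ * partSym j ξ) = -((kap i ξ * kap j ξ : ℝ) : ℂ) * jb (-4) ξ := by
  have h2 : (jb (-1) ξ : ℂ) * jb (-1) ξ = jb (-2) ξ := by
    rw [← Complex.ofReal_mul, ← jb_add]; norm_num
  have h4 : (jb (-2) ξ : ℂ) * jb (-2) ξ = jb (-4) ξ := by
    rw [← Complex.ofReal_mul, ← jb_add]; norm_num
  rw [partSym, partSym, ← h4, ← h2]
  push_cast
  linear_combination (jb (-1) ξ : ℂ) ^ 4 * kap i ξ * kap j ξ * Complex.I_sq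

lemma phys_lin (hd : d ≤ 3) (α : ℝ) {ρ : ℝ} (hρ : 5 ≤ ρ) (e : Vec d) (x : Space d) (i : Fin 3) :
    phys (ρ - 3) (∑ j, mulOp (linSym α i j) (e j)) x =
      grad (divergence (vecPhys (ρ + 1) e)) x i - α * curl (curl (vecPhys (ρ + 1) e)) x i := by
  have hp := fun j => bddSym_partSym (d := d) j
  have hpp := fun i j => (hp i).mul (hp j)
  -- the entries of the matrix symbol as products of symbols of first derivatives
  have hoff : ∀ j, i ≠ j → ∀ f : L2 d, mulOp (linSym α i j) f = jop (-2)
      (mulOp (partSym i) (mulOp (partSym j) f) - α • mulOp (partSym j) (mulOp (partSym i) f)) := by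
    intro j hij f
    rw [mulOp_mulOp (hp i) (hp j), mulOp_mulOp (hp j) (hp i), sub_eq_add_neg, ← neg_smul,
      smul_mulOp (hpp j i), ← mulOp_add_sym (hpp i j) ((bddSym_const _).mul (hpp j i))]
    refine (mulOp_mulOp_eq (bddSym_jb (by norm_num)) ((hpp i j).add
      ((bddSym_const _).mul (hpp j i))) (fun ξ => ?_) f).symm
    have h1 := partSym_mul i j ξ
    have h2 := partSym_mul j i ξ
    rw [linSym, if_neg hij]
    push_cast at h1 h2 ⊢
    linear_combination h1 - α * h2
  have hdiag : ∀ f : L2 d, mulOp (linSym α i i) f = jop (-2)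
      (mulOp (partSym i) (mulOp (partSym i) f) +
        α • (mulOp (partSym (i + 1)) (mulOp (partSym (i + 1)) f)
          + mulOp (partSym (i + 2)) (mulOp (partSym (i + 2)) f))) := by
    intro f
    have hs := (hpp (i + 1) (i + 1)).add (hpp (i + 2) (i + 2))
    rw [mulOp_mulOp (hp i) (hp i), mulOp_mulOp (hp (i + 1)) (hp (i + 1)),
      mulOp_mulOp (hp (i + 2)) (hp (i + 2)), ← mulOp_add_sym (hpp _ _) (hpp _ _),
      smul_mulOp hs, ← mulOp_add_sym (hpp _ _) ((bddSym_const _).mul hs)]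
    refine (mulOp_mulOp_eq (bddSym_jb (by norm_num)) ((hpp i i).add
      ((bddSym_const _).mul hs)) (fun ξ => ?_) f).symm
    have h0 := partSym_mul i i ξ
    have h1 := partSym_mul (i + 1) (i + 1) ξ
    have h2 := partSym_mul (i + 2) (i + 2) ξ
    rw [linSym, if_pos rfl, ← sum_kap_sq hd ξ, sum_fin_three _ i]
    push_cast at h0 h1 h2 ⊢
    linear_combination h0 + α * h1 + α * h2
  have hsum : ∑ j, mulOp (linSym α i j) (e j) = jop (-2)
      (mulOp (partSym i) (∑ j, mulOp (partSym j) (e j)) - α •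
        (mulOp (partSym (i + 1)) (mulOp (partSym (i + 2 + 1)) (e (i + 2 + 2))
            - mulOp (partSym (i + 2 + 2)) (e (i + 2 + 1)))
          - mulOp (partSym (i + 2)) (mulOp (partSym (i + 1 + 1)) (e (i + 1 + 2))
            - mulOp (partSym (i + 1 + 2)) (e (i + 1 + 1))))) := by
    have i1 : i ≠ i + 1 := by fin_cases i <;> decide
    have i2 : i ≠ i + 2 := by fin_cases i <;> decide
    have j1 : i + 2 + 1 = i := by fin_cases i <;> rfl
    have j2 : i + 2 + 2 = i + 1 := by fin_cases i <;> rfl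
    have j3 : i + 1 + 1 = i + 2 := by fin_cases i <;> rfl
    have j4 : i + 1 + 2 = i := by fin_cases i <;> rfl
    rw [sum_fin_three _ i, sum_fin_three (fun j => mulOp (partSym j) (e j)) i, hdiag,
      hoff _ i1, hoff _ i2, j1, j2, j3, j4]
    simp only [map_add, map_sub, map_smul, smul_add, smul_sub]
    abel
  have hgd := congrFun (congrFun (grad_divergence_vecPhys hd (by linarith : 4 ≤ ρ + 1) e) x) i
  rw [hsum, phys_jop (σ := ρ + 1 - 1 - 1) (by norm_num) (by ring), phys_sub hd (by linarith),
    phys_real_smul, hgd, curl_vecPhys hd (by linarith : 3 ≤ ρ + 1), curl_vecPhys hd (by linarith)]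
  rfl

/-- The force on the electric field, computed on the Fourier side, is that of the system. -/
lemma phys_elecForce (hd : d ≤ 3) (α : ℝ) {ρ : ℝ} (hρ : 5 ≤ ρ) (e : Vec d) (z : L2 d) (y : Vec d)
    (x : Space d) (i : Fin 3) :
    phys (ρ - 3) (elecForce α ρ e (symPart z) (fun j => symPart (y j)) i) x =
      grad (divergence (vecPhys (ρ + 1) e)) x i - α * curl (curl (vecPhys (ρ + 1) e)) x i
        - ((phys ρ z x).re : ℂ) * vecPhys (ρ + 1) e x i
        + Complex.I * (vecPhys (ρ + 1) e x ⨯₃ complexify (rePhys (ρ - 1) y) x) i := by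
  rw [elecForce, phys_add hd (by linarith), phys_sub hd (by linarith), phys_lin hd α hρ,
    mulOp_const, phys_smul, phys_cross_symPart hd hρ, phys_mul (convAdm_elec hd hρ),
    phys_symPart hd (by linarith)]
  rfl

/-- The second time derivative prescribed by the wave equation with frequency `θ` and force `G`. -/
def waveAccel (θ : Space d → ℝ) (κ : ℝ) (p G : L2 d) : L2 d :=
  -(mulOp (freqSym θ κ) (mulOp (freqSym θ κ) p) + mulOp (freqSym θ κ) G)

lemma jb_mul_jb (s t : ℝ) (ξ : Space d) : (jb s ξ : ℂ) * jb t ξ = jb (s + t) ξ := by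
  rw [← Complex.ofReal_mul, ← jb_add]

/-- `n_tt = Δ n + Δ|E|²`, where `D` is the transform of `|E|²`. -/
lemma phys_waveAccel_wn (hd : d ≤ 3) {σ : ℝ} (hσ : 4 ≤ σ) (p D : L2 d) (x : Space d) :
    phys (σ - 2) (waveAccel wn 1 p (jop (-1) (mulOp waveSym D))) x =
      lap (phys σ p) x + lap (phys (σ + 1) D) x := by
  have hf := dispersion_wn.bddSym (d := d) le_rfl
  have hj := bddSym_jb (d := d) (by norm_num : (-1 : ℝ) ≤ 0)
  have e1 : mulOp (freqSym wn 1) (mulOp (freqSym wn 1) p) = -mulOp lapSym p := by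
    rw [← mulOp_neg_sym bddSym_lapSym]
    refine mulOp_mulOp_eq hf hf (fun ξ => ?_) p
    have := jb_mul_jb (-1) (-1) ξ
    norm_num at this
    rw [freqSym, lapSym, ← this]
    push_cast
    ring
  have e2 : mulOp (freqSym wn 1) (jop (-1) (mulOp waveSym D)) = -jop (-1) (mulOp lapSym D) := by
    rw [mulOp_comm hf hj, ← map_neg, ← mulOp_neg_sym bddSym_lapSym,
      mulOp_mulOp_eq hf bddSym_waveSym (fun ξ => ?_)]
    have := jb_mul_jb (-1) (-1) ξ
    norm_num at this
    rw [freqSym, waveSym, lapSym, ← this]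
    push_cast
    ring
  rw [waveAccel, e1, e2, ← neg_add, neg_neg, phys_add hd (by linarith), lap_phys hd hσ,
    lap_phys hd (by linarith), phys_jop (σ := σ + 1 - 2) (by norm_num) (by ring)]

/-- `B_tt = -Δ² B + Δ B - i Δ²(E × Ē)`, where `D` is the transform of a component of `E × Ē`. -/
lemma phys_waveAccel_magFreq (hd : d ≤ 3) {σ : ℝ} (hσ : 6 ≤ σ) (p D : L2 d) (x : Space d) :
    phys (σ - 4) (waveAccel magFreq 2 p (jop (-2) (mulOp magSym D))) x =
      -lap (lap (phys σ p)) x + lap (phys σ p) x - Complex.I * lap (lap (phys (σ + 2) D)) x := by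
  have hf := dispersion_magFreq.bddSym (d := d) le_rfl
  have hj := bddSym_jb (d := d) (by norm_num : (-2 : ℝ) ≤ 0)
  have hl := bddSym_lapSym (d := d)
  have e1 : mulOp (freqSym magFreq 2) (mulOp (freqSym magFreq 2) p) =
      mulOp lapSym (mulOp lapSym p) - jop (-2) (mulOp lapSym p) := by
    rw [mulOp_mulOp hl hl, mulOp_mulOp hj hl, sub_eq_add_neg, ← mulOp_neg_sym (hj.mul hl),
      ← mulOp_add_sym (hl.mul hl) (by simpa using (bddSym_const (d := d) (-1)).mul (hj.mul hl))]
    refine mulOp_mulOp_eq hf hf (fun ξ => ?_) p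
    have h : (magFreq ξ : ℂ) ^ 2 = (wn ξ : ℂ) ^ 2 + (wn ξ : ℂ) ^ 4 := by
      exact_mod_cast magFreq_sq ξ
    rw [freqSym, lapSym]
    push_cast
    linear_combination (jb (-2) ξ : ℂ) ^ 2 * h
  have e2 : mulOp (freqSym magFreq 2) (jop (-2) (mulOp magSym D)) =
      Complex.I • jop (-2) (mulOp lapSym (mulOp lapSym D)) := by
    rw [mulOp_comm hf hj, ← mulOp_smul hj, ← mulOp_const, mulOp_mulOp hl hl,
      mulOp_mulOp (bddSym_const _) (hl.mul hl), mulOp_mulOp_eq hf bddSym_magSym (fun ξ => ?_)]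
    have h : (√(1 + wn ξ ^ 2) : ℂ) * (√(1 + wn ξ ^ 2) : ℂ)⁻¹ = 1 :=
      mul_inv_cancel₀ (Complex.ofReal_ne_zero.2 (by positivity))
    rw [freqSym, magSym, lapSym, magFreq]
    push_cast
    rw [div_eq_mul_inv]
    linear_combination (Complex.I * (wn ξ : ℂ) ^ 4 * (jb (-2) ξ : ℂ) ^ 2) * h
  rw [waveAccel, e1, e2, phys_neg, phys_add hd (by linarith), phys_sub hd (by linarith), phys_smul,
    lap_phys hd (by linarith : 4 ≤ σ), lap_phys hd (by linarith : 4 ≤ σ - 2),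
    lap_phys hd (by linarith : 4 ≤ σ + 2), lap_phys hd (by linarith : 4 ≤ σ + 2 - 2),
    phys_jop (σ := σ - 2) (by norm_num) (by ring),
    phys_jop (σ := σ + 2 - 2 - 2) (by norm_num) (by ring), show σ - 4 = σ - 2 - 2 by ring]
  ring

/-! ### Real fields given by their transforms -/

/-- The real part of the function with transform `f` at level `σ`. -/
def realPhys (σ : ℝ) (f : L2 d) (x : Space d) : ℝ := (phys σ f x).re

lemma ofReal_realPhys (hd : d ≤ 3) {σ : ℝ} (hσ : 2 ≤ σ) (f : L2 d) :
    (fun x => (realPhys σ f x : ℂ)) = phys σ (symPart f) :=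
  funext fun x => (phys_symPart hd hσ f x).symm

lemma isLift_realPhys (hd : d ≤ 3) {σ : ℝ} (hσ : 2 ≤ σ) (f : L2 d) :
    IsLift σ (fun x => (realPhys σ f x : ℂ)) (symPart f) := by
  have h := isLift_phys hd hσ le_rfl (symPart f)
  rwa [sub_self, jop_zero, ← ofReal_realPhys hd hσ f] at h

lemma isLift_vecPhys (hd : d ≤ 3) {σ : ℝ} (hσ : 2 ≤ σ) (e : Vec d) (i : Fin 3) :
    IsLift σ (fun x => vecPhys σ e x i) (e i) := by
  have h := isLift_phys hd hσ le_rfl (e i)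
  rwa [sub_self, jop_zero] at h

lemma contDiff_realPhys (hd : d ≤ 3) {σ : ℝ} (k : ℕ) (h : k + 2 ≤ σ) (f : L2 d) :
    ContDiff ℝ k (realPhys σ f) :=
  Complex.reCLM.contDiff.comp (contDiff_phys hd k h f)

lemma symPart_add_I {p q : L2 d} (hp : conjRefl p = p) (hq : conjRefl q = q) :
    symPart (p + Complex.I • q) = p := by
  rw [map_add, symPart_eq_self hp, symPart_I_smul hq, add_zero]

lemma imPart_add_I {p q : L2 d} (hp : conjRefl p = p) (hq : conjRefl q = q) :
    imPart (p + Complex.I • q) = q := by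
  rw [map_add, imPart_eq_zero hp, zero_add, imPart_apply, smul_smul, neg_mul, Complex.I_mul_I,
    neg_neg, one_smul, symPart_eq_self hq]

lemma IsLift.eq_zero {s : ℝ} {f : Space d → ℂ} {F : L2 d} (h : IsLift s f F)
    (hf : f =ᵐ[volume] 0) : F = 0 := by
  have h1 := h.smul 0
  rw [zero_smul] at h1
  refine h.unique (h1.congr ?_)
  filter_upwards [hf] with x hx
  rw [hx, zero_smul]; rfl

lemma jb_le_of_norm_le_one {σ : ℝ} (hσ : 0 ≤ σ) {ξ : Space d} (h : ‖ξ‖ ≤ 1) :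
    jb σ ξ ≤ 2 ^ (σ / 2) := by
  refine Real.rpow_le_rpow (base_pos ξ).le ?_ (by positivity)
  nlinarith [norm_nonneg ξ]

lemma ae_ne_zero (hd : 0 < d) : ∀ᵐ ξ : Space d, ξ ≠ 0 := by
  have : Nonempty (Fin d) := ⟨⟨0, hd⟩⟩
  have : Nontrivial (Space d) := inferInstance
  exact Measure.ae_ne volume 0

lemma Dispersion.pos {θ : Space d → ℝ} {κ : ℝ} (hθ : Dispersion θ κ) {ξ : Space d} (h : ξ ≠ 0) :
    0 < θ ξ := (norm_pos_iff.2 h).trans_le (hθ.low ξ)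

lemma Dispersion.injective (hd : 0 < d) {θ : Space d → ℝ} {κ : ℝ} (hθ : Dispersion θ κ) :
    Function.Injective (mulOp (freqSym θ κ)) := by
  refine mulOp_injective (hθ.bddSym le_rfl) ?_
  filter_upwards [ae_ne_zero hd] with ξ h0
  exact Complex.ofReal_ne_zero.2 (mul_ne_zero (hθ.pos h0).ne' (jb_ne _ ξ))

/-- The quotient of a function by the frequency `θ`. Near `ξ = 0` the homogeneous norm of negative
order controls it, and away from there the ellipticity of `θ`. -/
lemma Dispersion.exists_div (hd : d ≤ 3) (hd0 : 0 < d) {θ : Space d → ℝ} {κ : ℝ}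
    (hθ : Dispersion θ κ) {σ s : ℝ} (hσ : 2 ≤ σ - κ) (hs : s ≤ -1) {f : Space d → ℝ}
    (hf : MemH (σ - κ) (fun x => (f x : ℂ))) (hf' : MemHdot s (fun x => (f x : ℂ))) :
    ∃ q : L2 d, conjRefl q = q ∧
      IsLift (σ - κ) (fun x => (f x : ℂ)) (mulOp (freqSym θ κ) q) := by
  obtain ⟨F, hF⟩ := hf.exists_isLift
  obtain ⟨hL, hrep⟩ := id hF
  obtain ⟨C, hC⟩ := hθ.high
  set g : L2 d := 𝓕 (hL.toLp fun x => (f x : ℂ)) with hg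
  have hκ := hθ.order_nonneg
  have hhom : MemLp (fun ξ : Space d => (‖ξ‖ ^ s : ℝ) • g ξ) 2 volume := by
    refine ⟨?_, ?_⟩
    · exact ((measurable_norm.pow_const s).aestronglyMeasurable).smul (Lp.aestronglyMeasurable g)
    · have := hf'
      unfold MemHdot homogeneousNorm at this
      rwa [dif_pos hL] at this
  have hqm : MemLp (fun ξ : Space d => ((jb κ ξ / θ ξ : ℝ) : ℂ) * F ξ) 2 volume := by
    have hmeas : Measurable fun ξ : Space d => ((jb κ ξ / θ ξ : ℝ) : ℂ) := by
      have := hθ.meas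
      have := measurable_jb (d := d) κ
      fun_prop
    have hdom : MemLp (fun ξ : Space d => C * ‖F ξ‖ +
        2 ^ (σ / 2) * ‖(‖ξ‖ ^ s : ℝ) • g ξ‖) 2 volume :=
      ((Lp.memLp F).norm.const_mul C).add (hhom.norm.const_mul _)
    refine hdom.of_le (hmeas.aestronglyMeasurable.mul (Lp.aestronglyMeasurable F)) ?_
    filter_upwards [hrep, ae_ne_zero hd0] with ξ hξ h0
    have hp := hθ.pos h0
    have hC0 : 0 ≤ C * ‖F ξ‖ := by
      refine mul_nonneg ?_ (norm_nonneg _)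
      let v : Space d := EuclideanSpace.single ⟨0, hd0⟩ 1
      have hv : ‖v‖ = 1 := by simp [v]
      have h1 := hC v hv.ge
      have h2 := hθ.low v
      have h3 := jb_pos κ v
      by_contra! hn
      nlinarith
    rw [norm_mul, Complex.norm_real, Real.norm_eq_abs, abs_of_pos (div_pos (jb_pos κ ξ) hp)]
    refine le_trans ?_ (le_abs_self _)
    -- the first term dominates for `|ξ| ≥ 1`, the second one for `|ξ| ≤ 1`
    rcases le_total 1 ‖ξ‖ with h1 | h1
    · have h2 : jb κ ξ / θ ξ ≤ C := (div_le_iff₀ hp).2 (hC ξ h1)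
      have h3 := mul_le_mul_of_nonneg_right h2 (norm_nonneg (F ξ))
      have h4 : 0 ≤ (2 : ℝ) ^ (σ / 2) * ‖(‖ξ‖ ^ s : ℝ) • g ξ‖ := by positivity
      linarith
    · have h2 : F ξ = (jb (σ - κ) ξ : ℂ) * g ξ := by
        rw [← hξ, rep, ← mul_assoc, jb_mul_jb, add_neg_cancel, jb_zero, Complex.ofReal_one,
          one_mul]
      have h3 : jb κ ξ * jb (σ - κ) ξ = jb σ ξ := by rw [← jb_add]; congr 1; ring
      have hn := norm_pos_iff.2 h0
      have h4 : (θ ξ)⁻¹ ≤ ‖ξ‖ ^ s := by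
        calc (θ ξ)⁻¹ ≤ ‖ξ‖⁻¹ := inv_anti₀ hn (hθ.low ξ)
          _ = ‖ξ‖ ^ (-1 : ℝ) := (Real.rpow_neg_one _).symm
          _ ≤ _ := Real.rpow_le_rpow_of_exponent_ge hn h1 hs
      have h5 : jb κ ξ / θ ξ * ‖F ξ‖ = jb σ ξ * ((θ ξ)⁻¹ * ‖g ξ‖) := by
        rw [h2, norm_mul, Complex.norm_real, Real.norm_eq_abs, abs_of_pos (jb_pos _ ξ), ← h3]
        ring
      have h6 : jb κ ξ / θ ξ * ‖F ξ‖ ≤ 2 ^ (σ / 2) * ‖(‖ξ‖ ^ s : ℝ) • g ξ‖ := by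
        rw [h5, norm_smul, Real.norm_eq_abs, abs_of_nonneg (Real.rpow_nonneg hn.le s)]
        exact mul_le_mul (jb_le_of_norm_le_one (by linarith) h1)
          (mul_le_mul_of_nonneg_right h4 (norm_nonneg _)) (by positivity) (by positivity)
      linarith
  have hf1 := hθ.bddSym le_rfl
  have hq : mulOp (freqSym θ κ) hqm.toLp = F := by
    refine Lp.ext ?_
    filter_upwards [mulOp_ae hf1 hqm.toLp, hqm.coeFn_toLp, ae_ne_zero hd0] with ξ e1 e2 h0
    have hp := (hθ.pos h0).ne'
    rw [e1, e2, freqSym, ← mul_assoc, ← Complex.ofReal_mul]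
    have : θ ξ * jb (-κ) ξ * (jb κ ξ / θ ξ) = 1 := by
      rw [jb_neg]
      field_simp [jb_ne κ ξ]
    rw [this, Complex.ofReal_one, one_mul]
  refine ⟨hqm.toLp, ?_, by rw [hq]; exact hF⟩
  refine hθ.injective hd0 ?_
  rw [← conjRefl_mulOp hf1 hf1 (hθ.freqSym_neg κ), hq, hF.conjRefl_eq hd hσ]

/-! ### Construction of the solution -/

lemma conjRefl_waveAccel {θ : Space d → ℝ} {κ : ℝ} (hθ : Dispersion θ κ) {p G : L2 d}
    (hp : conjRefl p = p) (hG : conjRefl G = G) :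
    conjRefl (waveAccel θ κ p G) = waveAccel θ κ p G := by
  have h := fun f => conjRefl_mulOp (hθ.bddSym le_rfl) (hθ.bddSym le_rfl) (hθ.freqSym_neg κ) f
  rw [waveAccel, map_neg, map_add, h, h, h, hp, hG]

/-- The regularity in time of the real part of a solution of `∂ₜ z = -iθz - iG`. -/
lemma Dispersion.regularity (hd : d ≤ 3) {θ : Space d → ℝ} {κ : ℝ} (hθ : Dispersion θ κ) {σ : ℝ}
    (hσ : 2 + 2 * κ ≤ σ) {w G : ℝ → L2 d} (hG : ContinuousOn G (Ici 0))
    (hGJ : ∀ t, 0 ≤ t → conjRefl (G t) = G t)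
    (hw : ∀ t, 0 ≤ t → HasDerivWithinAt w (oscForce θ t (G t)) (Ici 0) t) :
    ContInH σ (fun t x => (realPhys σ (osc θ t (w t)) x : ℂ)) ∧
    C1InH (σ - κ) (fun t x => (realPhys σ (osc θ t (w t)) x : ℂ))
      (fun t x => (realPhys (σ - κ) (mulOp (freqSym θ κ) (imPart (osc θ t (w t)))) x : ℂ)) ∧
    C1InH (σ - 2 * κ)
      (fun t x => (realPhys (σ - κ) (mulOp (freqSym θ κ) (imPart (osc θ t (w t)))) x : ℂ))
      (fun t x => (realPhys (σ - 2 * κ)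
        (waveAccel θ κ (symPart (osc θ t (w t))) (jop (-κ) (G t))) x : ℂ)) := by
  have hκ := hθ.order_nonneg
  have hf := hθ.bddSym le_rfl
  have hz : ContinuousOn (fun t => osc θ t (w t)) (Ici 0) :=
    continuousOn_osc_apply hθ.meas continuous_id fun t ht => (hw t ht).continuousWithinAt
  have hlift : ∀ t, 0 ≤ t → IsLift σ (fun x => (realPhys σ (osc θ t (w t)) x : ℂ))
      (symPart (osc θ t (w t))) := fun t _ => isLift_realPhys hd (by linarith) _
  have hlift' : ∀ t, 0 ≤ t → IsLift (σ - κ)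
      (fun x => (realPhys (σ - κ) (mulOp (freqSym θ κ) (imPart (osc θ t (w t)))) x : ℂ))
      (mulOp (freqSym θ κ) (imPart (osc θ t (w t)))) := fun t _ => by
    have h := isLift_realPhys hd (by linarith : 2 ≤ σ - κ)
      (mulOp (freqSym θ κ) (imPart (osc θ t (w t))))
    rwa [symPart_mulOp hf (hθ.freqSym_neg κ), symPart_eq_self (conjRefl_imPart _)] at h
  refine ⟨(contInH_iff hlift).2 (symPart.continuous.comp_continuousOn hz), ?_, ?_⟩
  · have h1 : ∀ t, 0 ≤ t → IsLift (σ - κ) (fun x => (realPhys σ (osc θ t (w t)) x : ℂ))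
        (jop (-κ) (symPart (osc θ t (w t)))) := fun t ht => by
      have h := (hlift t ht).lower (s := σ - κ) (by linarith)
      rwa [show σ - κ - σ = -κ by ring] at h
    refine (c1InH_iff h1 hlift').2 ⟨?_, fun t ht => (hθ.hasDerivWithinAt_parts (hGJ t ht)
      (hw t ht)).1⟩
    exact (mulOp (freqSym θ κ)).continuous.comp_continuousOn
      (imPart.continuous.comp_continuousOn hz)
  · have hjf : ∀ f : L2 d, jop (-κ) (mulOp (freqSym θ κ) f) = mulOp (freqSym θ κ) (jop (-κ) f) :=
      fun f => jop_mulOp (by linarith) hf f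
    have h1 : ∀ t, 0 ≤ t → IsLift (σ - 2 * κ)
        (fun x => (realPhys (σ - κ) (mulOp (freqSym θ κ) (imPart (osc θ t (w t)))) x : ℂ))
        (mulOp (freqSym θ κ) (jop (-κ) (imPart (osc θ t (w t))))) := fun t ht => by
      have h := (hlift' t ht).lower (s := σ - 2 * κ) (by linarith)
      rwa [show σ - 2 * κ - (σ - κ) = -κ by ring, hjf] at h
    have h2 : ∀ t, 0 ≤ t → IsLift (σ - 2 * κ) (fun x => (realPhys (σ - 2 * κ)
        (waveAccel θ κ (symPart (osc θ t (w t))) (jop (-κ) (G t))) x : ℂ))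
        (waveAccel θ κ (symPart (osc θ t (w t))) (jop (-κ) (G t))) := fun t ht => by
      have h := isLift_realPhys hd (by linarith : 2 ≤ σ - 2 * κ)
        (waveAccel θ κ (symPart (osc θ t (w t))) (jop (-κ) (G t)))
      rwa [symPart_eq_self (conjRefl_waveAccel hθ (conjRefl_symPart _) _)] at h
      rw [← jop_conjRefl (by linarith), hGJ t ht]
    refine (c1InH_iff h1 h2).2 ⟨?_, fun t ht => ?_⟩
    · have hG' := (jop (-κ)).continuous.comp_continuousOn hG
      have hz' := symPart.continuous.comp_continuousOn hz
      unfold waveAccel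
      exact (((mulOp (freqSym θ κ)).continuous.comp_continuousOn
        ((mulOp (freqSym θ κ)).continuous.comp_continuousOn hz')).add
        ((mulOp (freqSym θ κ)).continuous.comp_continuousOn hG')).neg
    · have h3 := hasDerivWithinAt_clm (mulOp (freqSym θ κ))
        (hθ.hasDerivWithinAt_parts (hGJ t ht) (hw t ht)).2
      refine h3.congr_deriv ?_
      rw [waveAccel, map_neg, map_add]

/-- The equation `i E_t + i ε² Δ² E_t = -F` is solved by the resolvent. -/
lemma phys_resolvent (hd : d ≤ 3) {ε : ℝ} (hε : ε ∈ Ioo (0 : ℝ) 1) {σ : ℝ} (hσ : 6 ≤ σ) (f : L2 d)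
    (x : Space d) : Complex.I * phys σ (mulOp (resSym ε) f) x +
      Complex.I * (ε : ℂ) ^ 2 * lap (lap (phys σ (mulOp (resSym ε) f))) x = -phys (σ - 4) f x := by
  have hl := bddSym_lapSym (d := d)
  have hr := bddSym_resSym (d := d) hε
  have hj := bddSym_jb (d := d) (by norm_num : (-4 : ℝ) ≤ 0)
  rw [lap_phys hd (by linarith), lap_phys hd (by linarith), show σ - 2 - 2 = σ - 4 by ring,
    ← phys_jop (σ := σ) (τ := σ - 4) (s := -4) (by norm_num) (by ring), ← phys_smul, ← phys_smul,
    ← phys_add hd (by linarith), ← phys_neg]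
  congr 1
  rw [← mulOp_const, ← mulOp_const, mulOp_mulOp hj hr, mulOp_mulOp hl hr,
    mulOp_mulOp hl (hl.mul hr), mulOp_mulOp (bddSym_const _) (hj.mul hr),
    mulOp_mulOp (bddSym_const _) (hl.mul (hl.mul hr)),
    ← mulOp_add_sym ((bddSym_const _).mul (hj.mul hr))
      ((bddSym_const _).mul (hl.mul (hl.mul hr))), ← neg_one_smul ℂ f, ← mulOp_const]
  congr 2
  funext ξ
  have h1 : (regSym ε ξ : ℂ) * (regSym ε ξ : ℂ)⁻¹ = 1 :=
    mul_inv_cancel₀ (Complex.ofReal_ne_zero.2 (regSym_pos ε ξ).ne')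
  have h2 := jb_mul_jb (-4) 4 ξ
  rw [neg_add_cancel, jb_zero, Complex.ofReal_one] at h2
  have h3 := jb_mul_jb (-2) (-2) ξ
  norm_num at h3
  have h4 : (regSym ε ξ : ℂ) = 1 + (ε : ℂ) ^ 2 * (wn ξ : ℂ) ^ 4 := by
    rw [regSym]; push_cast; ring
  rw [resSym, lapSym]
  push_cast
  linear_combination (-(regSym ε ξ : ℂ) * (regSym ε ξ : ℂ)⁻¹) * h2 - h1
    + (-(ε : ℂ) ^ 2 * (wn ξ : ℂ) ^ 4 * (regSym ε ξ : ℂ)⁻¹ * jb 4 ξ) * h3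
    + ((jb (-4) ξ : ℂ) * jb 4 ξ * (regSym ε ξ : ℂ)⁻¹) * h4
    + ((jb (-4) ξ : ℂ) + (ε : ℂ) ^ 2 * (wn ξ : ℂ) ^ 4 * (jb (-2) ξ : ℂ) ^ 2) *
      (regSym ε ξ : ℂ)⁻¹ * jb 4 ξ * Complex.I_sq

/-- The fields of the system determined by a curve of states at level `ρ`. -/
def stateFields (α ε ρ : ℝ) (w : ℝ → State d) : Fields d :=
  let z := fun t => osc wn t (w t).2.1
  let y := fun t i => osc magFreq t ((w t).2.2 i)
  { E := fun t => vecPhys (ρ + 1) (w t).1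
    Et := fun t => vecPhys (ρ + 1)
      (elec α ε ρ (w t).1 (symPart (z t)) (fun i => symPart (y t i)))
    n := fun t => realPhys ρ (z t)
    nt := fun t => realPhys (ρ - 1) (mulOp (freqSym wn 1) (imPart (z t)))
    ntt := fun t => realPhys (ρ - 2 * 1) (waveAccel wn 1 (symPart (z t))
      (jop (-1) (mulOp waveSym (dens (ρ + 1) (w t).1))))
    B := fun t => rePhys (ρ - 1) (y t)
    Bt := fun t => rePhys (ρ - 1 - 2) fun i => mulOp (freqSym magFreq 2) (imPart (y t i))
    Btt := fun t => rePhys (ρ - 1 - 2 * 2) fun i => waveAccel magFreq 2 (symPart (y t i))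
      (jop (-2) (mulOp magSym (mag (ρ + 1) (w t).1 i))) }

lemma vecPhys_eq_zero {σ : ℝ} {e : Vec d} {i : Fin 3} (h : e i = 0) (x : Space d) :
    vecPhys σ e x i = 0 := by
  rw [vecPhys, h, phys_zero]

lemma ofReal_waveAccel (hd : d ≤ 3) {θ : Space d → ℝ} {κ : ℝ} (hθ : Dispersion θ κ) {σ : ℝ}
    (hσ : 2 ≤ σ) {p G : L2 d} (hp : conjRefl p = p) (hG : conjRefl G = G) (x : Space d) :
    (realPhys σ (waveAccel θ κ p (jop (-κ) G)) x : ℂ) =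
      phys σ (waveAccel θ κ p (jop (-κ) G)) x := by
  have h := congrFun (ofReal_realPhys hd hσ (waveAccel θ κ p (jop (-κ) G))) x
  rwa [symPart_eq_self (conjRefl_waveAccel hθ hp _)] at h
  rw [← jop_conjRefl (by linarith [hθ.order_nonneg]), hG]

/-- A global solution of the evolution equation of states with the right initial values gives a
solution of the system. -/
lemma stateFields_solves (hd : d ≤ 3) (α : ℝ) {ε r : ℝ} (hε : ε ∈ Ioo (0 : ℝ) 1) (hr : 20 ≤ r)
    {D : Data d} {w : ℝ → State d}
    (hplanar : d = 2 → ∀ t, 0 ≤ t → (w t).1 2 = 0 ∧ (w t).2.2 0 = 0 ∧ (w t).2.2 1 = 0)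
    {e₀ b₀ c₀ : Vec d} {p₀ q₀ : L2 d}
    (h0 : w 0 = (e₀, p₀ + Complex.I • q₀, fun i => b₀ i + Complex.I • c₀ i))
    (he : ∀ i, IsLift (r + 1) (fun x => D.E₀ x i) (e₀ i))
    (hp : IsLift r (fun x => (D.n₀ x : ℂ)) p₀) (hqJ : conjRefl q₀ = q₀)
    (hq : IsLift (r - 1) (fun x => (D.n₁ x : ℂ)) (mulOp (freqSym wn 1) q₀))
    (hb : ∀ i, IsLift (r - 1) (fun x => (D.B₀ x i : ℂ)) (b₀ i))
    (hcJ : ∀ i, conjRefl (c₀ i) = c₀ i)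
    (hc : ∀ i, IsLift (r - 1 - 2) (fun x => (D.B₁ x i : ℂ)) (mulOp (freqSym magFreq 2) (c₀ i))) :
    (stateFields α ε r w).Solves α ε D := by
  have hpJ := hp.conjRefl_eq hd (by linarith)
  have hbJ := fun i => (hb i).conjRefl_eq hd (by linarith)
  have reEq : ∀ {σ : ℝ} {f : L2 d} {g : Space d → ℝ}, 2 ≤ σ → conjRefl f = f →
      IsLift σ (fun x => (g x : ℂ)) f → realPhys σ f =ᵐ[volume] g := by
    intro σ f g hσ _ hg
    filter_upwards [hg.phys_ae hd hσ] with x hx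
    rw [realPhys, hx, Complex.ofReal_re]
  constructor
  case smoothE => exact fun t _ => contDiff_vecPhys hd 4 (by norm_num; linarith) _
  case smoothEt => exact fun t _ => contDiff_vecPhys hd 4 (by norm_num; linarith) _
  case smoothn => exact fun t _ => contDiff_realPhys hd 2 (by norm_num; linarith) _
  case contnt =>
    exact fun t _ => (contDiff_realPhys hd 0 (by norm_num; linarith) _).continuous
  case smoothB =>
    exact fun t _ => contDiff_pi.2 fun i => contDiff_realPhys hd 4 (by norm_num; linarith) _
  case contBt =>
    exact fun t _ => continuous_pi fun i =>
      (contDiff_realPhys hd 0 (by norm_num; linarith) _).continuous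
  case planar =>
    intro t ht x h2
    obtain ⟨h3, h4, h5⟩ := hplanar h2 t ht
    refine ⟨vecPhys_eq_zero h3 x, ?_, ?_⟩
    · simp only [stateFields, rePhys, h4, map_zero, phys_zero, Complex.zero_re]
    · simp only [stateFields, rePhys, h5, map_zero, phys_zero, Complex.zero_re]
  case eqE =>
    intro t _ x
    funext i
    have hF := phys_elecForce hd α (by linarith : 5 ≤ r) (w t).1 (osc wn t (w t).2.1)
      (fun i => osc magFreq t ((w t).2.2 i)) x i
    have hR := phys_resolvent hd hε (by linarith : 6 ≤ r + 1) (elecForce α r (w t).1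
      (symPart (osc wn t (w t).2.1)) (fun i => symPart (osc magFreq t ((w t).2.2 i))) i) x
    have hLL : lap (lap ((stateFields α ε r w).Et t)) x i =
        lap (lap (phys (r + 1) (elec α ε r (w t).1 (symPart (osc wn t (w t).2.1))
          (fun i => symPart (osc magFreq t ((w t).2.2 i))) i))) x := by
      simp only [stateFields]
      rw [lap_vecPhys hd (by linarith : 4 ≤ r + 1), lap_vecPhys hd (by linarith),
        lap_phys hd (by linarith), lap_phys hd (by linarith)]
      rfl
    have h4 : r + 1 - 4 = r - 3 := by ring
    rw [h4, hF] at hR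
    simp only [Pi.add_apply, Pi.sub_apply, Pi.smul_apply, smul_eq_mul, Pi.zero_apply, hLL]
    change Complex.I * phys (r + 1) (mulOp (resSym ε) _) x + Complex.I * (ε : ℂ) ^ 2 *
      lap (lap (phys (r + 1) (mulOp (resSym ε) _))) x + _ - _ - _ + _ = 0
    rw [hR]
    simp only [stateFields, realPhys]
    ring
  case eqn =>
    intro t _ x
    refine Complex.ofReal_injective ?_
    have hn : ContDiff ℝ 2 (realPhys r (osc wn t (w t).2.1)) :=
      contDiff_realPhys hd 2 (by norm_num; linarith) _
    have hS : (fun x => (normSq (vecPhys (r + 1) (w t).1) x : ℂ)) =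
        phys (r + 1) (dens (r + 1) (w t).1) :=
      funext fun x => (phys_dens hd (by linarith) _ x).symm
    have hS2 : ContDiff ℝ 2 (normSq (vecPhys (r + 1) (w t).1)) := by
      have h1 : normSq (vecPhys (r + 1) (w t).1) =
          realPhys (r + 1) (dens (r + 1) (w t).1) := by
        funext x
        rw [realPhys, phys_dens hd (by linarith), Complex.ofReal_re]
      rw [h1]
      exact contDiff_realPhys hd 2 (by norm_num; linarith) _
    rw [Complex.ofReal_sub]
    simp only [stateFields]
    rw [ofReal_lap hn, ofReal_lap hS2, hS, ofReal_realPhys hd (by linarith),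
      ofReal_waveAccel hd dispersion_wn (by linarith) (conjRefl_symPart _)
        (conjRefl_waveForce hd (by linarith) _), mul_one,
      phys_waveAccel_wn hd (by linarith)]
    ring
  case eqB =>
    intro t _ x
    funext i
    have hB : complexify ((stateFields α ε r w).B t) =
        vecPhys (r - 1) (fun i => symPart (osc magFreq t ((w t).2.2 i))) :=
      complexify_rePhys hd (by linarith) _
    have hC : crossConj ((stateFields α ε r w).E t) = vecPhys (r + 1) (mag (r + 1) (w t).1) :=
      crossConj_vecPhys hd (by linarith) _
    have hT : complexify ((stateFields α ε r w).Btt t) x i =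
        phys (r - 1 - 4) (waveAccel magFreq 2 (symPart (osc magFreq t ((w t).2.2 i)))
          (jop (-2) (mulOp magSym (mag (r + 1) (w t).1 i)))) x := by
      have h := ofReal_waveAccel hd dispersion_magFreq (by linarith : 2 ≤ r - 1 - 2 * 2)
        (conjRefl_symPart (osc magFreq t ((w t).2.2 i)))
        (conjRefl_magForce hd (by linarith : 2 ≤ r + 1) (w t).1 i) x
      rw [show r - 1 - 4 = r - 1 - 2 * 2 by ring]
      exact h
    rw [hB, hC, lap_vecPhys hd (by linarith), lap_vecPhys hd (by linarith),
      lap_vecPhys hd (by linarith), lap_vecPhys hd (by linarith)]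
    simp only [Pi.add_apply, Pi.sub_apply, Pi.smul_apply, smul_eq_mul, hT]
    rw [phys_waveAccel_magFreq hd (by linarith), lap_phys hd (by linarith),
      lap_phys hd (by linarith), show r - 1 + 2 = r + 1 by ring, lap_phys hd (by linarith),
      lap_phys hd (by linarith)]
    simp only [vecPhys]
    ring
  case initE =>
    have h1 : ∀ᵐ x, ∀ i, phys (r + 1) (e₀ i) x = D.E₀ x i :=
      ae_all_iff.2 fun i => (he i).phys_ae hd (by linarith)
    filter_upwards [h1] with x hx
    funext i
    simp only [stateFields, h0]
    exact hx i
  case initn =>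
    have h1 := reEq (by linarith) hpJ hp
    filter_upwards [h1] with x hx
    rw [← hx]
    simp only [stateFields, h0, osc_zero, realPhys]
    rw [← Complex.ofReal_re (phys r (p₀ + Complex.I • q₀) x).re, ← phys_symPart hd (by linarith),
      symPart_add_I hpJ hqJ]
  case initnt =>
    have hqJ' : conjRefl (mulOp (freqSym wn 1) q₀) = mulOp (freqSym wn 1) q₀ :=
      hq.conjRefl_eq hd (by linarith)
    have h1 := reEq (by linarith) hqJ' hq
    filter_upwards [h1] with x hx
    rw [← hx]
    simp only [stateFields, h0, osc_zero]
    rw [imPart_add_I hpJ hqJ]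
  case initB =>
    have h1 : ∀ᵐ x, ∀ i, realPhys (r - 1) (b₀ i) x = D.B₀ x i :=
      ae_all_iff.2 fun i => reEq (by linarith) (hbJ i) (hb i)
    filter_upwards [h1] with x hx
    funext i
    rw [← hx i]
    simp only [stateFields, h0, osc_zero, rePhys, realPhys]
    rw [← Complex.ofReal_re (phys (r - 1) (b₀ i + Complex.I • c₀ i) x).re,
      ← phys_symPart hd (by linarith), symPart_add_I (hbJ i) (hcJ i)]
  case initBt =>
    have h1 : ∀ᵐ x, ∀ i, realPhys (r - 1 - 2) (mulOp (freqSym magFreq 2) (c₀ i)) x = D.B₁ x i :=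
      ae_all_iff.2 fun i =>
        reEq (by linarith) ((hc i).conjRefl_eq hd (by linarith)) (hc i)
    filter_upwards [h1] with x hx
    funext i
    rw [← hx i]
    simp only [stateFields, h0, osc_zero, rePhys, realPhys]
    rw [imPart_add_I (hbJ i) (hcJ i)]

/-- The initial values of the wave components are `n₀ + i q₀` and `B₀ + i c₀`, where `n₁` and `B₁` are
the frequencies `wn` and `magFreq` applied to `q₀` and `c₀`. -/
theorem exists_solution (hd : d ≤ 3) (hd0 : 0 < d) (α : ℝ) {ε r : ℝ} (hε : ε ∈ Ioo (0 : ℝ) 1)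
    (hr : 20 ≤ r) {D : Data d} (hD : D.Admissible r) :
    ∃ u : Fields d, u.Solves α ε D ∧ u.InClass r ∧
      u.TimeRegular (r + 1) (r - 1) (r - 2) (r - 3) (r - 5) := by
  choose e₀ he using fun i => (hD.memE₀ i).exists_isLift
  obtain ⟨p₀, hp⟩ := hD.memn₀.exists_isLift
  obtain ⟨q₀, hqJ, hq⟩ := dispersion_wn.exists_div hd hd0 (σ := r) (by linarith) le_rfl hD.memn₁
    hD.memn₁'
  choose b₀ hb using fun i => (hD.memB₀ i).exists_isLift
  have hB₁ : ∀ i, MemH (r - 1 - 2) (fun x => (D.B₁ x i : ℂ)) := fun i => by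
    have h := hD.memB₁ i
    rwa [show r - 3 = r - 1 - 2 by ring] at h
  choose c₀ hcJ hc using fun i => dispersion_magFreq.exists_div hd hd0 (σ := r - 1)
    (by linarith) (by norm_num) (hB₁ i) (hD.memB₁' i)
  obtain ⟨w, h0, hw⟩ := exists_state hd α hε (by linarith : 5 ≤ r)
    ((e₀, p₀ + Complex.I • q₀, fun i => b₀ i + Complex.I • c₀ i) : State d)
  have hplanar : d = 2 → ∀ t, 0 ≤ t → (w t).1 2 = 0 ∧ (w t).2.2 0 = 0 ∧ (w t).2.2 1 = 0 := by
    intro h2 t ht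
    subst h2
    have hE : e₀ 2 = 0 := (he 2).eq_zero (by
      filter_upwards [hD.planar₀] with x hx using (hx rfl).1)
    have hbz : ∀ i : Fin 3, i ≠ 2 → b₀ i = 0 := fun i hi => (hb i).eq_zero (by
      filter_upwards [hD.planar₀] with x hx
      have h := (hx rfl).2
      fin_cases i
      · simp [h.1]
      · simp [h.2]
      · exact absurd rfl hi)
    have hcz : ∀ i : Fin 3, i ≠ 2 → c₀ i = 0 := fun i hi => by
      have h1 : mulOp (freqSym magFreq 2) (c₀ i) = 0 := (hc i).eq_zero (by
        filter_upwards [hD.planar₁] with x hx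
        have h := (hx rfl).2
        fin_cases i
        · simp [h.1]
        · simp [h.2]
        · exact absurd rfl hi)
      have hinj := dispersion_magFreq.injective hd0
      exact hinj (by rw [h1, map_zero])
    refine state_planar hw ?_ ?_ ?_ ht
    · rw [h0]; exact hE
    · rw [h0]
      simp only [hbz 0 (by decide), hcz 0 (by decide), smul_zero, add_zero]
    · rw [h0]
      simp only [hbz 1 (by decide), hcz 1 (by decide), smul_zero, add_zero]
  have hcont : ContinuousOn w (Ici 0) := fun t ht => (hw t ht).continuousWithinAt
  have hcE : ContinuousOn (fun t => (w t).1) (Ici 0) := continuous_fst.comp_continuousOn hcont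
  have hregn := dispersion_wn.regularity hd (σ := r) (by linarith) (w := fun t => (w t).2.1)
    (G := fun t => mulOp waveSym (dens (r + 1) (w t).1))
    ((mulOp waveSym).continuous.comp_continuousOn ((continuous_dens _).comp_continuousOn hcE))
    (fun t _ => conjRefl_waveForce hd (by linarith) _)
    (fun t ht => hasDerivWithinAt_clm stateZ (hw t ht))
  have hregB := fun i => dispersion_magFreq.regularity hd (σ := r - 1) (by linarith)
    (w := fun t => (w t).2.2 i) (G := fun t => mulOp magSym (mag (r + 1) (w t).1 i))
    ((mulOp magSym).continuous.comp_continuousOn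
      (((continuous_apply i).comp (continuous_mag _)).comp_continuousOn hcE))
    (fun t _ => conjRefl_magForce hd (by linarith) _ i)
    (fun t ht => hasDerivWithinAt_clm (stateY i) (hw t ht))
  have hcEi : ∀ i, ContinuousOn (fun t => (w t).1 i) (Ici 0) := fun i =>
    (continuous_apply i).comp_continuousOn hcE
  refine ⟨stateFields α ε r w, stateFields_solves hd α hε hr hplanar h0 he hp hqJ hq hb hcJ hc,
    ⟨fun i => ?_, hregn.1, fun i => (hregB i).1⟩, 
      ⟨fun i => ?_, hregn.2.1, ?_, fun i => ?_, fun i => ?_⟩⟩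
  · exact (contInH_iff fun t _ => isLift_vecPhys hd (by linarith) (w t).1 i).2 (hcEi i)
  · refine (c1InH_iff (fun t _ => isLift_vecPhys hd (by linarith) (w t).1 i)
      (fun t _ => isLift_vecPhys hd (by linarith) _ i)).2
      ⟨?_, fun t ht => hasDerivWithinAt_clm (stateE i) (hw t ht)⟩
    refine (continuous_apply i).comp_continuousOn (continuousOn_elec α ε r hcE ?_ ?_)
    · exact symPart.continuous.comp_continuousOn (continuousOn_osc_apply measurable_wn
        continuous_id (stateZ.continuous.comp_continuousOn hcont))
    · exact continuousOn_pi.2 fun j => symPart.continuous.comp_continuousOn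
        (continuousOn_osc_apply measurable_magFreq continuous_id
          ((stateY j).continuous.comp_continuousOn hcont))
  · rw [show r - 2 = r - 2 * 1 by ring]
    exact hregn.2.2
  · rw [show r - 3 = r - 1 - 2 by ring]
    exact (hregB i).2.1
  · rw [show r - 5 = r - 1 - 2 * 2 by ring]
    exact (hregB i).2.2

/-! ### The classical Laplacian as a Fourier multiplier -/

lemma lap_eq_sum {f : Space d → ℂ} (hf : ContDiff ℝ 2 f) (x : Space d) :
    lap f x = ∑ i, fderiv ℝ (fun y => fderiv ℝ f y (EuclideanSpace.basisFun (Fin d) ℝ i)) x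
      (EuclideanSpace.basisFun (Fin d) ℝ i) := by
  unfold lap
  rw [InnerProductSpace.laplacian_eq_iteratedFDeriv_orthonormalBasis _
    (EuclideanSpace.basisFun (Fin d) ℝ)]
  have h1 : Differentiable ℝ (fderiv ℝ f) :=
    (hf.fderiv_right (m := 1) (by norm_num)).differentiable (by norm_num)
  refine Finset.sum_congr rfl fun i _ => ?_
  rw [iteratedFDeriv_two_apply, fderiv_clm_apply (h1 x) (differentiableAt_const _)]
  simp

/-- Green's identity with a test function. -/
lemma integral_mul_lap {φ u : Space d → ℂ} (hφ : ContDiff ℝ 2 φ) (hc : HasCompactSupport φ)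
    (hu : ContDiff ℝ 2 u) : ∫ x, φ x * lap u x = ∫ x, lap φ x * u x := by
  have hd1 : ∀ {f : Space d → ℂ}, ContDiff ℝ 2 f → ∀ v, ContDiff ℝ 1 fun y => fderiv ℝ f y v :=
    fun hf v => (hf.fderiv_right (m := 1) (by norm_num)).clm_apply contDiff_const
  have hd2 : ∀ {f : Space d → ℂ}, ContDiff ℝ 2 f → ∀ v,
      Continuous fun x => fderiv ℝ (fun y => fderiv ℝ f y v) x v := fun hf v =>
    ((hd1 hf v).continuous_fderiv (by norm_num)).clm_apply continuous_const
  have hc1 : ∀ v, HasCompactSupport fun y => fderiv ℝ φ y v := fun v =>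
    hc.fderiv_apply (𝕜 := ℝ) v
  have hc2 : ∀ v, HasCompactSupport fun x => fderiv ℝ (fun y => fderiv ℝ φ y v) x v := fun v =>
    (hc1 v).fderiv_apply (𝕜 := ℝ) v
  have hint : ∀ {f g : Space d → ℂ}, Continuous f → HasCompactSupport f → Continuous g →
      Integrable (fun x => f x * g x) volume := fun hf hcf hg =>
    (hf.mul hg).integrable_of_hasCompactSupport hcf.mul_right
  have key : ∀ v, ∫ x, φ x * fderiv ℝ (fun y => fderiv ℝ u y v) x v =
      ∫ x, fderiv ℝ (fun y => fderiv ℝ φ y v) x v * u x := by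
    intro v
    rw [integral_mul_fderiv_eq_neg_fderiv_mul_of_integrable
        (hint (hd1 hφ v).continuous (hc1 v) (hd1 hu v).continuous)
        (hint hφ.continuous hc (hd2 hu v)) (hint hφ.continuous hc (hd1 hu v).continuous)
        (fun x _ => (hφ.differentiable (by norm_num)) x)
        (fun x _ => ((hd1 hu v).differentiable (by norm_num)) x),
      integral_mul_fderiv_eq_neg_fderiv_mul_of_integrable
        (hint (hd2 hφ v) (hc2 v) hu.continuous)
        (hint (hd1 hφ v).continuous (hc1 v) (hd1 hu v).continuous)
        (hint (hd1 hφ v).continuous (hc1 v) hu.continuous)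
        (fun x _ => ((hd1 hφ v).differentiable (by norm_num)) x)
        (fun x _ => (hu.differentiable (by norm_num)) x), neg_neg]
  simp only [lap_eq_sum hφ, lap_eq_sum hu, Finset.mul_sum, Finset.sum_mul]
  rw [integral_finsetSum _ fun i _ => hint hφ.continuous hc (hd2 hu _),
    integral_finsetSum _ fun i _ => hint (hd2 hφ _) (hc2 _) hu.continuous]
  exact Finset.sum_congr rfl fun i _ => key _

lemma memH_of_testFunction {φ : Space d → ℂ} (hφ : ContDiff ℝ (↑(⊤ : ℕ∞)) φ)
    (hc : HasCompactSupport φ) (s : ℝ) : MemH s φ := by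
  let ψ := hc.toSchwartzMap hφ
  have hL : MemLp φ 2 volume := ψ.memLp 2 volume
  have h1 : hL.toLp φ = ψ.toLp 2 := rfl
  unfold MemH sobolevNorm
  rw [dif_pos hL, h1, SchwartzMap.toLp_fourier_eq]
  have hg := Function.hasTemperateGrowth_one_add_norm_sq_rpow (Space d) (s / 2)
  let χ := SchwartzMap.smulLeftCLM ℂ (fun x : Space d => (1 + ‖x‖ ^ 2) ^ (s / 2)) (𝓕 ψ)
  refine lt_of_le_of_lt (le_of_eq (eLpNorm_congr_ae ?_)) (χ.memLp 2 volume).2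
  filter_upwards [(𝓕 ψ).coeFn_toLp 2 volume] with ξ hξ
  rw [hξ, SchwartzMap.smulLeftCLM_apply_apply hg]

lemma contDiff_lap {f : Space d → ℂ} {k : ℕ} (hf : ContDiff ℝ (k + 2 : ℕ) f) :
    ContDiff ℝ k (lap f) := by
  have h2 : ContDiff ℝ 2 f := hf.of_le (by exact_mod_cast Nat.le_add_left 2 k)
  have h : lap f = fun x => ∑ i, fderiv ℝ (fun y => fderiv ℝ f y
      (EuclideanSpace.basisFun (Fin d) ℝ i)) x (EuclideanSpace.basisFun (Fin d) ℝ i) :=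
    funext fun x => lap_eq_sum h2 x
  rw [h]
  refine ContDiff.sum fun i _ => ?_
  have h3 : ContDiff ℝ (k + 1 : ℕ) fun y => fderiv ℝ f y (EuclideanSpace.basisFun (Fin d) ℝ i) :=
    (hf.fderiv_right (m := (k + 1 : ℕ)) (by norm_cast)).clm_apply contDiff_const
  exact (h3.fderiv_right (m := k) (by norm_cast)).clm_apply contDiff_const

/-- If a `C²` function lies in `H²`, then its classical Laplacian is in `L²` and has the transform
expected. The point is that nothing is known in advance about the size of the classical
derivatives. -/
lemma isLift_lap (hd : d ≤ 3) {u : Space d → ℂ} (hu : ContDiff ℝ 2 u) {g : L2 d}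
    (hg : IsLift 2 u g) : IsLift 0 (lap u) (mulOp lapSym g) := by
  have hl := bddSym_lapSym (d := d)
  have hrep0 : ∀ F : L2 d, rep 0 F =ᵐ[volume] F := fun F => by
    refine Eventually.of_forall fun ξ => ?_
    rw [rep, neg_zero, jb_zero, Complex.ofReal_one, one_mul]
  let F : L2 d := 𝓕⁻ (mulOp lapSym g)
  have hFF : (𝓕 F : L2 d) = mulOp lapSym g := FourierTransform.fourier_fourierInv_eq _
  have hlapc : Continuous (lap u) := by
    have h := contDiff_lap (k := 0) (f := u) (by exact_mod_cast hu)
    exact h.continuous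
  -- both functions have the same integrals against real test functions
  have hpair : ∀ φ : Space d → ℝ, ContDiff ℝ (↑(⊤ : ℕ∞)) φ → HasCompactSupport φ →
      ∫ x, φ x • (lap u x - F x) = 0 := by
    intro φ hφ hc
    let ψ : Space d → ℂ := fun x => (φ x : ℂ)
    have hψ : ContDiff ℝ (↑(⊤ : ℕ∞)) ψ := Complex.ofRealCLM.contDiff.comp hφ
    have hψ2 : ContDiff ℝ 2 ψ := hψ.of_le (by norm_cast)
    have hψc : HasCompactSupport ψ := hc.comp_left (g := fun t : ℝ => (t : ℂ)) Complex.ofReal_zero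
    obtain ⟨f, hf⟩ := (memH_of_testFunction hψ hψc 4).exists_isLift
    have hψf : phys 4 f = ψ := hf.phys_eq hd (by norm_num) hψ.continuous
    have hψL : MemLp ψ 2 volume := hf.1
    have hreal : ∀ x, star (lap ψ x) = lap ψ x := by
      intro x
      have h := ofReal_lap (f := φ) (hφ.of_le (by norm_cast)) x
      change star (lap (fun y => (φ y : ℂ)) x) = lap (fun y => (φ y : ℂ)) x
      rw [← h, RCLike.star_def, Complex.conj_ofReal]
    have h1 : ∫ x, ψ x * lap u x = ∫ ξ, star (rep 2 (mulOp lapSym f) ξ) * rep 2 g ξ := by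
      rw [integral_mul_lap hψ2 hψc hu, integral_rep_mul hd le_rfl le_rfl]
      refine integral_congr_ae ?_
      filter_upwards [hg.phys_ae hd le_rfl] with x hx
      have h2 := lap_phys hd (le_refl 4) f
      rw [show (4 : ℝ) - 2 = 2 by norm_num, hψf] at h2
      rw [← h2, hreal, hx]
    have h2 : ∫ x, ψ x * F x = ∫ ξ, star (rep 2 (mulOp lapSym f) ξ) * rep 2 g ξ := by
      have h3 : inner ℂ (hψL.toLp ψ) F = (inner ℂ (𝓕 (hψL.toLp ψ) : L2 d) (𝓕 F) : ℂ) :=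
        ((Lp.fourierTransformₗᵢ (Space d) ℂ).inner_map_map _ _).symm
      rw [hFF, L2.inner_def, L2.inner_def] at h3
      have h4 : ∫ x, ψ x * F x = ∫ x, inner ℂ ((hψL.toLp ψ) x) (F x) := by
        refine integral_congr_ae ?_
        filter_upwards [hψL.coeFn_toLp] with x hx
        rw [hx, RCLike.inner_apply, Complex.conj_ofReal, mul_comm]
      rw [h4, h3]
      refine integral_congr_ae ?_
      filter_upwards [hf.2, mulOp_ae hl g, rep_mulOp 2 hl f] with ξ e1 e2 e3
      rw [← e1, e2, e3, RCLike.inner_apply, rep, rep, rep, RCLike.star_def, map_mul, map_mul,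
        map_mul, Complex.conj_ofReal, Complex.conj_ofReal]
      have h5 := jb_mul_jb (-2) (-2) ξ
      norm_num at h5
      have h6 : (starRingEnd ℂ) (lapSym ξ) = lapSym ξ := by
        rw [lapSym, map_mul, map_neg, map_pow, Complex.conj_ofReal, Complex.conj_ofReal]
      rw [h6, ← h5]
      ring
    have hi1 : Integrable (fun x => ψ x * lap u x) volume :=
      (hψ.continuous.mul hlapc).integrable_of_hasCompactSupport hψc.mul_right
    have hi2 : Integrable (fun x => ψ x * F x) volume := hψL.integrable_mul (Lp.memLp F)
    have h7 : ∀ x, φ x • (lap u x - F x) = ψ x * lap u x - ψ x * F x := fun x => by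
      rw [Complex.real_smul, mul_sub]
    simp only [h7]
    rw [integral_sub hi1 hi2, h1, h2, sub_self]
  have hloc : LocallyIntegrable (fun x => lap u x - F x) volume :=
    hlapc.locallyIntegrable.sub ((Lp.memLp F).locallyIntegrable one_le_two)
  have hae : ∀ᵐ x, lap u x - F x = 0 := ae_eq_zero_of_integral_contDiff_smul_eq_zero hloc hpair
  have hae' : lap u =ᵐ[volume] F := by
    filter_upwards [hae] with x hx using sub_eq_zero.1 hx
  have hm : MemLp (lap u) 2 volume := (memLp_congr_ae hae').2 (Lp.memLp F)
  refine ⟨hm, ?_⟩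
  have h8 : hm.toLp (lap u) = F := by
    rw [← Lp.toLp_coeFn F (Lp.memLp F), MemLp.toLp_eq_toLp_iff]
    exact hae'
  rw [h8, hFF]
  exact hrep0 _

/-! ### Classical solutions give curves of states -/

/-- The operator `1 + ε² Δ²` is injective, and `resSym` inverts it. -/
lemma eq_mulOp_resSym {ε : ℝ} (hε : ε ∈ Ioo (0 : ℝ) 1) {f g : L2 d}
    (h : jop (-4) f - (-ε ^ 2 : ℝ) • mulOp lapSym (mulOp lapSym f) = Complex.I • g) :
    f = mulOp (resSym ε) g := by
  have hl := bddSym_lapSym (d := d)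
  have hr := bddSym_resSym (d := d) hε
  have hj := bddSym_jb (d := d) (by norm_num : (-4 : ℝ) ≤ 0)
  have hc := fun c : ℂ => bddSym_const (d := d) c
  have hg : g = -Complex.I •
      (jop (-4) f + ((ε ^ 2 : ℝ) : ℂ) • mulOp lapSym (mulOp lapSym f)) := by
    rw [← real_smul_eq, ← sub_neg_eq_add, ← neg_smul, h, smul_smul, neg_mul, Complex.I_mul_I,
      neg_neg, one_smul]
  rw [hg, ← mulOp_const, ← mulOp_const, mulOp_mulOp hl hl, mulOp_mulOp (hc _) (hl.mul hl),
    ← mulOp_add_sym hj ((hc _).mul (hl.mul hl)),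
    mulOp_mulOp (hc _) (hj.add ((hc _).mul (hl.mul hl))),
    mulOp_mulOp hr ((hc _).mul (hj.add ((hc _).mul (hl.mul hl))))]
  refine (mulOp_eq_self ?_ f).symm
  intro ξ
  have h1 : (regSym ε ξ : ℂ) * (regSym ε ξ : ℂ)⁻¹ = 1 :=
    mul_inv_cancel₀ (Complex.ofReal_ne_zero.2 (regSym_pos ε ξ).ne')
  have h2 := jb_mul_jb (-4) 4 ξ
  rw [neg_add_cancel, jb_zero, Complex.ofReal_one] at h2
  have h3 := jb_mul_jb (-2) (-2) ξ
  norm_num at h3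
  have h4 : (regSym ε ξ : ℂ) = 1 + (ε : ℂ) ^ 2 * (wn ξ : ℂ) ^ 4 := by
    rw [regSym]; push_cast; ring
  rw [resSym, lapSym]
  push_cast
  linear_combination ((regSym ε ξ : ℂ) * (regSym ε ξ : ℂ)⁻¹) * h2 + h1
    + ((ε : ℂ) ^ 2 * (wn ξ : ℂ) ^ 4 * (regSym ε ξ : ℂ)⁻¹ * jb 4 ξ) * h3
    - ((jb (-4) ξ : ℂ) * jb 4 ξ * (regSym ε ξ : ℂ)⁻¹) * h4
    - ((jb (-4) ξ : ℂ) + (ε : ℂ) ^ 2 * (wn ξ : ℂ) ^ 4 * (jb (-2) ξ : ℂ) ^ 2) *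
      (regSym ε ξ : ℂ)⁻¹ * jb 4 ξ * Complex.I_sq

lemma jop_dens (hd : d ≤ 3) {σ τ s : ℝ} (hs : s ≤ 0) (h : τ = σ + s) (hτ : 2 ≤ τ) (e : Vec d) :
    jop s (dens σ e) = dens τ (fun i => jop s (e i)) := by
  refine phys_injective hd hτ (funext fun x => ?_)
  rw [phys_jop hs h, phys_dens hd (by linarith), phys_dens hd hτ]
  simp only [normSq, vecPhys, phys_jop hs h]

lemma jop_mag (hd : d ≤ 3) {σ τ s : ℝ} (hs : s ≤ 0) (h : τ = σ + s) (hτ : 2 ≤ τ) (e : Vec d)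
    (i : Fin 3) : jop s (mag σ e i) = mag τ (fun i => jop s (e i)) i := by
  refine phys_injective hd hτ (funext fun x => ?_)
  rw [phys_jop hs h, phys_mag hd (by linarith), phys_mag hd hτ]
  have h1 : vecPhys τ (fun i => jop s (e i)) = vecPhys σ e := by
    funext x i
    simp only [vecPhys, phys_jop hs h]
  rw [h1]

/-- The time derivative of the electric field of a solution. It is only known to lie in `H⁴`
beforehand; the equation determines it as an element of the space of the electric field. -/
lemma Fields.Solves.hasDerivWithinAt_elec (hd : d ≤ 3) {α ε ρ : ℝ} (hε : ε ∈ Ioo (0 : ℝ) 1)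
    (hρ : 5 ≤ ρ) {D : Data d} {u : Fields d} (hu : u.Solves α ε D)
    (hE : ∀ i, C1InH 4 (fun t x => u.E t x i) (fun t x => u.Et t x i))
    {e b : ℝ → Vec d} {p : ℝ → L2 d} (hec : ContinuousOn e (Ici 0))
    (hpc : ContinuousOn p (Ici 0)) (hbc : ContinuousOn b (Ici 0))
    (he : ∀ t, 0 ≤ t → ∀ i, IsLift (ρ + 1) (fun x => u.E t x i) (e t i))
    (hp : ∀ t, 0 ≤ t → IsLift ρ (fun x => (u.n t x : ℂ)) (p t))
    (hb : ∀ t, 0 ≤ t → ∀ i, IsLift (ρ - 1) (fun x => (u.B t x i : ℂ)) (b t i)) :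
    ∀ t, 0 ≤ t → HasDerivWithinAt e (elec α ε ρ (e t) (p t) (b t)) (Ici 0) t := by
  have hcont := continuousOn_elec α ε ρ hec hpc hbc
  suffices h : ∀ i t, 0 ≤ t → HasDerivWithinAt (fun τ => e τ i)
      (elec α ε ρ (e t) (p t) (b t) i) (Ici 0) t from
    fun t ht => hasDerivWithinAt_pi.2 fun i => h i t ht
  intro i
  have hs : 4 - (ρ + 1) ≤ 0 := by linarith
  refine hasDerivWithinAt_of_injective (jop (4 - (ρ + 1))) (jop_injective hs)
    ((continuous_apply i).comp_continuousOn hcont) ?_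
  obtain ⟨f, hf, -⟩ := (hE i).2.1.exists_lift
  have hder := ((c1InH_iff (fun t ht => (he t ht i).lower (by linarith : 4 ≤ ρ + 1)) hf).1
    (hE i)).2
  intro t ht
  refine (hder t ht).congr_deriv ?_
  rw [elec, jop_mulOp hs (bddSym_resSym hε)]
  refine eq_mulOp_resSym hε ?_
  have hsm : ContDiff ℝ (4 : ℕ) (u.Et t) := by exact_mod_cast hu.smoothEt t ht
  have hEtc : ContDiff ℝ (4 : ℕ) (fun x => u.Et t x i) := contDiff_pi.1 hsm i
  have hEt := (hf t ht).phys_eq hd (by norm_num) hEtc.continuous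
  -- `Et ∈ H⁴` gives the first Laplacian as a continuous function in `H²`; the second one is only
  -- given as a classical derivative of that function
  have hlap : lap (fun x => u.Et t x i) = phys 2 (mulOp lapSym (f t)) := by
    rw [← hEt, lap_phys hd le_rfl]
    norm_num
  have hlift1 : IsLift 2 (lap fun x => u.Et t x i) (mulOp lapSym (f t)) := by
    have h := isLift_phys hd le_rfl le_rfl (mulOp lapSym (f t))
    rwa [sub_self, jop_zero, ← hlap] at h
  have hlapc : ContDiff ℝ (2 : ℕ) (lap fun x => u.Et t x i) := contDiff_lap hEtc
  have hlift2 := isLift_lap hd (by exact_mod_cast hlapc) hlift1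
  have hlift0 := (hf t ht).lower (by norm_num : (0 : ℝ) ≤ 4)
  rw [zero_sub] at hlift0
  have hL := hlift0.sub (hlift2.smul (-ε ^ 2))
  refine hL.unique ?_
  have hF := isLift_phys hd (by linarith : 2 ≤ ρ - 3) (by linarith : 0 ≤ ρ - 3)
    (Complex.I • elecForce α ρ (e t) (p t) (b t) i)
  have h3 : (0 : ℝ) - (ρ - 3) = 4 - (ρ + 1) := by ring
  rw [h3] at hF
  have h4 : jop (4 - (ρ + 1)) (Complex.I • elecForce α ρ (e t) (p t) (b t) i) =
      Complex.I • jop (4 - (ρ + 1)) (elecForce α ρ (e t) (p t) (b t) i) :=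
    mulOp_smul (bddSym_jb hs) _ _
  rw [h4] at hF
  refine hF.congr (Eventually.of_forall fun x => ?_)
  -- the equation of the system, with all terms but those with `E_t` on the Fourier side
  have hsp := symPart_eq_self ((hp t ht).conjRefl_eq hd (by linarith))
  have hsb := fun j => symPart_eq_self ((hb t ht j).conjRefl_eq hd (by linarith))
  have hforce := phys_elecForce hd α hρ (e t) (p t) (b t) x i
  simp only [hsp, hsb] at hforce
  have hEv : vecPhys (ρ + 1) (e t) = u.E t := by
    funext y j
    have hc : Continuous fun x => u.E t x j :=
      (continuous_apply j).comp (hu.smoothE t ht).continuous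
    exact congrFun ((he t ht j).phys_eq hd (by linarith) hc) y
  have hnv : (phys ρ (p t) x).re = u.n t x := by
    have hc : Continuous fun x => (u.n t x : ℂ) :=
      Complex.continuous_ofReal.comp (hu.smoothn t ht).continuous
    rw [(hp t ht).phys_eq hd (by linarith) hc, Complex.ofReal_re]
  have hBv : rePhys (ρ - 1) (b t) = u.B t := by
    funext y j
    have hc : Continuous fun x => (u.B t x j : ℂ) :=
      Complex.continuous_ofReal.comp
        ((continuous_apply j).comp (hu.smoothB t ht).continuous)
    rw [rePhys, (hb t ht j).phys_eq hd (by linarith) hc, Complex.ofReal_re]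
  rw [hEv, hnv, hBv] at hforce
  have hLL : lap (lap (u.Et t)) x i = lap (lap fun x => u.Et t x i) x := by
    have h1 : (fun y => lap (u.Et t) y i) = lap fun x => u.Et t x i :=
      funext fun y => lap_apply ((hu.smoothEt t ht).of_le (by norm_num)) y i
    have h2 : ContDiff ℝ (2 : ℕ) (lap (u.Et t)) := by
      refine contDiff_pi.2 fun j => ?_
      have h3 : (fun y => lap (u.Et t) y j) = lap fun x => u.Et t x j :=
        funext fun y => lap_apply ((hu.smoothEt t ht).of_le (by norm_num)) y j
      rw [h3]
      exact contDiff_lap (contDiff_pi.1 hsm j)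
    rw [lap_apply (by exact_mod_cast h2), h1]
  have heq := congrFun (hu.eqE t ht x) i
  simp only [Pi.add_apply, Pi.sub_apply, Pi.smul_apply, smul_eq_mul, Pi.zero_apply, hLL] at heq
  rw [phys_smul, hforce]
  beta_reduce
  rw [Complex.real_smul]
  push_cast
  linear_combination Complex.I * heq - (u.Et t x i + (ε : ℂ) ^ 2 *
    lap (lap fun x => u.Et t x i) x) * Complex.I_sq

/-- `Dispersion.exists_interaction` for a real solution of `f_tt = -θ² f - θ G` given in physical
space. The initial time derivative has to lie in the range of `θ`. -/
lemma Dispersion.exists_interaction_of_field (hd : d ≤ 3) {θ : Space d → ℝ} {κ : ℝ}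
    (hθ : Dispersion θ κ) {σ : ℝ} (hσ : 2 ≤ σ) {f f' f'' : ℝ → Space d → ℝ} {p G : ℝ → L2 d}
    {g : Space d → ℝ} {q₀ : L2 d} (hpc : ContinuousOn p (Ici 0))
    (hp : ∀ t, 0 ≤ t → IsLift (σ + 2 * κ) (fun x => (f t x : ℂ)) (p t))
    (hG : ContinuousOn G (Ici 0)) (hGJ : ∀ t, 0 ≤ t → conjRefl (G t) = G t)
    (hqJ : conjRefl q₀ = q₀)
    (hq : IsLift (σ + κ) (fun x => (g x : ℂ)) (mulOp (freqSym θ κ) q₀)) (hg : f' 0 =ᵐ[volume] g)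
    (hf : C1InH 0 (fun t x => (f t x : ℂ)) (fun t x => (f' t x : ℂ)))
    (hf' : C1InH 0 (fun t x => (f' t x : ℂ)) (fun t x => (f'' t x : ℂ)))
    (heq : ∀ t, 0 ≤ t → ∀ x, phys σ (waveAccel θ κ (p t) (G t)) x = (f'' t x : ℂ)) :
    ∃ w : ℝ → L2 d, w 0 = jop (-(2 * κ)) (p 0 + Complex.I • q₀) ∧
      ∀ t, 0 ≤ t → HasDerivWithinAt w (oscForce θ t (jop (-κ) (G t))) (Ici 0) t ∧
        symPart (osc θ t (w t)) = jop (-(2 * κ)) (p t) := by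
  have hκ := hθ.order_nonneg
  have hs0 : -σ ≤ 0 := by linarith
  have hfs := hθ.bddSym le_rfl
  have hcomb : ∀ {s : ℝ}, 0 ≤ s → ∀ h : L2 d,
      jop (-s) (mulOp (freqSym θ κ) h) = mulOp (freqSym θ (s + κ)) h := by
    intro s hs h
    refine mulOp_mulOp_eq (bddSym_jb (by linarith)) hfs (fun ξ => ?_) h
    rw [freqSym, freqSym, show -(s + κ) = -s + -κ by ring, jb_add]
    push_cast
    ring
  obtain ⟨s, hs, -⟩ := hf.2.1.exists_lift
  refine hθ.exists_interaction (by linarith : 0 ≤ σ) hpc hG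
    (fun t ht => (hp t ht).conjRefl_eq hd (by linarith)) hGJ hqJ (s := s) ?_ ?_ ?_
  · have h1 : IsLift 0 (fun x => (f' 0 x : ℂ)) (jop (0 - (σ + κ)) (mulOp (freqSym θ κ) q₀)) :=
      (hq.lower (by linarith)).congr (by
        filter_upwards [hg] with x hx
        rw [hx])
    rw [zero_sub, hcomb (by linarith)] at h1
    rw [← h1.unique (hs 0 le_rfl), add_assoc, ← two_mul]
  · have h1 := ((c1InH_iff (fun t ht => (hp t ht).lower (by linarith : 0 ≤ σ + 2 * κ)) hs).1 hf).2
    simpa only [zero_sub] using h1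
  · intro t ht
    have h2 : ∀ t, 0 ≤ t → IsLift 0 (fun x => (f'' t x : ℂ))
        (jop (-σ) (waveAccel θ κ (p t) (G t))) := fun t ht => by
      have h := isLift_phys hd hσ (by linarith : 0 ≤ σ) (waveAccel θ κ (p t) (G t))
      rw [zero_sub] at h
      exact h.congr (Eventually.of_forall (heq t ht))
    refine (((c1InH_iff hs h2).1 hf').2 t ht).congr_deriv ?_
    rw [waveAccel, map_neg, map_add, jop_mulOp hs0 hfs, hcomb (by linarith), hcomb (by linarith)]

lemma IsLift.lower_to {s σ τ : ℝ} (hs : s ≤ 0) (h : τ = σ + s) {f : Space d → ℂ} {F : L2 d}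
    (hF : IsLift σ f F) : IsLift τ f (jop s F) := by
  have := hF.lower (s := τ) (by linarith)
  rwa [show τ - σ = s by linarith] at this

/-- A solution in the class of the theorem is given by a curve of states which solves the
evolution equation, at a level where four derivatives have been given up. -/
theorem exists_state_of_solves (hd : d ≤ 3) {α ε ρ : ℝ} (hε : ε ∈ Ioo (0 : ℝ) 1) (hρ : 10 ≤ ρ)
    {D : Data d} {e₀ b₀ c₀ : Vec d} {p₀ q₀ : L2 d}
    (he₀ : ∀ i, IsLift (ρ + 1) (fun x => D.E₀ x i) (e₀ i))
    (hp₀ : IsLift (ρ + 2) (fun x => (D.n₀ x : ℂ)) p₀) (hqJ : conjRefl q₀ = q₀)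
    (hq₀ : IsLift (ρ + 1) (fun x => (D.n₁ x : ℂ)) (mulOp (freqSym wn 1) q₀))
    (hb₀ : ∀ i, IsLift (ρ + 3) (fun x => (D.B₀ x i : ℂ)) (b₀ i))
    (hcJ : ∀ i, conjRefl (c₀ i) = c₀ i)
    (hc₀ : ∀ i, IsLift (ρ + 1) (fun x => (D.B₁ x i : ℂ)) (mulOp (freqSym magFreq 2) (c₀ i)))
    {u : Fields d} (hu : u.Solves α ε D) (hc : u.InClass (ρ + 4))
    (ht : u.TimeRegular 4 0 0 0 0) :
    ∃ w : ℝ → State d,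
      w 0 = (e₀, jop (-2) (p₀ + Complex.I • q₀), fun i => jop (-4) (b₀ i + Complex.I • c₀ i)) ∧
      ∀ t, 0 ≤ t → HasDerivWithinAt w (stateField α ε ρ t (w t)) (Ici 0) t ∧
        u.E t = vecPhys (ρ + 1) (w t).1 ∧ u.n t = realPhys ρ (osc wn t (w t).2.1) ∧
        u.B t = rePhys (ρ - 1) (fun i => osc magFreq t ((w t).2.2 i)) := by
  choose eh heh hehc using fun i => (hc.contE i).exists_lift
  obtain ⟨ph, hph, hphc⟩ := hc.contn.exists_lift
  choose b hb hbc using fun i => (hc.contB i).exists_lift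
  let e : ℝ → Vec d := fun t i => jop (-4) (eh i t)
  let ev : ℝ → Vec d := fun t i => eh i t
  have hevc : ContinuousOn ev (Ici 0) := continuousOn_pi.2 hehc
  let p : ℝ → L2 d := fun t => jop (-2) (ph t)
  have hpc : ContinuousOn p (Ici 0) := (jop (-2)).continuous.comp_continuousOn hphc
  have hec : ContinuousOn e (Ici 0) :=
    continuousOn_pi.2 fun i => (jop (-4)).continuous.comp_continuousOn (hehc i)
  have he : ∀ t, 0 ≤ t → ∀ i, IsLift (ρ + 1) (fun x => u.E t x i) (e t i) := fun t ht i =>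
    (heh i t ht).lower_to (by norm_num) (by ring)
  have hp : ∀ t, 0 ≤ t → IsLift (ρ + 2) (fun x => (u.n t x : ℂ)) (p t) := fun t ht =>
    (hph t ht).lower_to (by norm_num) (by ring)
  have hb' : ∀ t, 0 ≤ t → ∀ i, IsLift (ρ + 3) (fun x => (u.B t x i : ℂ)) (b i t) :=
    fun t ht i => by
      have h := hb i t ht
      rwa [show ρ + 4 - 1 = ρ + 3 by ring] at h
  have hEc : ∀ t, 0 ≤ t → ∀ i, Continuous fun x => u.E t x i := fun t ht i =>
    (continuous_apply i).comp (hu.smoothE t ht).continuous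
  have hnc : ∀ t, 0 ≤ t → Continuous fun x => (u.n t x : ℂ) := fun t ht =>
    Complex.continuous_ofReal.comp (hu.smoothn t ht).continuous
  have hBc : ∀ t, 0 ≤ t → ∀ i, Continuous fun x => (u.B t x i : ℂ) := fun t ht i =>
    Complex.continuous_ofReal.comp ((continuous_apply i).comp (hu.smoothB t ht).continuous)
  have hEv : ∀ t, 0 ≤ t → u.E t = vecPhys (ρ + 1) (e t) := fun t ht =>
    funext fun x => funext fun i =>
      (congrFun ((he t ht i).phys_eq hd (by linarith) (hEc t ht i)) x).symm
  have hEv5 : ∀ t, 0 ≤ t → u.E t = vecPhys (ρ + 5) (ev t) := fun t ht =>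
    funext fun x => funext fun i => by
      have h := heh i t ht
      rw [show ρ + 4 + 1 = ρ + 5 by ring] at h
      exact (congrFun (h.phys_eq hd (by linarith) (hEc t ht i)) x).symm
  -- both forces are formed from `E` at the highest level `ρ + 5` and lowered afterwards
  have hn := dispersion_wn.exists_interaction_of_field hd (σ := ρ) (by linarith) hpc
    (f := u.n) (f' := u.nt) (f'' := u.ntt)
    (G := fun t => jop (-1) (mulOp waveSym (jop (-2) (dens (ρ + 5) (ev t))))) (g := D.n₁) (q₀ := q₀)
    (fun t ht => by rw [mul_one]; exact hp t ht)
    ((jop (-1)).continuous.comp_continuousOn ((mulOp waveSym).continuous.comp_continuousOn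
      ((jop (-2)).continuous.comp_continuousOn ((continuous_dens _).comp_continuousOn hevc))))
    (fun t _ => by
      rw [← jop_conjRefl (by norm_num), jop_dens hd (τ := ρ + 3) (by norm_num) (by ring)
        (by linarith), conjRefl_waveForce hd (by linarith)])
    hqJ hq₀ hu.initnt ht.derivn ht.derivnt (fun t ht => by
      intro x
      have h2 := phys_waveAccel_wn hd (by linarith : 4 ≤ ρ + 2) (p t)
        (jop (-2) (dens (ρ + 5) (ev t))) x
      rw [show ρ + 2 - 2 = ρ by ring, (hp t ht).phys_eq hd (by linarith) (hnc t ht),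
        phys_jop (σ := ρ + 5) (by norm_num) (by ring)] at h2
      rw [h2]
      have hS : phys (ρ + 5) (dens (ρ + 5) (ev t)) = fun x => (normSq (u.E t) x : ℂ) :=
        funext fun x => by rw [phys_dens hd (by linarith), hEv5 t ht]
      have hS2 : ContDiff ℝ 2 (normSq (u.E t)) := by
        have h1 : normSq (u.E t) = realPhys (ρ + 5) (dens (ρ + 5) (ev t)) := by
          funext x
          rw [realPhys, hS, Complex.ofReal_re]
        rw [h1]
        exact contDiff_realPhys hd 2 (by norm_num; linarith) _
      rw [hS, ← ofReal_lap (hu.smoothn t ht), ← ofReal_lap hS2, ← Complex.ofReal_add,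
        ← hu.eqn t ht x]
      congr 1
      ring)
  obtain ⟨z, hz0, hz⟩ := hn
  have hB := fun i => dispersion_magFreq.exists_interaction_of_field hd (σ := ρ - 1) (by linarith)
    (hbc i) (f := fun t x => u.B t x i) (f' := fun t x => u.Bt t x i)
    (f'' := fun t x => u.Btt t x i)
    (G := fun t => jop (-2) (mulOp magSym (mag (ρ + 5) (ev t) i)))
    (g := fun x => D.B₁ x i) (q₀ := c₀ i)
    (fun t ht => by rw [show ρ - 1 + 2 * 2 = ρ + 3 by ring]; exact hb' t ht i)
    ((jop (-2)).continuous.comp_continuousOn ((mulOp magSym).continuous.comp_continuousOn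
      (((continuous_apply i).comp (continuous_mag _)).comp_continuousOn hevc)))
    (fun t _ => by
      rw [← jop_conjRefl (by norm_num), conjRefl_magForce hd (by linarith)])
    (hcJ i) (by rw [show ρ - 1 + 2 = ρ + 1 by ring]; exact hc₀ i)
    (by filter_upwards [hu.initBt] with x hx; rw [hx])
    (ht.derivB i) (ht.derivBt i) (fun t ht => by
      intro x
      have h2 := phys_waveAccel_magFreq hd (by linarith : 6 ≤ ρ + 3) (b i t)
        (mag (ρ + 5) (ev t) i) x
      rw [show ρ + 3 - 4 = ρ - 1 by ring, show ρ + 3 + 2 = ρ + 5 by ring] at h2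
      rw [h2]
      have hBv : complexify (u.B t) = vecPhys (ρ + 3) (fun j => b j t) :=
        funext fun y => funext fun j =>
          (congrFun ((hb' t ht j).phys_eq hd (by linarith) (hBc t ht j)) y).symm
      have heq := congrFun (hu.eqB t ht x) i
      rw [hBv, hEv5 t ht, crossConj_vecPhys hd (by linarith), lap_vecPhys hd (by linarith),
        lap_vecPhys hd (by linarith), lap_vecPhys hd (by linarith),
        lap_vecPhys hd (by linarith)] at heq
      simp only [Pi.add_apply, Pi.sub_apply, Pi.smul_apply, smul_eq_mul, vecPhys,
        complexify] at heq
      rw [lap_phys hd (by linarith), lap_phys hd (by linarith), lap_phys hd (by linarith),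
        lap_phys hd (by linarith)]
      linear_combination -heq)
  choose y hy0 hy using hB
  have hp2 : ∀ t, 0 ≤ t → IsLift ρ (fun x => (u.n t x : ℂ)) (jop (-2) (p t)) := fun t ht =>
    (hp t ht).lower_to (by norm_num) (by ring)
  have hb4 : ∀ t, 0 ≤ t → ∀ i, IsLift (ρ - 1) (fun x => (u.B t x i : ℂ)) (jop (-4) (b i t)) :=
    fun t ht i => (hb' t ht i).lower_to (by norm_num) (by ring)
  have hzs : ∀ t, 0 ≤ t → symPart (osc wn t (z t)) = jop (-2) (p t) := fun t ht => by
    rw [(hz t ht).2, mul_one]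
  have hys : ∀ t, 0 ≤ t → ∀ i, symPart (osc magFreq t (y i t)) = jop (-4) (b i t) :=
    fun t ht i => by
      rw [(hy i t ht).2]
      norm_num
  have hEd := hu.hasDerivWithinAt_elec hd hε (by linarith : 5 ≤ ρ) ht.derivE hec
    ((jop (-2)).continuous.comp_continuousOn hpc)
    (continuousOn_pi.2 fun i => (jop (-4)).continuous.comp_continuousOn (hbc i)) he hp2 hb4
  refine ⟨fun t => (e t, z t, fun i => y i t), ?_, fun t ht => ⟨?_, hEv t ht, ?_, ?_⟩⟩
  · have h1 : e 0 = e₀ := funext fun i => (he 0 le_rfl i).unique ((he₀ i).congr (by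
      filter_upwards [hu.initE] with x hx
      rw [hx]))
    have h2 : p 0 = p₀ := (hp 0 le_rfl).unique (hp₀.congr (by
      filter_upwards [hu.initn] with x hx
      rw [hx]))
    have h3 : ∀ i, b i 0 = b₀ i := fun i => (hb' 0 le_rfl i).unique ((hb₀ i).congr (by
      filter_upwards [hu.initB] with x hx
      rw [hx]))
    simp only [h1, hz0, h2, hy0, h3]
    norm_num
  · rw [stateField]
    simp only [hzs t ht, hys t ht]
    refine (hEd t ht).prodMk (HasDerivWithinAt.prodMk ?_ (hasDerivWithinAt_pi.2 fun i => ?_))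
    · refine (hz t ht).1.congr_deriv ?_
      congr 1
      rw [jop_jop (by norm_num) (by norm_num), jop_mulOp (by norm_num) bddSym_waveSym,
        jop_jop (by norm_num) (by norm_num),
        jop_dens hd (τ := ρ + 1) (by norm_num) (by ring) (by linarith)]
      norm_num
      rfl
    · refine (hy i t ht).1.congr_deriv ?_
      congr 1
      rw [jop_jop (by norm_num) (by norm_num), jop_mulOp (by norm_num) bddSym_magSym,
        jop_mag hd (τ := ρ + 1) (by norm_num) (by ring) (by linarith)]
      norm_num
      rfl
  · funext x
    have h1 := congrFun ((hp2 t ht).phys_eq hd (by linarith) (hnc t ht)) x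
    rw [← hzs t ht, ← ofReal_realPhys hd (by linarith)] at h1
    exact (Complex.ofReal_injective h1).symm
  · funext x i
    have h1 := congrFun ((hb4 t ht i).phys_eq hd (by linarith) (hBc t ht i)) x
    rw [← hys t ht, ← ofReal_realPhys hd (by linarith)] at h1
    exact (Complex.ofReal_injective h1).symm

/-! ### Uniqueness -/

lemma MemH.mono {s σ : ℝ} (h : s ≤ σ) {f : Space d → ℂ} (hf : MemH σ f) : MemH s f := by
  obtain ⟨F, hF⟩ := hf.exists_isLift
  exact (hF.lower h).memH

lemma C1InH.mono {s σ : ℝ} (h : s ≤ σ) {u u' : ℝ → Space d → ℂ} (hu : C1InH σ u u') :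
    C1InH s u u' := by
  obtain ⟨F, hF, -⟩ := hu.1.exists_lift
  obtain ⟨F', hF', -⟩ := hu.2.1.exists_lift
  obtain ⟨h1, h2⟩ := (c1InH_iff hF hF').1 hu
  exact (c1InH_iff (fun t ht => (hF t ht).lower h) (fun t ht => (hF' t ht).lower h)).2
    ⟨(jop (s - σ)).continuous.comp_continuousOn h1, fun t ht =>
      hasDerivWithinAt_clm (jop (s - σ)) (h2 t ht)⟩

lemma Fields.TimeRegular.mono {u : Fields d} {a b b' c c' a₁ b₁ b₁' c₁ c₁' : ℝ}
    (h : u.TimeRegular a b b' c c') (ha : a₁ ≤ a) (hb : b₁ ≤ b) (hb' : b₁' ≤ b') (hc : c₁ ≤ c)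
    (hc' : c₁' ≤ c') : u.TimeRegular a₁ b₁ b₁' c₁ c₁' :=
  ⟨fun i => (h.derivE i).mono ha, h.derivn.mono hb, h.derivnt.mono hb',
    fun i => (h.derivB i).mono hc, fun i => (h.derivBt i).mono hc'⟩

/-- Two solutions with the same data start from the same state, because the auxiliary initial values
`q₀` and `c₀` are chosen in terms of the data. -/
theorem Fields.Solves.unique (hd : d ≤ 3) (hd0 : 0 < d) {α ε r : ℝ} (hε : ε ∈ Ioo (0 : ℝ) 1)
    (hr : 20 ≤ r) {D : Data d} (hD : D.Admissible r) {u v : Fields d}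
    (hu : u.Solves α ε D) (huc : u.InClass r) (hut : u.TimeRegular 4 0 0 0 0)
    (hv : v.Solves α ε D) (hvc : v.InClass r) (hvt : v.TimeRegular 4 0 0 0 0)
    {t : ℝ} (ht : 0 ≤ t) : v.E t = u.E t ∧ v.n t = u.n t ∧ v.B t = u.B t := by
  obtain ⟨ρ, rfl⟩ : ∃ ρ, r = ρ + 4 := ⟨r - 4, by ring⟩
  choose e₀ he using fun i => ((hD.memE₀ i).mono (by linarith : ρ + 1 ≤ _)).exists_isLift
  obtain ⟨p₀, hp⟩ := (hD.memn₀.mono (by linarith : ρ + 2 ≤ _)).exists_isLift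
  obtain ⟨q₀, hqJ, hq⟩ := dispersion_wn.exists_div hd hd0 (σ := ρ + 2) (by linarith) le_rfl
    (hD.memn₁.mono (by linarith)) hD.memn₁'
  choose b₀ hb using fun i => ((hD.memB₀ i).mono (by linarith : ρ + 3 ≤ _)).exists_isLift
  choose c₀ hcJ hc using fun i => dispersion_magFreq.exists_div hd hd0 (σ := ρ + 3)
    (by linarith) (by norm_num) ((hD.memB₁ i).mono (by linarith)) (hD.memB₁' i)
  rw [show ρ + 2 - 1 = ρ + 1 by ring] at hq
  simp only [show ρ + 3 - 2 = ρ + 1 by ring] at hc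
  obtain ⟨w, hw0, hw⟩ := exists_state_of_solves hd hε (by linarith) he hp hqJ hq hb hcJ hc hu huc
    hut
  obtain ⟨w', hw0', hw'⟩ := exists_state_of_solves hd hε (by linarith) he hp hqJ hq hb hcJ hc hv
    hvc hvt
  have h := state_unique (hw0.trans hw0'.symm) (fun t ht => (hw t ht).1)
    (fun t ht => (hw' t ht).1) ht
  obtain ⟨-, h1, h2, h3⟩ := hw t ht
  obtain ⟨-, h1', h2', h3'⟩ := hw' t ht
  rw [h1, h2, h3, h1', h2', h3', h]
  exact ⟨rfl, rfl, rfl⟩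

end MagneticZakharov

end

open MagneticZakharov
theorem theorem3p1 (d : ℕ) (hd : d = 2 ∨ d = 3) (α : ℝ) (hα : 1 ≤ α)
    (ε : ℝ) (hε : ε ∈ Set.Ioo (0 : ℝ) 1)
    (s r : ℝ) (hs : (d : ℝ) / 2 < s) (hr : (d : ℝ) / 2 + s + 100 < r)
    (D : Data d) (hD : D.Admissible r) :
    ∃ u : Fields d,
      u.Solves α ε D ∧ u.InClass r ∧
      u.TimeRegular (r + 1) (r - 1) (r - 2) (r - 3) (r - 5) ∧
      ∀ v : Fields d, v.Solves α ε D → v.InClass r → v.TimeRegular 4 0 0 0 0 →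
        ∀ t : ℝ, 0 ≤ t → v.E t = u.E t ∧ v.n t = u.n t ∧ v.B t = u.B t := by
  have hd3 : d ≤ 3 := by omega
  have hd0 : 0 < d := by omega
  have hr20 : 20 ≤ r := by
    have : (0 : ℝ) ≤ d := Nat.cast_nonneg d
    linarith
  obtain ⟨u, hu, huc, hut⟩ := exists_solution hd3 hd0 α hε hr20 hD
  refine ⟨u, hu, huc, hut, fun v hv hvc hvt t ht => ?_⟩
  exact hu.unique hd3 hd0 hε hr20 hD huc (hut.mono (by linarith) (by linarith) (by linarith)
    (by linarith) (by linarith)) hv hvc hvt ht
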